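/- **Setting.** Let $(W,\lambda)$ be a Liouville domain of dimension $2n\ge 2$: a compact connected $2n$-dimensional smooth manifold with boundary with a smooth one-form $\lambda$ such that $\omega=d\lambda$ is symplectic and the Liouville vector field $Y$, $\iota_Y\omega=\lambda$, points strictly outwards along $\partial W$. Put $\alpha=\lambda|_{\partial W}$, and let $\hat W=W\cup_{\partial W}(\partial W\times[1,+\infty[)$ be its completion. The flow of $Y$ gives an open embedding $\partial W\times\,]0,+\infty[\;\hookrightarrow\hat W$, whose second coordinate is denoted by $\rho$ and under which $\lambda=\rho\alpha$; $\partial W\times\{1\}$ is the boundary of $W$. Put $\mathbb T=\mathbb R/\mathbb Z$, and for $H\in C^\infty(\hat W)$ let $X_H$ be defined by $\iota_{X_H}\omega=-dH$. Let $J_t$, $t\in\mathbb T$, be a smooth loop of almost complex structures on $\hat W$ such that $\langle\cdot,\cdot\rangle_t=\omega(J_t\cdot,\cdot)$ is a Riemannian metric for every $t$; write $|\cdot|_t$ for its norm. For a smooth loop $x:\mathbb T\to\hat W$ and $\eta\in\mathbb R$ put $$\mathbb A_H(x,\eta)=\int_{\mathbb T}x^*\lambda-\eta\int_{\mathbb T}H(x(t))\,dt,\qquad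 \|\nabla\mathbb A_H(x,\eta)\|^2=\int_{\mathbb T}\bigl|J_t(x)\bigl(x'-\eta X_H(x)\bigr)\bigr|_t^2\,dt+\Bigl(\int_{\mathbb T}H(x(t))\,dt\Bigr)^2 .$$ **Statement.** Let $\rho_0>0$ and assume that $J_t$ is of contact type on $\partial W\times[\rho_0,+\infty[$, i.e. $d\rho\circ J_t=\lambda$ there for every $t$. Let $\{H_s\}_{s\in\mathbb R}$ be a smooth family of Hamiltonians on $\hat W$ with $H_s=H_0$ for $s\le0$ and $H_s=H_1$ for $s\ge1$, such that for some $\theta>0$ $$\lambda(X_{H_s}(w))-H_s(w)\ge\theta\quad\text{for all } s\in\mathbb R \text{ and } w\in\hat W \text{ with } H_s(w)=0,$$ and such that $H_s(x,\rho)=h(s,\rho)$ on $\partial W\times[\rho_0,+\infty[$ for all $s$, where $h:\mathbb R\times[\rho_0,+\infty[\to\mathbb R$ is smooth and satisfies, for some constant $\kappa>0$ and all $(s,\rho)\in\mathbb R\times[\rho_0,+\infty[$, * (a) $\dfrac{\partial h}{\partial\rho}(s,\rho)\ge0$; * (b′) $\inf\{h(s,\rho): s\in\mathbb R,\ \rho\ge\rho_0\}>0$;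 * (c′) $\Bigl|\dfrac{\partial h}{\partial\rho}\Bigr|^2\le\kappa(h+1)$, $\ \rho^2\Bigl|\dfrac{\partial^2h}{\partial\rho^2}\Bigr|^2\le\kappa(h+1)$, $\ \Bigl|\dfrac{\partial^2h}{\partial s\,\partial\rho}\Bigr|^2\le\kappa(h+1)$. Then for every pair of real numbers $A,E$ there is a compact set $K=K(A,E)\subset\hat W$ such that for every solution $v=(u,\eta)$, with $u:\mathbb R\times\mathbb T\to\hat W$ smooth and $\eta:\mathbb R\to\mathbb R$, of $$\frac{\partial u}{\partial s}+J_t(u)\Bigl(\frac{\partial u}{\partial t}-\eta X_{H_s}(u)\Bigr)=0,\qquad \frac{d\eta}{ds}=\int_{\mathbb T}H_s(u)\,dt$$ with $\sup_{s\in\mathbb R}|\mathbb A_{H_s}(v(s))|\le A$ and $\int_{-\infty}^{+\infty}\|\nabla\mathbb A_{H_s}(v(s))\|^2\,ds\le E$, one has $u(s,t)\in K$ for all $(s,t)\in\mathbb R\times\mathbb T$. Moreover, every real polynomial $h=h(\rho)$ (independent of $s$) of degree at most two with positive leading coefficient satisfies (a), (b′) and (c′) on $[\rho_0,+\infty[$,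 with a suitable $\kappa>0$, for all sufficiently large $\rho_0$. -/

import Mathlib

open Set MeasureTheory Bundle
open scoped Manifold ContDiff

noncomputable section

namespace RabinowitzFloer

/-! ### One-forms on manifolds with corners -/

section OneForms

variable {E : Type*} [NormedAddCommGroup E] [NormedSpace ℝ E]
  {H : Type*} [TopologicalSpace H] (I : ModelWithCorners ℝ E H)
  {M : Type*} [TopologicalSpace M] [ChartedSpace H M]

/-- One-forms on `M` (no smoothness required). -/
abbrev OneForm : Type _ := ∀ x : M, TangentSpace I x →L[ℝ] ℝ

variable {I}

/-- Smoothness of a one-form, as a section of the cotangent bundle. -/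
def OneForm.IsSmooth [IsManifold I ∞ M] (lam : OneForm I (M := M)) : Prop :=
  ContMDiff I (I.prod 𝓘(ℝ, E →L[ℝ] ℝ)) ∞
    (fun x => (TotalSpace.mk' (E →L[ℝ] ℝ) x (lam x) :
      TotalSpace (E →L[ℝ] ℝ) (fun x : M => TangentSpace I x →L[ℝ] Trivial M ℝ x)))

/-- The one-form `lam` read in the preferred chart at `x`, as a function on the model space. -/
def OneForm.inChart [IsManifold I ∞ M] (lam : OneForm I (M := M)) (x : M) : E → E →L[ℝ] ℝ :=
  fun y => (lam ((extChartAt I x).symm y)).comp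
    (mfderivWithin 𝓘(ℝ, E) I (extChartAt I x).symm (range I) y)

/-- The exterior derivative `d lam` at `x`, namely
`d lam (v, w) = D_v (lam w) - D_w (lam v)` in the preferred chart at `x`. The tangent space at `x`
is identified with the model space through the differential of that chart; at boundary points
derivatives are taken within the model domain. -/
def OneForm.d [IsManifold I ∞ M] (lam : OneForm I (M := M)) (x : M) :
    TangentSpace I x →L[ℝ] TangentSpace I x →L[ℝ] ℝ :=
  let D : E →L[ℝ] E →L[ℝ] ℝ := fderivWithin ℝ (lam.inChart x) (range I) (extChartAt I x x)
  let c : E →L[ℝ] E := mfderiv I 𝓘(ℝ, E) (extChartAt I x) x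
  let B : E →L[ℝ] E →L[ℝ] ℝ := (D - D.flip).bilinearComp c c
  B

/-- `d lam` is nondegenerate at every point, i.e. it is a symplectic form. -/
def OneForm.IsSymplectic [IsManifold I ∞ M] (lam : OneForm I (M := M)) : Prop :=
  ∀ (x : M) (v : TangentSpace I x), (∀ w : TangentSpace I x, lam.d x v w = 0) → v = 0

/-- The vector `v` at `x` with `d lam (v, ·) = ξ` (when `d lam` is nondegenerate). -/
def OneForm.sharp [IsManifold I ∞ M] (lam : OneForm I (M := M)) (x : M)
    (ξ : TangentSpace I x →L[ℝ] ℝ) : TangentSpace I x :=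
  (ContinuousLinearMap.inverse (lam.d x)) ξ

theorem OneForm.d_sharp [IsManifold I ∞ M] [FiniteDimensional ℝ E] {lam : OneForm I (M := M)}
    (hlam : lam.IsSymplectic) (x : M) (ξ : TangentSpace I x →L[ℝ] ℝ) (w : TangentSpace I x) :
    lam.d x (lam.sharp x ξ) w = ξ w := by
  let B : E →L[ℝ] E →L[ℝ] ℝ := lam.d x
  have hinj : Function.Injective B := by
    rw [injective_iff_map_eq_zero]
    intro v hv
    exact hlam x v fun w => by
      change B v w = 0
      rw [hv]; rfl
  have hdim : Module.finrank ℝ E = Module.finrank ℝ (E →L[ℝ] ℝ) := by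
    rw [← LinearEquiv.finrank_eq (LinearMap.toContinuousLinearMap (𝕜 := ℝ) (E := E) (F' := ℝ))]
    exact (Subspace.dual_finrank_eq (K := ℝ) (V := E)).symm
  have e : ∃ e : E ≃L[ℝ] (E →L[ℝ] ℝ), (e : E →L[ℝ] E →L[ℝ] ℝ) = B := by
    refine ⟨(LinearEquiv.ofInjectiveOfFinrankEq B.toLinearMap hinj hdim).toContinuousLinearEquiv,
      ?_⟩
    ext v w
    rfl
  obtain ⟨e, he⟩ := e
  change B (ContinuousLinearMap.inverse B ξ) w = ξ w
  rw [← he, ContinuousLinearMap.inverse_equiv]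
  exact DFunLike.congr_fun (e.apply_symm_apply (ξ : E →L[ℝ] ℝ)) (w : E)

/-- The Liouville vector field `Y`: `d lam (Y, ·) = lam`. -/
def OneForm.liouvilleField [IsManifold I ∞ M] (lam : OneForm I (M := M)) (x : M) :
    TangentSpace I x :=
  lam.sharp x (lam x)

/-- The Hamiltonian vector field `X_F` of `F`: `d lam (X_F, ·) = - dF`. -/
def OneForm.hamiltonianField [IsManifold I ∞ M] (lam : OneForm I (M := M)) (F : M → ℝ) (x : M) :
    TangentSpace I x :=
  lam.sharp x (-(mfderiv I 𝓘(ℝ, ℝ) F x : TangentSpace I x →L[ℝ] ℝ))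

end OneForms

/-! ### Liouville domains and their completions -/

section Liouville

variable {n : ℕ} [NeZero (2 * n)]
  {W : Type*} [TopologicalSpace W] [ChartedSpace (EuclideanHalfSpace (2 * n)) W]
  [IsManifold (𝓡∂ (2 * n)) ∞ W]
  {P : Type*} [TopologicalSpace P] [ChartedSpace (EuclideanSpace ℝ (Fin (2 * n - 1))) P]
  [IsManifold (𝓡 (2 * n - 1)) ∞ P]

/-- `(W, lam)` is a Liouville domain: `W` is a compact connected `2n`-dimensional manifold with
boundary, `d lam` is symplectic, and the Liouville vector field points strictly outwards along the
boundary. The model domain is the half-space `{x | 0 ≤ x 0}`, so a vector at a boundary point points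
strictly outwards if and only if its coordinate `0` in the preferred chart is negative. -/
structure IsLiouvilleDomain (lam : OneForm (𝓡∂ (2 * n)) (M := W)) : Prop where
  compact : CompactSpace W
  connected : ConnectedSpace W
  hausdorff : T2Space W
  smooth : lam.IsSmooth
  symplectic : lam.IsSymplectic
  outward : ∀ x ∈ (𝓡∂ (2 * n)).boundary W,
    let y : EuclideanSpace ℝ (Fin (2 * n)) :=
      mfderiv (𝓡∂ (2 * n)) 𝓘(ℝ, EuclideanSpace ℝ (Fin (2 * n))) (extChartAt (𝓡∂ (2 * n)) x) x
        (lam.liouvilleField x)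
    y 0 < 0

variable (n) in
/-- `b : P → W` identifies the manifold `P` with the boundary of `W`, as a submanifold. -/
structure IsBoundaryInclusion (b : P → W) : Prop where
  smooth : ContMDiff (𝓡 (2 * n - 1)) (𝓡∂ (2 * n)) ∞ b
  embedding : Topology.IsEmbedding b
  immersion : ∀ x, Function.Injective (mfderiv (𝓡 (2 * n - 1)) (𝓡∂ (2 * n)) b x)
  range_eq : range b = (𝓡∂ (2 * n)).boundary W

/-- The boundaryless manifold `X` with the one-form `lam` is the completion
`W ∪ (∂W × [1, ∞))` of the Liouville domain `(W, lamW)`, where `b : P → W` is the boundary of `W`.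

`incl` is the inclusion of `W`, and `collar` is the canonical chart `∂W × (0, ∞) → X` which on
`∂W × (0, 1]` is given by the Liouville flow and on `∂W × [1, ∞)` is the glued cylinder. The
identity `collar^* lam = ρ α`, with `α = b^* lamW`, is equivalent to `collar^* Y = ρ ∂/∂ρ` together
with `collar (x, 1) = b x`. -/
structure Completion (lamW : OneForm (𝓡∂ (2 * n)) (M := W)) (b : P → W)
    (X : Type*) [TopologicalSpace X] [ChartedSpace (EuclideanSpace ℝ (Fin (2 * n))) X]
    [IsManifold (𝓡 (2 * n)) ∞ X] where
  /-- the Liouville form of the completion -/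
  lam : OneForm (𝓡 (2 * n)) (M := X)
  lam_smooth : lam.IsSmooth
  lam_symplectic : lam.IsSymplectic
  /-- the inclusion of the Liouville domain -/
  incl : W → X
  incl_smooth : ContMDiff (𝓡∂ (2 * n)) (𝓡 (2 * n)) ∞ incl
  incl_injective : Function.Injective incl
  incl_pullback : ∀ (w : W) (v : TangentSpace (𝓡∂ (2 * n)) w),
    lam (incl w) (mfderiv (𝓡∂ (2 * n)) (𝓡 (2 * n)) incl w v) = lamW w v
  /-- the diffeomorphism from `∂W × (0, ∞)` onto an open subset of `X` -/
  collar : OpenPartialHomeomorph (P × ℝ) X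
  collar_source : collar.source = univ ×ˢ Ioi 0
  collar_smooth :
    ContMDiffOn ((𝓡 (2 * n - 1)).prod 𝓘(ℝ, ℝ)) (𝓡 (2 * n)) ∞ collar collar.source
  collar_symm_smooth :
    ContMDiffOn (𝓡 (2 * n)) ((𝓡 (2 * n - 1)).prod 𝓘(ℝ, ℝ)) ∞ collar.symm collar.target
  collar_one : ∀ x : P, collar (x, 1) = incl (b x)
  collar_pullback : ∀ (x : P) (ρ : ℝ), 0 < ρ →
    ∀ (v : TangentSpace (𝓡 (2 * n - 1)) x) (r : ℝ),
      lam (collar (x, ρ))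
        (mfderiv ((𝓡 (2 * n - 1)).prod 𝓘(ℝ, ℝ)) (𝓡 (2 * n)) collar (x, ρ)
          ((v, r) : TangentSpace ((𝓡 (2 * n - 1)).prod 𝓘(ℝ, ℝ)) (x, ρ)))
      = ρ * lamW (b x) (mfderiv (𝓡 (2 * n - 1)) (𝓡∂ (2 * n)) b x v)
  disjoint : Disjoint (range incl) (collar '' (univ ×ˢ Ioi 1))
  cover : range incl ∪ collar '' (univ ×ˢ Ioi 1) = univ

namespace Completion

variable {lamW : OneForm (𝓡∂ (2 * n)) (M := W)} {b : P → W}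
  {X : Type*} [TopologicalSpace X] [ChartedSpace (EuclideanSpace ℝ (Fin (2 * n))) X]
  [IsManifold (𝓡 (2 * n)) ∞ X]

/-- The radial coordinate `ρ` on `∂W × (0, ∞) ⊆ X` (with junk values elsewhere). -/
def radius (C : Completion lamW b X) (w : X) : ℝ := (C.collar.symm w).2

/-- The end `∂W × [ρ₀, ∞)` as a subset of the completion. -/
def cylEnd (C : Completion lamW b X) (ρ₀ : ℝ) : Set X := C.collar '' (univ ×ˢ Ici ρ₀)

end Completion

end Liouville

/-! ### The Rabinowitz-Floer equation

The circle is `ℝ / ℤ`: maps on it are `1`-periodic maps on `ℝ`. -/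

section Floer

variable {m : ℕ} {X : Type*} [TopologicalSpace X] [ChartedSpace (EuclideanSpace ℝ (Fin m)) X]
  [IsManifold (𝓡 m) ∞ X]

/-- A (time-dependent) field of endomorphisms of the tangent bundle. -/
abbrev EndLoop (m : ℕ) (X : Type*) [TopologicalSpace X]
    [ChartedSpace (EuclideanSpace ℝ (Fin m)) X] : Type _ :=
  ℝ → ∀ x : X, TangentSpace (𝓡 m) x →L[ℝ] TangentSpace (𝓡 m) x

/-- `J` is a smooth loop of almost complex structures compatible with `ω = d lam`, in the sense that
`ω (J_t ·, ·)` is a Riemannian metric for every `t`. -/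
structure IsCompatibleLoop (lam : OneForm (𝓡 m) (M := X)) (J : EndLoop m X) : Prop where
  periodic : ∀ t x, J (t + 1) x = J t x
  smooth : ContMDiff (𝓘(ℝ, ℝ).prod (𝓡 m))
    ((𝓡 m).prod 𝓘(ℝ, EuclideanSpace ℝ (Fin m) →L[ℝ] EuclideanSpace ℝ (Fin m))) ∞
    (fun p : ℝ × X =>
      (TotalSpace.mk' (EuclideanSpace ℝ (Fin m) →L[ℝ] EuclideanSpace ℝ (Fin m)) p.2 (J p.1 p.2) :
        TotalSpace (EuclideanSpace ℝ (Fin m) →L[ℝ] EuclideanSpace ℝ (Fin m))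
          (fun x : X => TangentSpace (𝓡 m) x →L[ℝ] TangentSpace (𝓡 m) x)))
  sq : ∀ t x (v : TangentSpace (𝓡 m) x), J t x (J t x v) = -v
  symm : ∀ t x (v w : TangentSpace (𝓡 m) x), lam.d x (J t x v) w = lam.d x (J t x w) v
  pos : ∀ t x (v : TangentSpace (𝓡 m) x), v ≠ 0 → 0 < lam.d x (J t x v) v

/-- The velocity of a curve. -/
def velocity (x : ℝ → X) (t : ℝ) : TangentSpace (𝓡 m) (x t) :=
  mfderiv 𝓘(ℝ, ℝ) (𝓡 m) x t (1 : ℝ)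

/-- The Rabinowitz action `𝔸_F (x, η) = ∫ x^* lam - η ∫ F (x (t)) dt`. -/
def action (lam : OneForm (𝓡 m) (M := X)) (F : X → ℝ) (x : ℝ → X) (η : ℝ) : ℝ :=
  (∫ t in (0 : ℝ)..1, lam (x t) (velocity x t)) - η * ∫ t in (0 : ℝ)..1, F (x t)

/-- The loop component `J_t (x) (x' - η X_F (x))` of the gradient of the action with respect to the
`L²`-metric induced by `ω (J_t ·, ·)`. -/
def gradLoop (lam : OneForm (𝓡 m) (M := X)) (J : EndLoop m X) (F : X → ℝ) (x : ℝ → X) (η : ℝ)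
    (t : ℝ) : TangentSpace (𝓡 m) (x t) :=
  J t (x t) (velocity x t - η • lam.hamiltonianField F (x t))

/-- The square norm `‖∇𝔸_F (x, η)‖²` of the gradient of the action, whose `ℝ`-component is
`- ∫ F (x (t)) dt`. -/
def gradNormSq (lam : OneForm (𝓡 m) (M := X)) (J : EndLoop m X) (F : X → ℝ) (x : ℝ → X) (η : ℝ) :
    ℝ :=
  (∫ t in (0 : ℝ)..1,
      lam.d (x t) (J t (x t) (gradLoop lam J F x η t)) (gradLoop lam J F x η t))
    + (-∫ t in (0 : ℝ)..1, F (x t)) ^ 2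

/-- `(u, η)` is a solution on `ℝ × ℝ/ℤ` of the Rabinowitz-Floer equation of the family `Ham`:
`∂ₛu + J_t(u) (∂ₜu - η X_{H_s}(u)) = 0` and `η' = ∫ H_s(u) dt`. -/
structure IsSolution (lam : OneForm (𝓡 m) (M := X)) (J : EndLoop m X) (Ham : ℝ → X → ℝ)
    (u : ℝ → ℝ → X) (η : ℝ → ℝ) : Prop where
  smooth : ContMDiff 𝓘(ℝ, ℝ × ℝ) (𝓡 m) ∞ (fun p : ℝ × ℝ => u p.1 p.2)
  periodic : ∀ s t, u s (t + 1) = u s t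
  loop_eq : ∀ s t,
    (velocity (fun σ => u σ t) s : TangentSpace (𝓡 m) (u s t))
      + J t (u s t)
        (velocity (fun τ => u s τ) t - η s • lam.hamiltonianField (Ham s) (u s t)) = 0
  multiplier_eq : ∀ s, HasDerivAt η (∫ t in (0 : ℝ)..1, Ham s (u s t)) s

end Floer

/-! ### Radial profiles -/

/-- The partial derivative `∂h/∂ρ` on `ℝ × [ρ₀, ∞)` (one-sided at `ρ₀`). -/
def dRho (ρ₀ : ℝ) (h : ℝ → ℝ → ℝ) (s ρ : ℝ) : ℝ := derivWithin (h s) (Ici ρ₀) ρ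

/-- The conditions on the smooth function `h = h (s, ρ)` on `ℝ × [ρ₀, ∞)`:
`∂h/∂ρ ≥ 0`, `inf h > 0`, and `|∂h/∂ρ|²`, `ρ² |∂²h/∂ρ²|²`, `|∂²h/∂s∂ρ|²` are at most
`κ (h + 1)`. -/
structure IsAdmissibleProfile (ρ₀ κ : ℝ) (h : ℝ → ℝ → ℝ) : Prop where
  smooth : ContDiffOn ℝ ∞ (fun p : ℝ × ℝ => h p.1 p.2) (univ ×ˢ Ici ρ₀)
  monotone : ∀ s, ∀ ρ ≥ ρ₀, 0 ≤ dRho ρ₀ h s ρ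
  inf_pos : ∃ c > 0, ∀ s, ∀ ρ ≥ ρ₀, c ≤ h s ρ
  dRho_le : ∀ s, ∀ ρ ≥ ρ₀, |dRho ρ₀ h s ρ| ^ 2 ≤ κ * (h s ρ + 1)
  dRhoRho_le : ∀ s, ∀ ρ ≥ ρ₀, ρ ^ 2 * |dRho ρ₀ (dRho ρ₀ h) s ρ| ^ 2 ≤ κ * (h s ρ + 1)
  dSRho_le : ∀ s, ∀ ρ ≥ ρ₀, |deriv (fun σ => dRho ρ₀ h σ ρ) s| ^ 2 ≤ κ * (h s ρ + 1)

end RabinowitzFloer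

end

open RabinowitzFloer

noncomputable section

set_option linter.unusedSectionVars false

namespace RabinowitzFloer

/-! ### Antisymmetry of the exterior derivative. -/

section General

variable {E : Type*} [NormedAddCommGroup E] [NormedSpace ℝ E]
  {H : Type*} [TopologicalSpace H] {I : ModelWithCorners ℝ E H}
  {M : Type*} [TopologicalSpace M] [ChartedSpace H M] [IsManifold I ∞ M]

/-! On the end write `f = ρ ∘ u`, `e = |∂ₛu|²` and `G(s) = ‖∇𝔸‖²`, and let `h'`, `h''` be the radial
derivatives of the profile. The proof is a maximum principle for `log f`, with coefficients that are
bounded only after integration in `s`.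

Contact type turns the equation into `∂ₜf = λ(∂ₛu)` and `∂ₛf = -λ(∂ₜu) + η f h'`. Differentiating
once more gives `Δf = e + η' f h' + η f ∂ₛh' + η f h'' ∂ₛf` (`laplacian_radius`). Bessel's
inequality for the orthogonal vectors `Y` and `JY` gives `|∇f|² ≤ f e` (`add_sq_le_of_contact`).
Hence `Δ log f ≥ η' h' + η ∂ₛh' + η f h'' ∂ₛ(log f)`. By (a) and (c′), and because `H` is bounded
below, the right side is at least `-const (1 + |η|) √(κ(h+1)) (1 + |∂ₛ log f|)`
(`laplacian_log_radius_ge`). Three things are then needed: times at which `f` is bounded, a bound on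
`η`, and control of `√(h+1)`.

Good times. Every window of length `E/δ + 1` contains a time with `G < δ`. At such a time the loop
cannot lie wholly in the end, where `H` is bounded away from zero, and its small energy keeps it
near the compact part (`cutoff_le_one`). There `H` is uniformly small along the loop, so `λ(X_H) -
H` is bounded below, and the identity `𝔸 = ∫ λ(J∂ₛu) + η ∫ (λ(X_H) - H)` bounds `η`
(`exists_bound_of_gradNormSq_lt`). Since `|η'| ≤ √G`, the bound on `η` spreads to all times
(`abs_multiplier_le`).

Coefficients. The function `q = (√ρ - √r)₊²` satisfies `|∇q|² ≤ q e` along `u`. Gronwall's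
inequality in `s`, started at a good time, bounds the mean of `q` over the loop. Integration in `t`
then gives `q² ≤ Φ (1 + G)` pointwise (`cutoff_sq_le`). By (c′), `√(h+1)` is Lipschitz in `ρ`, so `h
+ 1` grows at most quadratically and is at most a constant times `1 + G`.

Conclusion. Between two good times at most `2L` apart, with `L = E/δ + 1`, `log f` satisfies a
differential inequality whose coefficient is a multiple of `1 + G(s)`. This coefficient has bounded
integral, so a barrier `ψ(s)` solving the corresponding linear ODE bounds `log f`
(`le_of_laplacian_ge`). -/

theorem OneForm.d_apply (lam : OneForm I (M := M)) (x : M) (v w : TangentSpace I x) :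
    lam.d x v w =
      fderivWithin ℝ (lam.inChart x) (range I) (extChartAt I x x)
          (mfderiv I 𝓘(ℝ, E) (extChartAt I x) x v) (mfderiv I 𝓘(ℝ, E) (extChartAt I x) x w)
        - fderivWithin ℝ (lam.inChart x) (range I) (extChartAt I x x)
          (mfderiv I 𝓘(ℝ, E) (extChartAt I x) x w) (mfderiv I 𝓘(ℝ, E) (extChartAt I x) x v) :=
  rfl

theorem OneForm.d_swap (lam : OneForm I (M := M)) (x : M) (v w : TangentSpace I x) :
    lam.d x v w = -lam.d x w v := by
  rw [lam.d_apply, lam.d_apply x w v, neg_sub]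

theorem OneForm.d_self (lam : OneForm I (M := M)) (x : M) (v : TangentSpace I x) :
    lam.d x v v = 0 := by
  rw [lam.d_apply, sub_self]

end General

/-! ### Pullbacks of one-forms and naturality of the exterior derivative. -/

section Naturality

variable {E : Type*} [NormedAddCommGroup E] [NormedSpace ℝ E]
  {M : Type*} [TopologicalSpace M] [ChartedSpace E M] [IsManifold 𝓘(ℝ, E) ∞ M]
  {V : Type*} [NormedAddCommGroup V] [NormedSpace ℝ V]

/-- The pullback of a one-form to a normed space. -/
def OneForm.pullback (lam : OneForm 𝓘(ℝ, E) (M := M)) (F : V → M) (y : V) : V →L[ℝ] ℝ :=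
  (lam (F y)).comp (mfderiv 𝓘(ℝ, V) 𝓘(ℝ, E) F y)

theorem OneForm.inChart_eq_pullback (lam : OneForm 𝓘(ℝ, E) (M := M)) (x : M) :
    lam.inChart x = lam.pullback (extChartAt 𝓘(ℝ, E) x).symm := by
  funext y
  simp only [OneForm.inChart, OneForm.pullback, modelWithCornersSelf_coe, range_id,
    mfderivWithin_univ]

theorem OneForm.IsSmooth.contDiffAt_inChart {lam : OneForm 𝓘(ℝ, E) (M := M)}
    (hlam : lam.IsSmooth) (x : M) :
    ContDiffAt ℝ ∞ (lam.inChart x) (extChartAt 𝓘(ℝ, E) x x) := by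
  have h1 := ((contMDiffAt_hom_bundle _).1 (hlam x)).2
  have h2 : ContMDiffAt 𝓘(ℝ, E) 𝓘(ℝ, E) ∞ (extChartAt 𝓘(ℝ, E) x).symm (extChartAt 𝓘(ℝ, E) x x) :=
    (contMDiffOn_extChartAt_symm x).contMDiffAt (extChartAt_target_mem_nhds x)
  have h3 := h1.comp_of_eq h2 (extChartAt_to_inv x)
  refine (h3.congr_of_eventuallyEq ?_).contDiffAt
  filter_upwards [extChartAt_target_mem_nhds (I := 𝓘(ℝ, E)) x] with y hy
  have hs := (extChartAt 𝓘(ℝ, E) x).map_target hy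
  have hr := (extChartAt 𝓘(ℝ, E) x).right_inv hy
  ext v
  simp only [OneForm.inChart, Function.comp, ContinuousLinearMap.inCoordinates]
  rw [TangentBundle.symmL_trivializationAt (by simpa using hs), hr]
  simp

theorem eventually_chart_symm_comp {F : V → M} {y₀ : V} (hF : ContinuousAt F y₀) :
    ∀ᶠ y in nhds y₀, F y ∈ (chartAt E (F y₀)).source :=
  hF.eventually ((chartAt E (F y₀)).open_source.mem_nhds (mem_chart_source E (F y₀)))

theorem contDiffAt_extChartAt_comp {F : V → M} {y₀ : V}
    (hF : ContMDiffAt 𝓘(ℝ, V) 𝓘(ℝ, E) ∞ F y₀) :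
    ContDiffAt ℝ ∞ (fun y => extChartAt 𝓘(ℝ, E) (F y₀) (F y)) y₀ :=
  ((contMDiffAt_extChartAt (n := ∞)).comp y₀ hF).contDiffAt

theorem mfderiv_eq_symm_comp_fderiv {F : V → M} {x : M} {y : V}
    (hF : MDifferentiableAt 𝓘(ℝ, V) 𝓘(ℝ, E) F y) (hy : F y ∈ (chartAt E x).source) (v : V) :
    mfderiv 𝓘(ℝ, V) 𝓘(ℝ, E) F y v =
      mfderivWithin 𝓘(ℝ, E) 𝓘(ℝ, E) (extChartAt 𝓘(ℝ, E) x).symm (range 𝓘(ℝ, E))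
        (extChartAt 𝓘(ℝ, E) x (F y))
        (fderiv ℝ (fun y => extChartAt 𝓘(ℝ, E) x (F y)) y v) := by
  have h1 : fderiv ℝ (fun y => extChartAt 𝓘(ℝ, E) x (F y)) y =
      (mfderiv 𝓘(ℝ, E) 𝓘(ℝ, E) (extChartAt 𝓘(ℝ, E) x) (F y)).comp
        (mfderiv 𝓘(ℝ, V) 𝓘(ℝ, E) F y) := by
    rw [← mfderiv_eq_fderiv]
    exact mfderiv_comp y (mdifferentiableAt_extChartAt hy) hF
  have h2 := mfderivWithin_extChartAt_symm_comp_mfderiv_extChartAt' (I := 𝓘(ℝ, E)) (x := x)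
    (y := F y) (by simpa using hy)
  rw [h1]
  exact (DFunLike.congr_fun h2 (mfderiv 𝓘(ℝ, V) 𝓘(ℝ, E) F y v)).symm

theorem fderiv_extChartAt_comp {F : V → M} {x : M} {y : V}
    (hF : MDifferentiableAt 𝓘(ℝ, V) 𝓘(ℝ, E) F y) (hy : F y ∈ (chartAt E x).source) (v : V) :
    fderiv ℝ (fun y => extChartAt 𝓘(ℝ, E) x (F y)) y v =
      mfderiv 𝓘(ℝ, E) 𝓘(ℝ, E) (extChartAt 𝓘(ℝ, E) x) (F y)
        (mfderiv 𝓘(ℝ, V) 𝓘(ℝ, E) F y v) := by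
  have h1 : fderiv ℝ (fun y => extChartAt 𝓘(ℝ, E) x (F y)) y =
      (mfderiv 𝓘(ℝ, E) 𝓘(ℝ, E) (extChartAt 𝓘(ℝ, E) x) (F y)).comp
        (mfderiv 𝓘(ℝ, V) 𝓘(ℝ, E) F y) := by
    rw [← mfderiv_eq_fderiv]
    exact mfderiv_comp y (mdifferentiableAt_extChartAt hy) hF
  rw [h1]; rfl

theorem eventually_mdifferentiableAt {F : V → M} {y₀ : V}
    (hF : ContMDiffAt 𝓘(ℝ, V) 𝓘(ℝ, E) ∞ F y₀) :
    ∀ᶠ y in nhds y₀, MDifferentiableAt 𝓘(ℝ, V) 𝓘(ℝ, E) F y := by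
  have h1 : ContMDiffAt 𝓘(ℝ, V) 𝓘(ℝ, E) 1 F y₀ := hF.of_le (by simp)
  filter_upwards [(contMDiffAt_iff_contMDiffAt_nhds (by simp)).1 h1] with y hy
  exact hy.mdifferentiableAt (by simp)

/-- Factoring `F` through the chart at `F y₀` reduces pullbacks to a composition in flat space,
which the product rule can differentiate. -/
theorem OneForm.pullback_eventuallyEq (lam : OneForm 𝓘(ℝ, E) (M := M)) {F : V → M} {y₀ : V}
    (hF : ContMDiffAt 𝓘(ℝ, V) 𝓘(ℝ, E) ∞ F y₀) :
    lam.pullback F =ᶠ[nhds y₀] fun y =>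
      (lam.inChart (F y₀) (extChartAt 𝓘(ℝ, E) (F y₀) (F y))).comp
        (fderiv ℝ (fun y => extChartAt 𝓘(ℝ, E) (F y₀) (F y)) y) := by
  filter_upwards [eventually_mdifferentiableAt hF,
    eventually_chart_symm_comp (E := E) hF.continuousAt]
    with y h1 h2
  ext v
  have h3 : (extChartAt 𝓘(ℝ, E) (F y₀)).symm (extChartAt 𝓘(ℝ, E) (F y₀) (F y)) = F y :=
    (extChartAt 𝓘(ℝ, E) (F y₀)).left_inv (by simpa using h2)
  simp only [OneForm.pullback, OneForm.inChart, ContinuousLinearMap.comp_apply]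
  rw [h3]
  exact congrArg (lam (F y)) (mfderiv_eq_symm_comp_fderiv h1 h2 v)

/-- The pullback of a smooth one-form by a smooth map is smooth. -/
theorem OneForm.IsSmooth.contDiffAt_pullback {lam : OneForm 𝓘(ℝ, E) (M := M)}
    (hlam : lam.IsSmooth) {F : V → M} {y₀ : V} (hF : ContMDiffAt 𝓘(ℝ, V) 𝓘(ℝ, E) ∞ F y₀) :
    ContDiffAt ℝ ∞ (lam.pullback F) y₀ := by
  refine ContDiffAt.congr_of_eventuallyEq ?_ (lam.pullback_eventuallyEq hF)
  have hg := contDiffAt_extChartAt_comp hF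
  have h1 : ContDiffAt ℝ ∞ (fun y => lam.inChart (F y₀) (extChartAt 𝓘(ℝ, E) (F y₀) (F y))) y₀ :=
    ContDiffAt.comp (g := lam.inChart (F y₀)) y₀ (hlam.contDiffAt_inChart (F y₀)) hg
  exact h1.clm_comp (hg.fderiv_right (m := ∞) (by simp))

/-- The exterior derivative commutes with pullbacks. -/
theorem OneForm.IsSmooth.fderiv_pullback {lam : OneForm 𝓘(ℝ, E) (M := M)}
    (hlam : lam.IsSmooth) {F : V → M} {y₀ : V} (hF : ContMDiffAt 𝓘(ℝ, V) 𝓘(ℝ, E) ∞ F y₀)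
    (v w : V) :
    fderiv ℝ (lam.pullback F) y₀ v w - fderiv ℝ (lam.pullback F) y₀ w v =
      lam.d (F y₀) (mfderiv 𝓘(ℝ, V) 𝓘(ℝ, E) F y₀ v) (mfderiv 𝓘(ℝ, V) 𝓘(ℝ, E) F y₀ w) := by
  have hg := contDiffAt_extChartAt_comp hF
  have hd := fderiv_extChartAt_comp (eventually_mdifferentiableAt hF).self_of_nhds
    (mem_chart_source E (F y₀))
  have key := (lam.pullback_eventuallyEq hF).fderiv_eq (𝕜 := ℝ)
  set g : V → E := fun y => extChartAt 𝓘(ℝ, E) (F y₀) (F y) with hgdef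
  have hν := (hlam.contDiffAt_inChart (F y₀)).differentiableAt (by simp)
  have hgd : DifferentiableAt ℝ g y₀ := hg.differentiableAt (by simp)
  have h1 : HasFDerivAt (fun y => lam.inChart (F y₀) (g y))
      ((fderiv ℝ (lam.inChart (F y₀)) (g y₀)).comp (fderiv ℝ g y₀)) y₀ :=
    HasFDerivAt.comp (g := lam.inChart (F y₀)) y₀ hν.hasFDerivAt hgd.hasFDerivAt
  have h2 : HasFDerivAt (fderiv ℝ g) (fderiv ℝ (fderiv ℝ g) y₀) y₀ :=
    ((hg.fderiv_right (m := ∞) (by simp)).differentiableAt (by simp)).hasFDerivAt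
  have h3 := (h1.clm_comp h2).fderiv
  have hsym := hg.isSymmSndFDerivAt (by
    rw [minSmoothness_of_isRCLikeNormedField]; exact WithTop.coe_le_coe.2 le_top)
  rw [key, h3, OneForm.d_apply, ← hd v, ← hd w]
  simp only [_root_.add_apply, ContinuousLinearMap.comp_apply,
    ContinuousLinearMap.compL_apply, ContinuousLinearMap.flip_apply,
    modelWithCornersSelf_coe, range_id, fderivWithin_univ]
  -- The terms containing the second derivative of `g` are symmetric in `v`, `w` and cancel after
  -- antisymmetrization.
  rw [hsym.eq v w]
  ring

end Naturality

/-! ### One-forms and differentials in a fixed chart, at nearby points. -/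

section ChartFormulas

variable {E : Type*} [NormedAddCommGroup E] [NormedSpace ℝ E]
  {M : Type*} [TopologicalSpace M] [ChartedSpace E M] [IsManifold 𝓘(ℝ, E) ∞ M]

/-- The differential at `x` of the preferred chart at `x₀`, as a map to the model space. -/
def chartDiff (x₀ x : M) (v : TangentSpace 𝓘(ℝ, E) x) : E :=
  mfderiv 𝓘(ℝ, E) 𝓘(ℝ, E) (extChartAt 𝓘(ℝ, E) x₀) x v

theorem contMDiffAt_extChartAt_symm {x₀ : M} {y : E} (hy : y ∈ (extChartAt 𝓘(ℝ, E) x₀).target) :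
    ContMDiffAt 𝓘(ℝ, E) 𝓘(ℝ, E) ∞ (extChartAt 𝓘(ℝ, E) x₀).symm y :=
  (contMDiffOn_extChartAt_symm x₀).contMDiffAt ((isOpen_extChartAt_target x₀).mem_nhds hy)

theorem mfderiv_symm_chartDiff {x₀ : M} {y : E} (hy : y ∈ (extChartAt 𝓘(ℝ, E) x₀).target)
    (v : TangentSpace 𝓘(ℝ, E) ((extChartAt 𝓘(ℝ, E) x₀).symm y)) :
    mfderiv 𝓘(ℝ, E) 𝓘(ℝ, E) (extChartAt 𝓘(ℝ, E) x₀).symm y (chartDiff (E := E) x₀ _ v) = v := by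
  have h := mfderivWithin_extChartAt_symm_comp_mfderiv_extChartAt hy
  rw [modelWithCornersSelf_coe, range_id, mfderivWithin_univ] at h
  exact DFunLike.congr_fun h v

theorem chartDiff_bijective {x₀ x : M} (hx : x ∈ (extChartAt 𝓘(ℝ, E) x₀).source) :
    Function.Bijective (chartDiff x₀ x : TangentSpace 𝓘(ℝ, E) x → E) :=
  (isInvertible_mfderiv_extChartAt (I := 𝓘(ℝ, E)) hx).bijective

theorem OneForm.apply_eq_inChart (lam : OneForm 𝓘(ℝ, E) (M := M)) {x₀ x : M}
    (hx : x ∈ (extChartAt 𝓘(ℝ, E) x₀).source) :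
    ∀ v : TangentSpace 𝓘(ℝ, E) x,
      lam x v = lam.inChart x₀ (extChartAt 𝓘(ℝ, E) x₀ x) (chartDiff (E := E) x₀ x v) := by
  have hy := (extChartAt 𝓘(ℝ, E) x₀).map_source hx
  have h : ∀ v : TangentSpace 𝓘(ℝ, E) ((extChartAt 𝓘(ℝ, E) x₀).symm (extChartAt 𝓘(ℝ, E) x₀ x)),
      lam _ v = lam.inChart x₀ (extChartAt 𝓘(ℝ, E) x₀ x) (chartDiff (E := E) x₀ _ v) := by
    intro v
    rw [lam.inChart_eq_pullback]
    exact congrArg (lam _) (mfderiv_symm_chartDiff hy v).symm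
  rwa [(extChartAt 𝓘(ℝ, E) x₀).left_inv hx] at h

theorem OneForm.IsSmooth.d_eq_inChart {lam : OneForm 𝓘(ℝ, E) (M := M)} (hlam : lam.IsSmooth)
    {x₀ x : M} (hx : x ∈ (extChartAt 𝓘(ℝ, E) x₀).source) :
    ∀ v w : TangentSpace 𝓘(ℝ, E) x,
      lam.d x v w =
        (fderiv ℝ (lam.inChart x₀) (extChartAt 𝓘(ℝ, E) x₀ x)
          - (fderiv ℝ (lam.inChart x₀) (extChartAt 𝓘(ℝ, E) x₀ x)).flip)
            (chartDiff (E := E) x₀ x v) (chartDiff (E := E) x₀ x w) := by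
  have hy := (extChartAt 𝓘(ℝ, E) x₀).map_source hx
  have h : ∀ v w : TangentSpace 𝓘(ℝ, E)
        ((extChartAt 𝓘(ℝ, E) x₀).symm (extChartAt 𝓘(ℝ, E) x₀ x)),
      lam.d _ v w =
        (fderiv ℝ (lam.inChart x₀) (extChartAt 𝓘(ℝ, E) x₀ x)
          - (fderiv ℝ (lam.inChart x₀) (extChartAt 𝓘(ℝ, E) x₀ x)).flip)
            (chartDiff (E := E) x₀ _ v) (chartDiff (E := E) x₀ _ w) := by
    intro v w
    have h1 := hlam.fderiv_pullback (contMDiffAt_extChartAt_symm hy) (chartDiff (E := E) x₀ _ v)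
      (chartDiff (E := E) x₀ _ w)
    rw [mfderiv_symm_chartDiff hy, mfderiv_symm_chartDiff hy, ← lam.inChart_eq_pullback] at h1
    exact h1.symm
  rwa [(extChartAt 𝓘(ℝ, E) x₀).left_inv hx] at h

theorem mfderiv_eq_fderiv_symm {F : M → ℝ} {x₀ x : M}
    (hx : x ∈ (extChartAt 𝓘(ℝ, E) x₀).source) (hF : MDifferentiableAt 𝓘(ℝ, E) 𝓘(ℝ, ℝ) F x)
    (v : TangentSpace 𝓘(ℝ, E) x) :
    mfderiv 𝓘(ℝ, E) 𝓘(ℝ, ℝ) F x v =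
      fderiv ℝ (fun y => F ((extChartAt 𝓘(ℝ, E) x₀).symm y)) (extChartAt 𝓘(ℝ, E) x₀ x)
        (chartDiff (E := E) x₀ x v) := by
  have hy := (extChartAt 𝓘(ℝ, E) x₀).map_source hx
  have hl := (extChartAt 𝓘(ℝ, E) x₀).left_inv hx
  have h1 : MDifferentiableAt 𝓘(ℝ, E) 𝓘(ℝ, ℝ) (fun y => F ((extChartAt 𝓘(ℝ, E) x₀).symm y))
      (extChartAt 𝓘(ℝ, E) x₀ x) :=
    MDifferentiableAt.comp (I' := 𝓘(ℝ, E)) _ (by rwa [hl])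
      ((contMDiffAt_extChartAt_symm hy).mdifferentiableAt (by simp))
  have h2 := mfderiv_comp x h1 (mdifferentiableAt_extChartAt (I := 𝓘(ℝ, E)) (by simpa using hx))
  have h3 : (fun y => F ((extChartAt 𝓘(ℝ, E) x₀).symm y)) ∘ (extChartAt 𝓘(ℝ, E) x₀)
      =ᶠ[nhds x] F := by
    filter_upwards [(isOpen_extChartAt_source (I := 𝓘(ℝ, E)) x₀).mem_nhds hx] with z hz
    simp only [Function.comp]
    rw [(extChartAt 𝓘(ℝ, E) x₀).left_inv hz]
  rw [h3.mfderiv_eq] at h2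
  rw [← mfderiv_eq_fderiv]
  exact DFunLike.congr_fun h2 v

/-- The partial derivative along a chart of a smooth family of functions. -/
theorem continuousAt_fderiv_family {Ham : ℝ → M → ℝ}
    (hH : ContMDiff (𝓘(ℝ, ℝ).prod 𝓘(ℝ, E)) 𝓘(ℝ, ℝ) ∞ (fun p : ℝ × M => Ham p.1 p.2))
    (s₀ : ℝ) (x₀ : M) :
    ContinuousAt (fun p : ℝ × M =>
      fderiv ℝ (fun y => Ham p.1 ((extChartAt 𝓘(ℝ, E) x₀).symm y)) (extChartAt 𝓘(ℝ, E) x₀ p.2))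
      (s₀, x₀) := by
  set G : ℝ × E → ℝ := fun p => Ham p.1 ((extChartAt 𝓘(ℝ, E) x₀).symm p.2) with hG
  have hGs : ∀ s : ℝ, ∀ y ∈ (extChartAt 𝓘(ℝ, E) x₀).target, ContDiffAt ℝ ∞ G (s, y) := by
    intro s y hy
    have h1 : ContMDiffAt 𝓘(ℝ, ℝ × E) (𝓘(ℝ, ℝ).prod 𝓘(ℝ, E)) ∞
        (fun p : ℝ × E => (p.1, (extChartAt 𝓘(ℝ, E) x₀).symm p.2)) (s, y) :=
      ContMDiffAt.prodMk contDiff_fst.contMDiff.contMDiffAt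
        (ContMDiffAt.comp (I' := 𝓘(ℝ, E)) (s, y) (contMDiffAt_extChartAt_symm hy)
          contDiff_snd.contMDiff.contMDiffAt)
    exact ((hH _).comp (s, y) h1).contDiffAt
  have h0 : extChartAt 𝓘(ℝ, E) x₀ x₀ ∈ (extChartAt 𝓘(ℝ, E) x₀).target := mem_extChartAt_target x₀
  have hcont : ContinuousAt (fun p : ℝ × E => (fderiv ℝ G p).comp (ContinuousLinearMap.inr ℝ ℝ E))
      (s₀, extChartAt 𝓘(ℝ, E) x₀ x₀) :=
    (((hGs s₀ _ h0).fderiv_right (m := ∞) (by simp)).clm_comp contDiffAt_const).continuousAt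
  have hc2 : ContinuousAt (fun p : ℝ × M => (p.1, extChartAt 𝓘(ℝ, E) x₀ p.2)) (s₀, x₀) :=
    continuousAt_fst.prodMk
      (ContinuousAt.comp (g := extChartAt 𝓘(ℝ, E) x₀) (continuousAt_extChartAt x₀) continuousAt_snd)
  refine (ContinuousAt.comp (x := (s₀, x₀)) (g := fun p : ℝ × E =>
    (fderiv ℝ G p).comp (ContinuousLinearMap.inr ℝ ℝ E)) hcont hc2).congr ?_
  have hmem : ∀ᶠ p : ℝ × M in nhds (s₀, x₀), p.2 ∈ (extChartAt 𝓘(ℝ, E) x₀).source :=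
    continuousAt_snd.eventually (extChartAt_source_mem_nhds x₀)
  filter_upwards [hmem] with p hp
  have hd := ((hGs p.1 _ ((extChartAt 𝓘(ℝ, E) x₀).map_source hp)).differentiableAt
    (by simp)).hasFDerivAt
  exact (hd.comp _ (hasFDerivAt_prodMk_right p.1 _)).fderiv.symm

end ChartFormulas

/-! ### Positive bilinear forms and their perturbations. -/

section Bilinear

variable {E : Type*} [NormedAddCommGroup E] [NormedSpace ℝ E]

/-! Shortcut instances on the space of bilinear forms. -/

instance dualNormedAddCommGroup : NormedAddCommGroup (E →L[ℝ] ℝ) :=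
  ContinuousLinearMap.toNormedAddCommGroup
instance dualNormedSpace : NormedSpace ℝ (E →L[ℝ] ℝ) := ContinuousLinearMap.toNormedSpace
instance bilinNormedAddCommGroup : NormedAddCommGroup (E →L[ℝ] E →L[ℝ] ℝ) :=
  ContinuousLinearMap.toNormedAddCommGroup
instance bilinSeminormedAddCommGroup : SeminormedAddCommGroup (E →L[ℝ] E →L[ℝ] ℝ) :=
  NormedAddCommGroup.toSeminormedAddCommGroup

theorem continuous_sub_flip : Continuous fun L : E →L[ℝ] E →L[ℝ] ℝ => L - L.flip :=
  continuous_id.sub (ContinuousLinearMap.flipₗᵢ ℝ E E ℝ).continuous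

/-- The constant is the minimum of the quadratic form on the compact unit sphere; homogeneity does
the rest. An empty sphere means that the space is zero. -/
theorem exists_mul_sq_le_of_pos [FiniteDimensional ℝ E] {B : E →L[ℝ] E →L[ℝ] ℝ}
    (hpos : ∀ v, v ≠ 0 → 0 < B v v) : ∃ c > 0, ∀ v, c * ‖v‖ ^ 2 ≤ B v v := by
  have hunit : ∀ v : E, v ≠ 0 → (‖v‖⁻¹ • v) ∈ Metric.sphere (0 : E) 1 := by
    intro v hv
    rw [mem_sphere_zero_iff_norm, norm_smul, norm_inv, norm_norm,
      inv_mul_cancel₀ (norm_ne_zero_iff.2 hv)]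
  rcases (Metric.sphere (0 : E) 1).eq_empty_or_nonempty with h | h
  · refine ⟨1, one_pos, fun v => ?_⟩
    have : v = 0 := by
      by_contra hv
      have := hunit v hv
      rw [h] at this
      exact this
    simp [this]
  · obtain ⟨z, hz, hmin⟩ := (isCompact_sphere (0 : E) 1).exists_isMinOn h
      (f := fun v => B v v) (by fun_prop)
    have hz0 : z ≠ 0 := by
      rintro rfl
      simp at hz
    refine ⟨B z z, hpos z hz0, fun v => ?_⟩
    rcases eq_or_ne v 0 with rfl | hv
    · simp
    · have hm : B z z ≤ B (‖v‖⁻¹ • v) (‖v‖⁻¹ • v) := hmin (hunit v hv)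
      rw [map_smul, map_smul, _root_.smul_apply, smul_eq_mul, smul_eq_mul] at hm
      have hn : 0 < ‖v‖ := norm_pos_iff.2 hv
      calc B z z * ‖v‖ ^ 2
          ≤ (‖v‖⁻¹ * (‖v‖⁻¹ * B v v)) * ‖v‖ ^ 2 := by gcongr
        _ = B v v := by field_simp

theorem eventually_norm_sub_lt {α F : Type*} [TopologicalSpace α] [SeminormedAddCommGroup F]
    {B : α → F} {a : α} (hB : ContinuousAt B a) {c : ℝ} (hc : 0 < c) :
    ∀ᶠ p in nhds a, ‖B p - B a‖ < c := by
  filter_upwards [hB (Metric.ball_mem_nhds (B a) hc)] with p hp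
  rwa [← dist_eq_norm]

theorem half_mul_sq_le_of_norm_sub_lt {B B₀ : E →L[ℝ] E →L[ℝ] ℝ} {c : ℝ}
    (hc : ∀ v, c * ‖v‖ ^ 2 ≤ B₀ v v) (hB : ‖B - B₀‖ < c / 2) (w : E) :
    c / 2 * ‖w‖ ^ 2 ≤ B w w := by
  have h1 := hc w
  have h2 : |(B - B₀) w w| ≤ c / 2 * ‖w‖ ^ 2 := by
    calc |(B - B₀) w w| ≤ ‖B - B₀‖ * ‖w‖ * ‖w‖ := (B - B₀).le_opNorm₂ w w
      _ ≤ c / 2 * ‖w‖ * ‖w‖ := by gcongr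
      _ = _ := by ring
  have h3 : (B - B₀) w w = B w w - B₀ w w := rfl
  have := (abs_le.1 h2).1
  linarith

end Bilinear

/-! ### Continuity of the symplectic form and of Hamiltonian fields. -/

section Continuity

variable {E : Type*} [NormedAddCommGroup E] [NormedSpace ℝ E] [FiniteDimensional ℝ E]
  {M : Type*} [TopologicalSpace M] [ChartedSpace E M] [IsManifold 𝓘(ℝ, E) ∞ M]

/-- The exterior derivative of a one-form in a chart. -/
def OneForm.dChart (lam : OneForm 𝓘(ℝ, E) (M := M)) (x₀ : M) (y : E) : E →L[ℝ] E →L[ℝ] ℝ :=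
  fderiv ℝ (lam.inChart x₀) y - (fderiv ℝ (lam.inChart x₀) y).flip

theorem OneForm.IsSmooth.continuousAt_dChart {lam : OneForm 𝓘(ℝ, E) (M := M)}
    (hlam : lam.IsSmooth) (x₀ : M) :
    ContinuousAt (fun x => lam.dChart x₀ (extChartAt 𝓘(ℝ, E) x₀ x)) x₀ := by
  have h1 : ContinuousAt (fderiv ℝ (lam.inChart x₀)) (extChartAt 𝓘(ℝ, E) x₀ x₀) :=
    ((hlam.contDiffAt_inChart x₀).fderiv_right (m := ∞) (by simp)).continuousAt
  have h2 : ContinuousAt (fun x => fderiv ℝ (lam.inChart x₀) (extChartAt 𝓘(ℝ, E) x₀ x)) x₀ :=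
    ContinuousAt.comp (g := fderiv ℝ (lam.inChart x₀)) h1 (continuousAt_extChartAt x₀)
  exact ContinuousAt.comp (g := fun L : E →L[ℝ] E →L[ℝ] ℝ => L - L.flip)
    continuous_sub_flip.continuousAt h2

theorem exists_equiv_of_nondegenerate {B : E →L[ℝ] E →L[ℝ] ℝ}
    (hB : ∀ v, (∀ w, B v w = 0) → v = 0) :
    ∃ e : E ≃L[ℝ] (E →L[ℝ] ℝ), (e : E →L[ℝ] E →L[ℝ] ℝ) = B := by
  have hinj : Function.Injective B := by
    rw [injective_iff_map_eq_zero]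
    exact fun v hv => hB v fun w => by rw [hv]; rfl
  have hdim : Module.finrank ℝ E = Module.finrank ℝ (E →L[ℝ] ℝ) := by
    rw [← LinearEquiv.finrank_eq (LinearMap.toContinuousLinearMap (𝕜 := ℝ) (E := E) (F' := ℝ))]
    exact (Subspace.dual_finrank_eq (K := ℝ) (V := E)).symm
  exact ⟨(LinearEquiv.ofInjectiveOfFinrankEq B.toLinearMap hinj hdim).toContinuousLinearEquiv, by
    ext v w; rfl⟩

theorem OneForm.IsSymplectic.dChart_nondegenerate {lam : OneForm 𝓘(ℝ, E) (M := M)}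
    (hlam : lam.IsSmooth) (hsymp : lam.IsSymplectic) {x₀ x : M}
    (hx : x ∈ (extChartAt 𝓘(ℝ, E) x₀).source) (v : E)
    (hv : ∀ w, lam.dChart x₀ (extChartAt 𝓘(ℝ, E) x₀ x) v w = 0) : v = 0 := by
  obtain ⟨v', rfl⟩ := (chartDiff_bijective hx).2 v
  have : v' = 0 := hsymp x v' fun w => by
    rw [hlam.d_eq_inChart hx]
    exact hv _
  rw [this]
  exact map_zero (mfderiv 𝓘(ℝ, E) 𝓘(ℝ, E) (extChartAt 𝓘(ℝ, E) x₀) x)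

theorem OneForm.d_hamiltonianField {lam : OneForm 𝓘(ℝ, E) (M := M)} (hsymp : lam.IsSymplectic)
    (F : M → ℝ) (x : M) (v : TangentSpace 𝓘(ℝ, E) x) :
    lam.d x (lam.hamiltonianField F x) v = -(mfderiv 𝓘(ℝ, E) 𝓘(ℝ, ℝ) F x v : ℝ) := by
  exact OneForm.d_sharp hsymp x _ v

theorem OneForm.d_liouvilleField {lam : OneForm 𝓘(ℝ, E) (M := M)} (hsymp : lam.IsSymplectic)
    (x : M) (v : TangentSpace 𝓘(ℝ, E) x) :
    lam.d x (lam.liouvilleField x) v = lam x v := by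
  rw [OneForm.liouvilleField, OneForm.d_sharp hsymp]

theorem mdifferentiableAt_family {Ham : ℝ → M → ℝ}
    (hH : ContMDiff (𝓘(ℝ, ℝ).prod 𝓘(ℝ, E)) 𝓘(ℝ, ℝ) ∞ (fun p : ℝ × M => Ham p.1 p.2))
    (s : ℝ) (x : M) : MDifferentiableAt 𝓘(ℝ, E) 𝓘(ℝ, ℝ) (Ham s) x := by
  have h1 : ContMDiffAt 𝓘(ℝ, E) (𝓘(ℝ, ℝ).prod 𝓘(ℝ, E)) ∞ (fun y : M => (s, y)) x :=
    contMDiffAt_const.prodMk contMDiffAt_id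
  exact ((hH (s, x)).comp x h1).mdifferentiableAt (by simp)

/-- The function `lam (X_{H_s})` depends continuously on `s` and on the point. -/
theorem continuous_apply_hamiltonianField {lam : OneForm 𝓘(ℝ, E) (M := M)}
    (hlam : lam.IsSmooth) (hsymp : lam.IsSymplectic) {Ham : ℝ → M → ℝ}
    (hH : ContMDiff (𝓘(ℝ, ℝ).prod 𝓘(ℝ, E)) 𝓘(ℝ, ℝ) ∞ (fun p : ℝ × M => Ham p.1 p.2)) :
    Continuous (fun p : ℝ × M => lam p.2 (lam.hamiltonianField (Ham p.1) p.2)) := by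
  rw [continuous_iff_continuousAt]
  rintro ⟨s₀, x₀⟩
  have hD := continuousAt_fderiv_family hH s₀ x₀
  have hΩ : ContinuousAt (fun p : ℝ × M => lam.dChart x₀ (extChartAt 𝓘(ℝ, E) x₀ p.2)) (s₀, x₀) :=
    ContinuousAt.comp (x := (s₀, x₀)) (g := fun x => lam.dChart x₀ (extChartAt 𝓘(ℝ, E) x₀ x))
      (hlam.continuousAt_dChart x₀) continuousAt_snd
  have hν : ContinuousAt (fun p : ℝ × M => lam.inChart x₀ (extChartAt 𝓘(ℝ, E) x₀ p.2))
      (s₀, x₀) :=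
    ContinuousAt.comp (x := (s₀, x₀)) (g := fun x => lam.inChart x₀ (extChartAt 𝓘(ℝ, E) x₀ x))
      (ContinuousAt.comp (g := lam.inChart x₀) (hlam.contDiffAt_inChart x₀).continuousAt
        (continuousAt_extChartAt x₀)) continuousAt_snd
  obtain ⟨e, he⟩ := exists_equiv_of_nondegenerate (fun v hv =>
    hsymp.dChart_nondegenerate hlam (mem_extChartAt_source (I := 𝓘(ℝ, E)) x₀) v hv)
  -- In the chart `X_H = -Ω⁻¹ dH`, where `Ω` is the matrix form of `dλ`, and inversion is continuous
  -- at an isomorphism.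
  have hinv : ContinuousAt (fun p : ℝ × M =>
      ContinuousLinearMap.inverse (lam.dChart x₀ (extChartAt 𝓘(ℝ, E) x₀ p.2))) (s₀, x₀) := by
    refine ContinuousAt.comp (x := (s₀, x₀)) (g := ContinuousLinearMap.inverse) ?_ hΩ
    have := (contDiffAt_map_inverse (𝕜 := ℝ) (n := 1) e).continuousAt
    rwa [he] at this
  refine (hν.clm_apply (hinv.clm_apply hD.neg)).congr ?_
  have hmem : ∀ᶠ p : ℝ × M in nhds (s₀, x₀), p.2 ∈ (extChartAt 𝓘(ℝ, E) x₀).source :=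
    continuousAt_snd.eventually (extChartAt_source_mem_nhds x₀)
  filter_upwards [hmem] with p hp
  obtain ⟨e', he'⟩ := exists_equiv_of_nondegenerate (fun v hv =>
    hsymp.dChart_nondegenerate hlam hp v hv)
  rw [lam.apply_eq_inChart hp]
  congr 1
  rw [← he', ContinuousLinearMap.inverse_equiv]
  rw [ContinuousLinearEquiv.coe_coe, ContinuousLinearEquiv.symm_apply_eq]
  ext w
  obtain ⟨w', rfl⟩ := (chartDiff_bijective hp).2 w
  have h1 := hlam.d_eq_inChart hp (lam.hamiltonianField (Ham p.1) p.2) w'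
  rw [lam.d_hamiltonianField hsymp, mfderiv_eq_fderiv_symm hp (mdifferentiableAt_family hH _ _)]
    at h1
  change _ = (e' : E →L[ℝ] E →L[ℝ] ℝ) _ _
  rw [he']
  exact h1

end Continuity

/-! ### The metrics `ω(J_t ·, ·)`: local and uniform bounds. -/

section Metric

variable {m : ℕ} {X : Type*} [TopologicalSpace X] [ChartedSpace (EuclideanSpace ℝ (Fin m)) X]
  [IsManifold (𝓡 m) ∞ X]

/-- The square norm of a tangent vector with respect to the metric `d lam (J_t ·, ·)`. -/
def metricSq (lam : OneForm (𝓡 m) (M := X)) (J : EndLoop m X) (t : ℝ) (x : X)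
    (v : TangentSpace (𝓡 m) x) : ℝ :=
  lam.d x (J t x v) v

/-- In coordinates the metric is a bilinear form depending continuously on time and point. It is
positive definite at the base point, hence uniformly so nearby. -/
theorem exists_chartDiff_sq_le {lam : OneForm (𝓡 m) (M := X)} {J : EndLoop m X}
    (hlam : lam.IsSmooth) (hJ : IsCompatibleLoop lam J) (t₀ : ℝ) (x₀ : X) :
    ∃ c > 0, ∀ᶠ p : ℝ × X in nhds (t₀, x₀), p.2 ∈ (extChartAt (𝓡 m) x₀).source ∧
      ∀ v : TangentSpace (𝓡 m) p.2,
        c * ‖chartDiff x₀ p.2 v‖ ^ 2 ≤ metricSq lam J p.1 p.2 v := by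
  let E := EuclideanSpace ℝ (Fin m)
  have hmem : ∀ᶠ p : ℝ × X in nhds (t₀, x₀), p.2 ∈ (extChartAt (𝓡 m) x₀).source :=
    continuousAt_snd.eventually (extChartAt_source_mem_nhds x₀)
  obtain ⟨Jc, hJc, hJeq⟩ : ∃ Jc : ℝ × X → E →L[ℝ] E, ContinuousAt Jc (t₀, x₀) ∧
      ∀ p : ℝ × X, p.2 ∈ (extChartAt (𝓡 m) x₀).source → ∀ v : TangentSpace (𝓡 m) p.2,
        Jc p (chartDiff x₀ p.2 v) = chartDiff x₀ p.2 (J p.1 p.2 v) := by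
    have h1 := ((contMDiffAt_hom_bundle _).1 (hJ.smooth (t₀, x₀))).2.continuousAt
    refine ⟨_, h1, fun p hp v => ?_⟩
    have hp' : p.2 ∈ (chartAt E x₀).source := by simpa using hp
    simp only [ContinuousLinearMap.inCoordinates, ContinuousLinearMap.comp_apply]
    rw [TangentBundle.symmL_trivializationAt hp',
      TangentBundle.continuousLinearMapAt_trivializationAt hp']
    have h2 := DFunLike.congr_fun
      (mfderivWithin_extChartAt_symm_comp_mfderiv_extChartAt' (I := 𝓡 m) hp) v
    exact congrArg (fun w => chartDiff x₀ p.2 (J p.1 p.2 w)) h2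
  let B : ℝ × X → E →L[ℝ] E →L[ℝ] ℝ := fun p =>
    (lam.dChart x₀ (extChartAt (𝓡 m) x₀ p.2)).comp (Jc p)
  have hBc : ContinuousAt B (t₀, x₀) :=
    (ContinuousAt.comp (x := (t₀, x₀)) (g := fun x => lam.dChart x₀ (extChartAt (𝓡 m) x₀ x))
      (hlam.continuousAt_dChart x₀) continuousAt_snd).clm_comp hJc
  have hB : ∀ p : ℝ × X, p.2 ∈ (extChartAt (𝓡 m) x₀).source → ∀ v : TangentSpace (𝓡 m) p.2,
      metricSq lam J p.1 p.2 v = B p (chartDiff x₀ p.2 v) (chartDiff x₀ p.2 v) := by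
    intro p hp v
    rw [metricSq, hlam.d_eq_inChart hp]
    change _ = lam.dChart _ _ (Jc p _) _
    rw [hJeq p hp]; rfl
  have hpos : ∀ v : E, v ≠ 0 → 0 < B (t₀, x₀) v v := by
    intro v hv
    have hs := mem_extChartAt_source (I := 𝓡 m) x₀
    obtain ⟨v', rfl⟩ := (chartDiff_bijective hs).2 v
    rw [← hB (t₀, x₀) hs]
    refine hJ.pos t₀ x₀ v' ?_
    rintro rfl
    exact hv (map_zero (mfderiv 𝓘(ℝ, E) 𝓘(ℝ, E) (extChartAt 𝓘(ℝ, E) x₀) x₀))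
  obtain ⟨c, hc, hcB⟩ := exists_mul_sq_le_of_pos hpos
  refine ⟨c / 2, by positivity, ?_⟩
  filter_upwards [hmem, eventually_norm_sub_lt hBc (half_pos hc)] with p hp hn
  refine ⟨hp, fun v => ?_⟩
  rw [hB p hp]
  exact half_mul_sq_le_of_norm_sub_lt hcB hn _

end Metric

section Differential

variable {E : Type*} [NormedAddCommGroup E] [NormedSpace ℝ E]
  {M : Type*} [TopologicalSpace M] [ChartedSpace E M] [IsManifold 𝓘(ℝ, E) ∞ M]

/-- The differential of a real function, as a one-form. -/
def differential (F : M → ℝ) : OneForm 𝓘(ℝ, E) (M := M) := fun x => mfderiv 𝓘(ℝ, E) 𝓘(ℝ, ℝ) F x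

theorem differential_eq_fderiv_symm {F : M → ℝ} {x₀ x : M}
    (hx : x ∈ (extChartAt 𝓘(ℝ, E) x₀).source) (hF : MDifferentiableAt 𝓘(ℝ, E) 𝓘(ℝ, ℝ) F x)
    (v : TangentSpace 𝓘(ℝ, E) x) :
    differential F x v =
      fderiv ℝ (fun y => F ((extChartAt 𝓘(ℝ, E) x₀).symm y)) (extChartAt 𝓘(ℝ, E) x₀ x)
        (chartDiff (E := E) x₀ x v) :=
  mfderiv_eq_fderiv_symm hx hF v

end Differential

section MetricBounds

variable {m : ℕ} {X : Type*} [TopologicalSpace X] [ChartedSpace (EuclideanSpace ℝ (Fin m)) X]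
  [IsManifold (𝓡 m) ∞ X] {lam : OneForm (𝓡 m) (M := X)} {J : EndLoop m X}

theorem eventually_norm_le {α F : Type*} [TopologicalSpace α] [SeminormedAddCommGroup F]
    {B : α → F} {a : α} (hB : ContinuousAt B a) : ∀ᶠ p in nhds a, ‖B p‖ ≤ ‖B a‖ + 1 :=
  (hB.norm.eventually_lt continuousAt_const (lt_add_one _)).mono fun _ h => h.le

theorem sq_apply_le {F : Type*} [NormedAddCommGroup F] [NormedSpace ℝ F] {L : F →L[ℝ] ℝ} {v : F}
    {c C q : ℝ} (hc : 0 < c) (hL : ‖L‖ ≤ C) (hv : c * ‖v‖ ^ 2 ≤ q) :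
    (L v) ^ 2 ≤ C ^ 2 / c * q := by
  have h1 : |L v| ≤ C * ‖v‖ := L.le_of_opNorm_le hL v
  calc (L v) ^ 2 = |L v| ^ 2 := (sq_abs _).symm
    _ ≤ (C * ‖v‖) ^ 2 := by gcongr
    _ = C ^ 2 / c * (c * ‖v‖ ^ 2) := by field_simp
    _ ≤ _ := by gcongr

/-- On compact sets, the differentials of a smooth family of functions and the one-form are
uniformly bounded with respect to the metrics of a compatible loop. -/
theorem exists_sq_le_metricSq (hlam : lam.IsSmooth) (hJ : IsCompatibleLoop lam J)
    {Ham : ℝ → X → ℝ}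
    (hH : ContMDiff (𝓘(ℝ, ℝ).prod (𝓡 m)) 𝓘(ℝ, ℝ) ∞ (fun p : ℝ × X => Ham p.1 p.2))
    {K : Set X} (hK : IsCompact K) :
    ∃ C > 0, ∀ s ∈ Icc (0 : ℝ) 1, ∀ t ∈ Icc (0 : ℝ) 1, ∀ x ∈ K, ∀ v : TangentSpace (𝓡 m) x,
      (differential (Ham s) x v) ^ 2 ≤ C * metricSq lam J t x v ∧
      (lam x v) ^ 2 ≤ C * metricSq lam J t x v := by
  have hnn : ∀ t x (v : TangentSpace (𝓡 m) x), 0 ≤ metricSq lam J t x v := by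
    intro t x v
    rcases eq_or_ne v 0 with rfl | hv
    · simp [metricSq]
    · exact (hJ.pos t x v hv).le
  let Q : Set (ℝ × ℝ × X) → Prop := fun S => ∃ C > 0, ∀ p ∈ S, ∀ v : TangentSpace (𝓡 m) p.2.2,
      (differential (Ham p.1) p.2.2 v) ^ 2 ≤ C * metricSq lam J p.2.1 p.2.2 v ∧
      (lam p.2.2 v) ^ 2 ≤ C * metricSq lam J p.2.1 p.2.2 v
  have hQ : Q (Icc 0 1 ×ˢ Icc 0 1 ×ˢ K) := by
    -- The existence of a constant passes to subsets and to unions of two sets, so by compactness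
    -- the local bound suffices.
    refine (isCompact_Icc.prod (isCompact_Icc.prod hK)).induction_on (p := Q) ?_ ?_ ?_ ?_
    · exact ⟨1, one_pos, fun p hp => hp.elim⟩
    · rintro S T hST ⟨C, hC, h⟩
      exact ⟨C, hC, fun p hp => h p (hST hp)⟩
    · rintro S T ⟨C, hC, h⟩ ⟨C', hC', h'⟩
      refine ⟨max C C', lt_max_of_lt_left hC, fun p hp v => ?_⟩
      have hn := hnn p.2.1 p.2.2 v
      rcases hp with hp | hp
      · exact ⟨(h p hp v).1.trans (by gcongr; exact le_max_left _ _),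
          (h p hp v).2.trans (by gcongr; exact le_max_left _ _)⟩
      · exact ⟨(h' p hp v).1.trans (by gcongr; exact le_max_right _ _),
          (h' p hp v).2.trans (by gcongr; exact le_max_right _ _)⟩
    · rintro ⟨s₀, t₀, x₀⟩ -
      obtain ⟨c, hc, hev⟩ := exists_chartDiff_sq_le hlam hJ t₀ x₀
      have hD := eventually_norm_le (continuousAt_fderiv_family hH s₀ x₀)
      have hν := eventually_norm_le (ContinuousAt.comp (g := lam.inChart x₀)
        (hlam.contDiffAt_inChart x₀).continuousAt (continuousAt_extChartAt (I := 𝓡 m) x₀))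
      set C₁ := ‖fderiv ℝ (fun y => Ham s₀ ((extChartAt (𝓡 m) x₀).symm y))
        (extChartAt (𝓡 m) x₀ x₀)‖ + 1
      set C₂ := ‖(lam.inChart x₀ ∘ extChartAt (𝓡 m) x₀) x₀‖ + 1
      have e1 : ∀ᶠ p : ℝ × ℝ × X in nhds (s₀, t₀, x₀), _ := continuousAt_snd.eventually hev
      have e2 : ∀ᶠ p : ℝ × ℝ × X in nhds (s₀, t₀, x₀), _ :=
        (continuousAt_fst.prodMk (continuousAt_snd.comp continuousAt_snd)).eventually hD
      have e3 : ∀ᶠ p : ℝ × ℝ × X in nhds (s₀, t₀, x₀), _ :=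
        (continuousAt_snd.comp continuousAt_snd).eventually hν
      refine ⟨_, mem_nhdsWithin_of_mem_nhds (e1.and (e2.and e3)),
        C₁ ^ 2 / c + C₂ ^ 2 / c + 1, by positivity, ?_⟩
      rintro ⟨s, t, x⟩ ⟨⟨hx, h1⟩, h2, h3⟩ v
      have hn := hnn t x v
      constructor
      · rw [differential_eq_fderiv_symm hx (mdifferentiableAt_family hH s x)]
        refine (sq_apply_le hc h2 (h1 v)).trans ?_
        gcongr
        have : 0 ≤ C₂ ^ 2 / c := by positivity
        linarith
      · rw [lam.apply_eq_inChart hx]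
        refine (sq_apply_le hc h3 (h1 v)).trans ?_
        gcongr
        have : 0 ≤ C₁ ^ 2 / c := by positivity
        linarith
  obtain ⟨C, hC, h⟩ := hQ
  exact ⟨C, hC, fun s hs t ht x hx v => h (s, t, x) ⟨hs, ht, hx⟩ v⟩

theorem metricSq_nonneg (hJ : IsCompatibleLoop lam J) (t : ℝ) (x : X)
    (v : TangentSpace (𝓡 m) x) : 0 ≤ metricSq lam J t x v := by
  rcases eq_or_ne v 0 with rfl | hv
  · simp [metricSq]
  · exact (hJ.pos t x v hv).le

theorem metricSq_J (hJ : IsCompatibleLoop lam J) (t : ℝ) (x : X)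
    (v : TangentSpace (𝓡 m) x) : metricSq lam J t x (J t x v) = metricSq lam J t x v := by
  rw [metricSq, metricSq, hJ.sq, lam.d_swap, map_neg, neg_neg]

/-- Bessel's inequality. For the metric `B (j ·) ·`, the covectors `dρ` and `-lam` are dual to `Y`
and `j Y`, which are orthogonal and both of square length `ρ`. -/
theorem add_sq_le_of_contact {F : Type*} [NormedAddCommGroup F] [NormedSpace ℝ F]
    {B : F →L[ℝ] F →L[ℝ] ℝ} {j : F →L[ℝ] F} {lam dρ : F →L[ℝ] ℝ} {Y : F} {ρ : ℝ}
    (hB : ∀ v w, B v w = -B w v) (hj : ∀ v, j (j v) = -v) (hsymm : ∀ v w, B (j v) w = B (j w) v)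
    (hpos : ∀ v, 0 ≤ B (j v) v) (hY : ∀ v, B Y v = lam v) (hcontact : ∀ v, dρ (j v) = lam v)
    (hρ : 0 < ρ) (hdY : dρ Y = ρ) (v : F) :
    (dρ v) ^ 2 + (lam v) ^ 2 ≤ ρ * B (j v) v := by
  have g1 : ∀ v, B (j v) Y = dρ v := fun v => by
    rw [hB, hY, ← hcontact, hj, map_neg, neg_neg]
  have g2 : ∀ v, B (j v) (j Y) = -lam v := fun v => by
    rw [hsymm, hj, map_neg, ← hY]; rfl
  have g3 : B (j Y) v = dρ v := by rw [hsymm, g1]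
  have hself : lam Y = 0 := by
    have := hB Y Y
    rw [hY] at this
    linarith
  have hjY : lam (j Y) = -ρ := by rw [← hcontact, hj, map_neg, hdY]
  -- This vector is `ρ` times the component of `v` orthogonal to `Y` and `j Y`.
  have h := hpos (ρ • v - dρ v • Y + lam v • j Y)
  have hexp : B (j (ρ • v - dρ v • Y + lam v • j Y)) (ρ • v - dρ v • Y + lam v • j Y) =
      ρ * (ρ * B (j v) v - ((dρ v) ^ 2 + (lam v) ^ 2)) := by
    simp only [map_add, map_sub, map_smul, _root_.add_apply, _root_.sub_apply,
      _root_.smul_apply, smul_eq_mul, g1, g2, g3, hdY, hj, hself, map_neg, _root_.neg_apply, hY,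
      hjY]
    ring
  rw [hexp] at h
  have := nonneg_of_mul_nonneg_right h hρ
  linarith

end MetricBounds

/-! ### The inverse function theorem for maps into a manifold. -/

section LocalDiffeo

variable {E : Type*} [NormedAddCommGroup E] [NormedSpace ℝ E] [FiniteDimensional ℝ E]
  {M : Type*} [TopologicalSpace M] [ChartedSpace E M] [IsManifold 𝓘(ℝ, E) ∞ M]

/-- A smooth map from the model space with injective differential at a point is open there. -/
theorem map_nhds_eq_of_injective_mfderiv {F : E → M} {y₀ : E}
    (hF : ContMDiffAt 𝓘(ℝ, E) 𝓘(ℝ, E) ∞ F y₀)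
    (hinj : ∀ v : E, mfderiv 𝓘(ℝ, E) 𝓘(ℝ, E) F y₀ v = 0 → v = 0) :
    Filter.map F (nhds y₀) = nhds (F y₀) := by
  have hg := contDiffAt_extChartAt_comp hF
  have hd := fderiv_extChartAt_comp (eventually_mdifferentiableAt hF).self_of_nhds
    (mem_chart_source E (F y₀))
  set g : E → E := fun y => extChartAt 𝓘(ℝ, E) (F y₀) (F y) with hgdef
  have hinj' : Function.Injective (fderiv ℝ g y₀) := by
    rw [injective_iff_map_eq_zero]
    intro v hv
    refine hinj v ?_
    rw [hd v] at hv
    refine (chartDiff_bijective (mem_extChartAt_source (I := 𝓘(ℝ, E)) (F y₀))).1 ?_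
    exact hv.trans (map_zero (mfderiv 𝓘(ℝ, E) 𝓘(ℝ, E) (extChartAt 𝓘(ℝ, E) (F y₀)) (F y₀))).symm
  let e : E ≃L[ℝ] E :=
    (LinearEquiv.ofInjectiveEndo (fderiv ℝ g y₀ : E →ₗ[ℝ] E) hinj').toContinuousLinearEquiv
  have hs : HasStrictFDerivAt g (e : E →L[ℝ] E) y₀ := by
    have : (e : E →L[ℝ] E) = fderiv ℝ g y₀ := by ext v; rfl
    rw [this]
    exact hg.hasStrictFDerivAt (by simp)
  have hmap := hs.map_nhds_eq_of_equiv
  have hsymm : Filter.map (extChartAt 𝓘(ℝ, E) (F y₀)).symm (nhds (g y₀)) = nhds (F y₀) := by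
    have := map_extChartAt_symm_nhdsWithin_range (I := 𝓘(ℝ, E)) (F y₀)
    rwa [modelWithCornersSelf_coe, range_id, nhdsWithin_univ] at this
  rw [← hsymm, ← hmap, Filter.map_map]
  refine Filter.map_congr ?_
  filter_upwards [eventually_chart_symm_comp (E := E) hF.continuousAt] with y hy
  exact ((extChartAt 𝓘(ℝ, E) (F y₀)).left_inv (by simpa using hy)).symm

end LocalDiffeo

/-! ### Topology of the completion: closed ends and compact complements. -/

section Liouville

variable {n : ℕ} [NeZero (2 * n)]
  {W : Type*} [TopologicalSpace W] [ChartedSpace (EuclideanHalfSpace (2 * n)) W]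
  [IsManifold (𝓡∂ (2 * n)) ∞ W]
  {P : Type*} [TopologicalSpace P] [ChartedSpace (EuclideanSpace ℝ (Fin (2 * n - 1))) P]
  [IsManifold (𝓡 (2 * n - 1)) ∞ P]
  {X : Type*} [TopologicalSpace X] [ChartedSpace (EuclideanSpace ℝ (Fin (2 * n))) X]
  [IsManifold (𝓡 (2 * n)) ∞ X]
  {lamW : OneForm (𝓡∂ (2 * n)) (M := W)} {b : P → W}

namespace Completion

/-- The inclusion of the Liouville domain read in a chart of the domain. -/
def inclChart (C : Completion lamW b X) (w : W) : EuclideanSpace ℝ (Fin (2 * n)) → X :=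
  fun y => C.incl ((extChartAt (𝓡∂ (2 * n)) w).symm y)

theorem contMDiffAt_inclChart (C : Completion lamW b X) {w : W}
    {y : EuclideanSpace ℝ (Fin (2 * n))} (hy : (extChartAt (𝓡∂ (2 * n)) w).target ∈ nhds y) :
    ContMDiffAt 𝓘(ℝ, EuclideanSpace ℝ (Fin (2 * n))) (𝓡 (2 * n)) ∞ (C.inclChart w) y :=
  (C.incl_smooth _).comp y ((contMDiffOn_extChartAt_symm w).contMDiffAt hy)

theorem inChart_eq_pullback (C : Completion lamW b X) {w : W}
    {y : EuclideanSpace ℝ (Fin (2 * n))} (hy : (extChartAt (𝓡∂ (2 * n)) w).target ∈ nhds y) :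
    lamW.inChart w y = C.lam.pullback (C.inclChart w) y := by
  ext v
  have h1 : MDifferentiableAt 𝓘(ℝ, EuclideanSpace ℝ (Fin (2 * n))) (𝓡∂ (2 * n))
      (extChartAt (𝓡∂ (2 * n)) w).symm y :=
    ((contMDiffOn_extChartAt_symm (n := ∞) w).contMDiffAt hy).mdifferentiableAt (by simp)
  have hr : range (𝓡∂ (2 * n)) ∈ nhds y :=
    Filter.mem_of_superset hy (extChartAt_target_subset_range w)
  have h2 := mfderiv_comp y ((C.incl_smooth _).mdifferentiableAt (by simp)) h1
  simp only [OneForm.inChart, OneForm.pullback]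
  rw [mfderivWithin_of_mem_nhds hr]
  refine (C.incl_pullback _ _).symm.trans ?_
  exact congrArg (C.lam (C.inclChart w y)) (DFunLike.congr_fun h2 v).symm

/-- The inclusion pulls `d C.lam` back to `d lamW`, so a vector killed by its differential lies in
the kernel of a symplectic form and vanishes. The inverse function theorem then applies in a chart.
At interior points the derivatives within the half-space are ordinary derivatives. -/
theorem range_incl_mem_nhds (C : Completion lamW b X) (hW : IsLiouvilleDomain lamW) {w : W}
    (hw : (𝓡∂ (2 * n)).IsInteriorPoint w) : range C.incl ∈ nhds (C.incl w) := by
  have ht : (extChartAt (𝓡∂ (2 * n)) w).target ∈ nhds (extChartAt (𝓡∂ (2 * n)) w w) :=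
    mem_interior_iff_mem_nhds.1 (ModelWithCorners.isInteriorPoint_iff.1 hw)
  have hr : range (𝓡∂ (2 * n)) ∈ nhds (extChartAt (𝓡∂ (2 * n)) w w) :=
    Filter.mem_of_superset ht (extChartAt_target_subset_range w)
  have hF := C.contMDiffAt_inclChart ht
  have hF0 : C.inclChart w (extChartAt (𝓡∂ (2 * n)) w w) = C.incl w := by
    exact congrArg C.incl (extChartAt_to_inv w)
  have hev : lamW.inChart w =ᶠ[nhds (extChartAt (𝓡∂ (2 * n)) w w)]
      C.lam.pullback (C.inclChart w) := by
    filter_upwards [eventually_mem_nhds_iff.2 ht] with y hy using C.inChart_eq_pullback hy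
  have key := map_nhds_eq_of_injective_mfderiv hF (fun v hv => by
    have hinv := isInvertible_mfderiv_extChartAt (I := 𝓡∂ (2 * n)) (mem_extChartAt_source w)
    obtain ⟨v', rfl⟩ := hinv.bijective.2 v
    have hv' : v' = 0 := hW.symplectic w v' fun u => by
      rw [lamW.d_apply, fderivWithin_of_mem_nhds hr, hev.fderiv_eq]
      refine (C.lam_smooth.fderiv_pullback hF _ _).trans ?_
      rw [hv, map_zero]
      rfl
    rw [hv']
    exact map_zero _)
  rw [hF0] at key
  rw [← key, Filter.mem_map]
  exact Filter.univ_mem' fun y => mem_range_self _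

theorem mem_collar_target_iff (C : Completion lamW b X) {x : X} :
    x ∈ C.collar.target ↔ ∃ p : P, ∃ ρ > 0, C.collar (p, ρ) = x := by
  constructor
  · intro hx
    have h1 := C.collar.map_target hx
    rw [C.collar_source] at h1
    exact ⟨_, _, h1.2, C.collar.right_inv hx⟩
  · rintro ⟨p, ρ, hρ, rfl⟩
    exact C.collar.map_source (by rw [C.collar_source]; exact ⟨mem_univ _, hρ⟩)

theorem mem_collar_source (C : Completion lamW b X) {p : P} {ρ : ℝ} (hρ : 0 < ρ) :
    (p, ρ) ∈ C.collar.source := by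
  rw [C.collar_source]; exact ⟨mem_univ _, hρ⟩

theorem collar_mem_target (C : Completion lamW b X) {p : P} {ρ : ℝ} (hρ : 0 < ρ) :
    C.collar (p, ρ) ∈ C.collar.target := C.collar.map_source (C.mem_collar_source hρ)

theorem radius_collar (C : Completion lamW b X) {p : P} {ρ : ℝ} (hρ : 0 < ρ) :
    C.radius (C.collar (p, ρ)) = ρ := by
  rw [radius, C.collar.left_inv (C.mem_collar_source hρ)]

theorem mem_image_collar_iff (C : Completion lamW b X) {S : Set ℝ} (hS : S ⊆ Ioi 0) {x : X} :
    x ∈ C.collar '' (univ ×ˢ S) ↔ x ∈ C.collar.target ∧ C.radius x ∈ S := by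
  constructor
  · rintro ⟨⟨p, ρ⟩, ⟨-, hρ⟩, rfl⟩
    refine ⟨C.collar_mem_target (hS hρ), ?_⟩
    rwa [C.radius_collar (hS hρ)]
  · rintro ⟨hx, hr⟩
    exact ⟨C.collar.symm x, ⟨mem_univ _, hr⟩, C.collar.right_inv hx⟩

theorem mem_cylEnd_iff (C : Completion lamW b X) {r : ℝ} (hr : 0 < r) {x : X} :
    x ∈ C.cylEnd r ↔ x ∈ C.collar.target ∧ r ≤ C.radius x :=
  C.mem_image_collar_iff fun _ h => hr.trans_le h

theorem isOpen_image_collar (C : Completion lamW b X) {S : Set ℝ} (hS : S ⊆ Ioi 0)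
    (ho : IsOpen S) : IsOpen (C.collar '' (univ ×ˢ S)) := by
  refine C.collar.isOpen_image_of_subset_source (isOpen_univ.prod ho) ?_
  rw [C.collar_source]
  exact prod_mono_right hS

theorem compactSpace_boundary (hW : IsLiouvilleDomain lamW) (hb : IsBoundaryInclusion n b) :
    CompactSpace P := by
  have := hW.compact
  rw [← isCompact_univ_iff, hb.embedding.isCompact_iff, image_univ, hb.range_eq]
  exact (ModelWithCorners.isClosed_boundary (n := ∞) (by simp)).isCompact

theorem isCompact_image_collar (C : Completion lamW b X) (hW : IsLiouvilleDomain lamW)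
    (hb : IsBoundaryInclusion n b) {S : Set ℝ} (hS : S ⊆ Ioi 0) (hc : IsCompact S) :
    IsCompact (C.collar '' (univ ×ˢ S)) := by
  have := compactSpace_boundary hW hb
  refine (isCompact_univ.prod hc).image_of_continuousOn (C.collar.continuousOn.mono ?_)
  rw [C.collar_source]
  exact prod_mono_right hS

theorem isCompact_range_incl (C : Completion lamW b X) (hW : IsLiouvilleDomain lamW) :
    IsCompact (range C.incl) := by
  have := hW.compact
  exact isCompact_range C.incl_smooth.continuous

variable [T2Space X]

/-- Closedness is not part of the data of a completion. A point off the end is the image of an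
interior point of `W`, hence has a neighbourhood inside the image of `W`; that image meets the end
only in the slice `ρ = 1`, which is compact and so closed. -/
theorem isClosed_cylEnd_one (C : Completion lamW b X) (hW : IsLiouvilleDomain lamW)
    (hb : IsBoundaryInclusion n b) : IsClosed (C.cylEnd 1) := by
  rw [← isOpen_compl_iff, isOpen_iff_mem_nhds]
  intro x hx
  have h1 : (C.collar '' (univ ×ˢ ({1} : Set ℝ)))ᶜ ∈ nhds x := by
    refine (C.isCompact_image_collar hW hb (by simp) isCompact_singleton
      ).isClosed.isOpen_compl.mem_nhds
      fun h => hx ?_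
    exact image_mono (prod_mono_right (by simp)) h
  have h2 : x ∈ range C.incl := by
    have : x ∈ range C.incl ∪ C.collar '' (univ ×ˢ Ioi 1) := by rw [C.cover]; trivial
    refine this.resolve_right fun h => hx ?_
    exact image_mono (prod_mono_right Ioi_subset_Ici_self) h
  obtain ⟨w, rfl⟩ := h2
  have hw : (𝓡∂ (2 * n)).IsInteriorPoint w := by
    refine ((𝓡∂ (2 * n)).isInteriorPoint_or_isBoundaryPoint w).resolve_right fun h => hx ?_
    obtain ⟨p, rfl⟩ : w ∈ range b := by rw [hb.range_eq]; exact h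
    exact ⟨(p, 1), ⟨mem_univ _, mem_Ici.2 le_rfl⟩, C.collar_one p⟩
  filter_upwards [h1, C.range_incl_mem_nhds hW hw] with y hy1 hy2 hy3
  obtain ⟨⟨p, ρ⟩, ⟨-, hρ⟩, rfl⟩ := hy3
  rcases eq_or_lt_of_le (show (1 : ℝ) ≤ ρ from hρ) with h | h
  · exact hy1 ⟨(p, ρ), ⟨mem_univ _, h.symm⟩, rfl⟩
  · exact disjoint_left.1 C.disjoint hy2 ⟨(p, ρ), ⟨mem_univ _, h⟩, rfl⟩

theorem isClosed_cylEnd (C : Completion lamW b X) (hW : IsLiouvilleDomain lamW)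
    (hb : IsBoundaryInclusion n b) {r : ℝ} (hr : 0 < r) : IsClosed (C.cylEnd r) := by
  have hI : Icc r (max r 1) ⊆ Ioi 0 := fun _ h => hr.trans_le h.1
  have hO : Ioo 0 r ⊆ Ioi 0 := fun _ h => h.1
  -- For `r < 1` a compact annulus is added to the end at `1`; for `r > 1` the open piece `0 < ρ <
  -- r` is removed. The formula with `max r 1` covers both cases.
  have : C.cylEnd r = (C.collar '' (univ ×ˢ Icc r (max r 1)) ∪ C.cylEnd 1) ∩
      (C.collar '' (univ ×ˢ Ioo 0 r))ᶜ := by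
    ext x
    simp only [mem_inter_iff, mem_union, mem_compl_iff, C.mem_image_collar_iff hI,
      C.mem_image_collar_iff hO, C.mem_cylEnd_iff hr, C.mem_cylEnd_iff one_pos, mem_Icc, mem_Ioo]
    constructor
    · rintro ⟨h1, h2⟩
      refine ⟨?_, fun h => absurd h2 (not_le.2 h.2.2)⟩
      rcases le_total (C.radius x) (max r 1) with h | h
      · exact Or.inl ⟨h1, h2, h⟩
      · exact Or.inr ⟨h1, (le_max_right _ _).trans h⟩
    · rintro ⟨h | h, h'⟩
      · exact ⟨h.1, h.2.1⟩
      · refine ⟨h.1, not_lt.1 fun h2 => h' ⟨h.1, one_pos.trans_le h.2, h2⟩⟩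
  rw [this]
  exact ((C.isCompact_image_collar hW hb hI isCompact_Icc).isClosed.union
    (C.isClosed_cylEnd_one hW hb)).inter (C.isOpen_image_collar hO isOpen_Ioo).isClosed_compl

/-- The set is closed and lies in the union of the image of `W` and the annulus `1 ≤ ρ ≤ r`, both
compact. The compact sets of the theorem are of this form. -/
theorem isCompact_compl_image_collar (C : Completion lamW b X) (hW : IsLiouvilleDomain lamW)
    (hb : IsBoundaryInclusion n b) {r : ℝ} (hr : 0 < r) :
    IsCompact (C.collar '' (univ ×ˢ Ioi r))ᶜ := by
  have hO : Ioi r ⊆ Ioi 0 := fun _ h => hr.trans h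
  have hI : Icc 1 r ⊆ Ioi (0 : ℝ) := fun _ h => one_pos.trans_le h.1
  refine IsCompact.of_isClosed_subset ((C.isCompact_range_incl hW).union
    (C.isCompact_image_collar hW hb hI isCompact_Icc))
    (C.isOpen_image_collar hO isOpen_Ioi).isClosed_compl fun x hx => ?_
  have : x ∈ range C.incl ∪ C.collar '' (univ ×ˢ Ioi 1) := by rw [C.cover]; trivial
  refine this.imp_right fun h => ?_
  obtain ⟨⟨p, ρ⟩, ⟨-, hρ⟩, rfl⟩ := h
  exact ⟨(p, ρ), ⟨mem_univ _, le_of_lt hρ,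
    not_lt.1 fun h => hx ⟨(p, ρ), ⟨mem_univ _, h⟩, rfl⟩⟩, rfl⟩

end Completion
end Liouville

/-! ### The radial coordinate and the Liouville field on the collar. -/

section Radial

variable {n : ℕ} [NeZero (2 * n)]
  {W : Type*} [TopologicalSpace W] [ChartedSpace (EuclideanHalfSpace (2 * n)) W]
  [IsManifold (𝓡∂ (2 * n)) ∞ W]
  {P : Type*} [TopologicalSpace P] [ChartedSpace (EuclideanSpace ℝ (Fin (2 * n - 1))) P]
  [IsManifold (𝓡 (2 * n - 1)) ∞ P]
  {X : Type*} [TopologicalSpace X] [ChartedSpace (EuclideanSpace ℝ (Fin (2 * n))) X]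
  [IsManifold (𝓡 (2 * n)) ∞ X]
  {lamW : OneForm (𝓡∂ (2 * n)) (M := W)} {b : P → W}

namespace Completion

theorem contMDiffAt_radius (C : Completion lamW b X) {x : X} (hx : x ∈ C.collar.target) :
    ContMDiffAt (𝓡 (2 * n)) 𝓘(ℝ, ℝ) ∞ C.radius x :=
  contMDiffAt_snd.comp x (C.collar_symm_smooth.contMDiffAt (C.collar.open_target.mem_nhds hx))

/-- The collar read in a chart of the boundary. -/
def collarChart (C : Completion lamW b X) (p : P) :
    EuclideanSpace ℝ (Fin (2 * n - 1)) × ℝ → X :=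
  fun z => C.collar ((extChartAt (𝓡 (2 * n - 1)) p).symm z.1, z.2)

variable (C : Completion lamW b X) {p : P} {z : EuclideanSpace ℝ (Fin (2 * n - 1)) × ℝ}

theorem contMDiffAt_collarChart (h1 : z.1 ∈ (extChartAt (𝓡 (2 * n - 1)) p).target)
    (h2 : 0 < z.2) :
    ContMDiffAt 𝓘(ℝ, EuclideanSpace ℝ (Fin (2 * n - 1)) × ℝ) (𝓡 (2 * n)) ∞
      (C.collarChart p) z := by
  refine ContMDiffAt.comp (I' := (𝓡 (2 * n - 1)).prod 𝓘(ℝ, ℝ)) z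
    (C.collar_smooth.contMDiffAt (C.collar.open_source.mem_nhds (C.mem_collar_source h2))) ?_
  exact ContMDiffAt.prodMk
    ((contMDiffAt_extChartAt_symm h1).comp z contDiff_fst.contMDiff.contMDiffAt)
    contDiff_snd.contMDiff.contMDiffAt

/-- The pullback of `b^* lam` to a chart of the boundary. -/
def boundaryForm (lamW : OneForm (𝓡∂ (2 * n)) (M := W)) (b : P → W) (p : P)
    (y v : EuclideanSpace ℝ (Fin (2 * n - 1))) : ℝ :=
  lamW (b ((extChartAt (𝓡 (2 * n - 1)) p).symm y))
    (mfderiv (𝓡 (2 * n - 1)) (𝓡∂ (2 * n)) b ((extChartAt (𝓡 (2 * n - 1)) p).symm y)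
      (mfderiv (𝓡 (2 * n - 1)) (𝓡 (2 * n - 1)) (extChartAt (𝓡 (2 * n - 1)) p).symm y v))

theorem pullback_collarChart (h1 : z.1 ∈ (extChartAt (𝓡 (2 * n - 1)) p).target)
    (h2 : 0 < z.2) (v : EuclideanSpace ℝ (Fin (2 * n - 1)) × ℝ) :
    C.lam.pullback (C.collarChart p) z v = z.2 * boundaryForm lamW b p z.1 v.1 := by
  have e1 : HasMFDerivAt 𝓘(ℝ, EuclideanSpace ℝ (Fin (2 * n - 1)) × ℝ) (𝓡 (2 * n - 1))
      (fun z : EuclideanSpace ℝ (Fin (2 * n - 1)) × ℝ =>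
        (extChartAt (𝓡 (2 * n - 1)) p).symm z.1) z
      ((mfderiv (𝓡 (2 * n - 1)) (𝓡 (2 * n - 1)) (extChartAt (𝓡 (2 * n - 1)) p).symm z.1).comp
        (ContinuousLinearMap.fst ℝ (EuclideanSpace ℝ (Fin (2 * n - 1))) ℝ)) :=
    HasMFDerivAt.comp z
      ((contMDiffAt_extChartAt_symm h1).mdifferentiableAt (by simp)).hasMFDerivAt
      (hasFDerivAt_fst.hasMFDerivAt)
  have e2 : HasMFDerivAt 𝓘(ℝ, EuclideanSpace ℝ (Fin (2 * n - 1)) × ℝ) 𝓘(ℝ, ℝ)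
      (fun z : EuclideanSpace ℝ (Fin (2 * n - 1)) × ℝ => z.2) z
      (ContinuousLinearMap.snd ℝ (EuclideanSpace ℝ (Fin (2 * n - 1))) ℝ) :=
    hasFDerivAt_snd.hasMFDerivAt
  have e3 := ((C.collar_smooth.contMDiffAt (C.collar.open_source.mem_nhds
    (C.mem_collar_source (p := (extChartAt (𝓡 (2 * n - 1)) p).symm z.1) h2))).mdifferentiableAt
      (by simp)).hasMFDerivAt
  have e4 := HasMFDerivAt.comp z e3 (e1.prodMk e2)
  have e5 : mfderiv 𝓘(ℝ, EuclideanSpace ℝ (Fin (2 * n - 1)) × ℝ) (𝓡 (2 * n))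
    (C.collarChart p) z = _ := e4.mfderiv
  rw [OneForm.pullback, e5]
  exact C.collar_pullback _ z.2 h2
    (mfderiv (𝓡 (2 * n - 1)) (𝓡 (2 * n - 1)) (extChartAt (𝓡 (2 * n - 1)) p).symm z.1 v.1) v.2

theorem exists_collarChart {x : X} (hx : x ∈ C.collar.target) :
    ∃ (p : P) (z : EuclideanSpace ℝ (Fin (2 * n - 1)) × ℝ),
      z.1 ∈ (extChartAt (𝓡 (2 * n - 1)) p).target ∧ 0 < z.2 ∧ C.collarChart p z = x := by
  obtain ⟨p, ρ, hρ, rfl⟩ := C.mem_collar_target_iff.1 hx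
  refine ⟨p, (extChartAt (𝓡 (2 * n - 1)) p p, ρ), mem_extChartAt_target p, hρ, ?_⟩
  simp only [collarChart, extChartAt_to_inv]

theorem radius_collarChart_eventuallyEq (h2 : 0 < z.2) :
    (fun z => C.radius (C.collarChart p z)) =ᶠ[nhds z] Prod.snd := by
  filter_upwards [continuousAt_snd.eventually (lt_mem_nhds h2)] with z' hz'
  exact C.radius_collar hz'

/-- The map has a smooth local inverse `G`, built from the inverse of the collar and a chart of the
boundary. -/
theorem mfderiv_collarChart_surjective (h1 : z.1 ∈ (extChartAt (𝓡 (2 * n - 1)) p).target)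
    (h2 : 0 < z.2) (w : TangentSpace (𝓡 (2 * n)) (C.collarChart p z)) :
    ∃ v : EuclideanSpace ℝ (Fin (2 * n - 1)) × ℝ,
      mfderiv 𝓘(ℝ, EuclideanSpace ℝ (Fin (2 * n - 1)) × ℝ) (𝓡 (2 * n))
        (C.collarChart p) z v = w := by
  have hx : C.collarChart p z ∈ C.collar.target := C.collar_mem_target h2
  let G : X → EuclideanSpace ℝ (Fin (2 * n - 1)) × ℝ := fun x =>
    (extChartAt (𝓡 (2 * n - 1)) p (C.collar.symm x).1, (C.collar.symm x).2)
  have hsymm : C.collar.symm (C.collarChart p z) =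
      ((extChartAt (𝓡 (2 * n - 1)) p).symm z.1, z.2) := C.collar.left_inv (C.mem_collar_source h2)
  have hGz : G (C.collarChart p z) = z := by
    simp only [G, hsymm, (extChartAt (𝓡 (2 * n - 1)) p).right_inv h1]
  have hs := C.collar_symm_smooth.contMDiffAt (C.collar.open_target.mem_nhds hx)
  have hmem : (C.collar.symm (C.collarChart p z)).1 ∈ (chartAt (EuclideanSpace ℝ (Fin (2 * n - 1)))
      p).source := by
    rw [hsymm]
    simpa using (extChartAt (𝓡 (2 * n - 1)) p).map_target h1
  have hG : ContMDiffAt (𝓡 (2 * n)) 𝓘(ℝ, EuclideanSpace ℝ (Fin (2 * n - 1)) × ℝ) ∞ G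
      (C.collarChart p z) :=
    ContMDiffAt.prodMk_space
      (ContMDiffAt.comp _ (contMDiffAt_extChartAt' hmem) (contMDiffAt_fst.comp _ hs))
      (contMDiffAt_snd.comp _ hs)
  have hid : C.collarChart p ∘ G =ᶠ[nhds (C.collarChart p z)] id := by
    have hc : ∀ᶠ x in nhds (C.collarChart p z),
        (C.collar.symm x).1 ∈ (chartAt (EuclideanSpace ℝ (Fin (2 * n - 1))) p).source :=
      (continuousAt_fst.comp hs.continuousAt).eventually
        ((chartAt (EuclideanSpace ℝ (Fin (2 * n - 1))) p).open_source.mem_nhds hmem)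
    filter_upwards [hc, C.collar.open_target.mem_nhds hx] with x hx1 hx2
    simp only [Function.comp, G, collarChart, id]
    rw [(extChartAt (𝓡 (2 * n - 1)) p).left_inv (by simpa using hx1)]
    exact C.collar.right_inv hx2
  have hF := (C.contMDiffAt_collarChart h1 h2).mdifferentiableAt (by simp)
  have h3 := mfderiv_comp_of_eq hF (hG.mdifferentiableAt (by simp)) hGz
  rw [hid.mfderiv_eq, mfderiv_id] at h3
  let v₀ : EuclideanSpace ℝ (Fin (2 * n - 1)) × ℝ :=
    mfderiv (𝓡 (2 * n)) 𝓘(ℝ, EuclideanSpace ℝ (Fin (2 * n - 1)) × ℝ) G (C.collarChart p z) w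
  have key : ∀ z', G (C.collarChart p z) = z' →
      (mfderiv 𝓘(ℝ, EuclideanSpace ℝ (Fin (2 * n - 1)) × ℝ) (𝓡 (2 * n))
        (C.collarChart p) z' v₀ : EuclideanSpace ℝ (Fin (2 * n))) = w := by
    rintro _ rfl
    exact (DFunLike.congr_fun h3 w).symm
  exact ⟨v₀, key z hGz⟩

/-- In this chart `λ = ρ β`, where `β` does not depend on `ρ` and has no `dρ` component. Therefore
`dλ(∂/∂ρ, ·) = β`. -/
theorem d_collarChart (h1 : z.1 ∈ (extChartAt (𝓡 (2 * n - 1)) p).target) (h2 : 0 < z.2)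
    (w : TangentSpace (𝓡 (2 * n)) (C.collarChart p z)) :
    z.2 * C.lam.d (C.collarChart p z)
      (mfderiv 𝓘(ℝ, EuclideanSpace ℝ (Fin (2 * n - 1)) × ℝ) (𝓡 (2 * n)) (C.collarChart p) z
        ((0, 1) : EuclideanSpace ℝ (Fin (2 * n - 1)) × ℝ)) w = C.lam (C.collarChart p z) w := by
  have hF := C.contMDiffAt_collarChart h1 h2
  obtain ⟨v, rfl⟩ := C.mfderiv_collarChart_surjective h1 h2 w
  have hnear : ∀ᶠ z' in nhds z, z'.1 ∈ (extChartAt (𝓡 (2 * n - 1)) p).target ∧ 0 < z'.2 :=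
    (continuousAt_fst.eventually ((isOpen_extChartAt_target p).mem_nhds h1)).and
      (continuousAt_snd.eventually (lt_mem_nhds h2))
  have hμ : DifferentiableAt ℝ (C.lam.pullback (C.collarChart p)) z :=
    (C.lam_smooth.contDiffAt_pullback hF).differentiableAt (by simp)
  have hd := C.lam_smooth.fderiv_pullback hF (0, 1) v
  have hA : fderiv ℝ (C.lam.pullback (C.collarChart p)) z v (0, 1) = 0 := by
    have e1 := (hμ.hasFDerivAt.clm_apply
      (hasFDerivAt_const ((0, 1) : EuclideanSpace ℝ (Fin (2 * n - 1)) × ℝ) z))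
    have e2 : (fun z' => C.lam.pullback (C.collarChart p) z' (0, 1)) =ᶠ[nhds z] fun _ => 0 := by
      filter_upwards [hnear] with z' hz'
      rw [C.pullback_collarChart hz'.1 hz'.2]
      have : boundaryForm lamW b p z'.1 0 = 0 := by
        change lamW _ (mfderiv (𝓡 (2 * n - 1)) (𝓡∂ (2 * n)) b _ (mfderiv (𝓡 (2 * n - 1))
          (𝓡 (2 * n - 1)) (extChartAt (𝓡 (2 * n - 1)) p).symm z'.1
            (0 : TangentSpace (𝓡 (2 * n - 1)) z'.1))) = 0
        rw [map_zero, map_zero, map_zero]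
      simp [this]
    have e3 := e1.unique ((hasFDerivAt_const (0 : ℝ) z).congr_of_eventuallyEq e2)
    simpa using DFunLike.congr_fun e3 v
  have hB : fderiv ℝ (C.lam.pullback (C.collarChart p)) z (0, 1) v =
      boundaryForm lamW b p z.1 v.1 := by
    have e0 : HasDerivAt (fun r : ℝ => (z.1, r)) ((0, 1) : EuclideanSpace ℝ _ × ℝ) z.2 :=
      (hasDerivAt_const _ _).prodMk (hasDerivAt_id _)
    have e1 : HasDerivAt (fun r => C.lam.pullback (C.collarChart p) (z.1, r) v)
        (fderiv ℝ (C.lam.pullback (C.collarChart p)) z (0, 1) v) z.2 := by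
      have := (HasFDerivAt.comp_hasDerivAt (x := z.2) (f := fun r : ℝ => (z.1, r))
        (l := C.lam.pullback (C.collarChart p)) hμ.hasFDerivAt e0)
      simpa using this.clm_apply (hasDerivAt_const z.2 v)
    have e2 : (fun r => C.lam.pullback (C.collarChart p) (z.1, r) v) =ᶠ[nhds z.2]
        fun r => r * boundaryForm lamW b p z.1 v.1 := by
      filter_upwards [lt_mem_nhds h2] with r hr
      rw [C.pullback_collarChart (z := (z.1, r)) h1 hr]
    have e3 := e1.unique (((hasDerivAt_id z.2).mul_const _).congr_of_eventuallyEq e2)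
    simpa using e3
  rw [hA, hB, sub_zero] at hd
  rw [← hd]
  exact (C.pullback_collarChart h1 h2 v).symm

/-- On the collar, the Liouville field is `ρ ∂/∂ρ`. -/
theorem differential_radius_liouvilleField {x : X} (hx : x ∈ C.collar.target) :
    differential C.radius x (C.lam.liouvilleField x) = C.radius x := by
  obtain ⟨p, z, h1, h2, rfl⟩ := C.exists_collarChart hx
  have hF := (C.contMDiffAt_collarChart h1 h2).mdifferentiableAt (by simp)
  set D := mfderiv 𝓘(ℝ, EuclideanSpace ℝ (Fin (2 * n - 1)) × ℝ) (𝓡 (2 * n)) (C.collarChart p) z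
    with hD
  have hY : C.lam.liouvilleField (C.collarChart p z) =
      z.2 • D ((0, 1) : EuclideanSpace ℝ (Fin (2 * n - 1)) × ℝ) := by
    rw [← sub_eq_zero]
    refine C.lam_symplectic _ _ fun w => ?_
    rw [map_sub, map_smul, _root_.sub_apply, _root_.smul_apply, smul_eq_mul, hD,
      C.d_collarChart h1 h2, OneForm.d_liouvilleField C.lam_symplectic, sub_self]
  have hr : C.radius (C.collarChart p z) = z.2 := C.radius_collar h2
  have h3 := mfderiv_comp z ((C.contMDiffAt_radius hx).mdifferentiableAt (by simp)) hF
  have h4 := (C.radius_collarChart_eventuallyEq (p := p) h2).mfderiv_eq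
    (I := 𝓘(ℝ, EuclideanSpace ℝ (Fin (2 * n - 1)) × ℝ)) (I' := 𝓘(ℝ, ℝ))
  have h5 := DFunLike.congr_fun (h3.symm.trans h4)
    ((0, 1) : EuclideanSpace ℝ (Fin (2 * n - 1)) × ℝ)
  have h6 : differential C.radius (C.collarChart p z)
      (D ((0, 1) : EuclideanSpace ℝ (Fin (2 * n - 1)) × ℝ)) = 1 := by
    refine Eq.trans h5 ?_
    rw [mfderiv_eq_fderiv, fderiv_snd]
    rfl
  rw [hY, map_smul, h6, hr, smul_eq_mul, mul_one]

end Completion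
end Radial

/-! ### The standing data, profile calculus and radial Hamiltonians. -/

section Data

variable {n : ℕ} [NeZero (2 * n)]
  {W : Type*} [TopologicalSpace W] [ChartedSpace (EuclideanHalfSpace (2 * n)) W]
  [IsManifold (𝓡∂ (2 * n)) ∞ W]
  {P : Type*} [TopologicalSpace P] [ChartedSpace (EuclideanSpace ℝ (Fin (2 * n - 1))) P]
  [IsManifold (𝓡 (2 * n - 1)) ∞ P]
  {X : Type*} [TopologicalSpace X] [ChartedSpace (EuclideanSpace ℝ (Fin (2 * n))) X]
  [IsManifold (𝓡 (2 * n)) ∞ X]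
  {lamW : OneForm (𝓡∂ (2 * n)) (M := W)} {b : P → W}

/-- The standing assumptions on the almost complex structures and the Hamiltonians. -/
structure IsRadialAtInfinity (C : Completion lamW b X) (J : EndLoop (2 * n) X) (ρ₀ κ : ℝ)
    (Ham : ℝ → X → ℝ) (h : ℝ → ℝ → ℝ) : Prop where
  domain : IsLiouvilleDomain lamW
  boundary : IsBoundaryInclusion n b
  compatible : IsCompatibleLoop C.lam J
  pos : 0 < ρ₀
  contact : ∀ t, ∀ w ∈ C.cylEnd ρ₀, ∀ v : TangentSpace (𝓡 (2 * n)) w,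
    differential C.radius w (J t w v) = C.lam w v
  smooth : ContMDiff (𝓘(ℝ, ℝ).prod (𝓡 (2 * n))) 𝓘(ℝ, ℝ) ∞ (fun p : ℝ × X => Ham p.1 p.2)
  past : ∀ s ≤ 0, Ham s = Ham 0
  future : ∀ s ≥ 1, Ham s = Ham 1
  starshaped : ∃ θ > 0, ∀ s w, Ham s w = 0 →
    C.lam w (C.lam.hamiltonianField (Ham s) w) - Ham s w ≥ θ
  kappa_pos : 0 < κ
  profile : IsAdmissibleProfile ρ₀ κ h
  radial : ∀ s (x : P), ∀ ρ ≥ ρ₀, Ham s (C.collar (x, ρ)) = h s ρ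

/-- The open end `∂W × (r, ∞)`. -/
def Completion.openEnd (C : Completion lamW b X) (r : ℝ) : Set X :=
  C.collar.target ∩ {x | r < C.radius x}

theorem Completion.isOpen_openEnd (C : Completion lamW b X) (r : ℝ) : IsOpen (C.openEnd r) := by
  have hc : ContinuousOn C.radius C.collar.target := fun x hx =>
    (C.contMDiffAt_radius hx).continuousAt.continuousWithinAt
  exact hc.isOpen_inter_preimage C.collar.open_target isOpen_Ioi

namespace IsAdmissibleProfile

variable {ρ₀ κ : ℝ} {h : ℝ → ℝ → ℝ} (hh : IsAdmissibleProfile ρ₀ κ h)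
include hh

theorem contDiffAt (s : ℝ) {ρ : ℝ} (hρ : ρ₀ < ρ) :
    ContDiffAt ℝ ∞ (fun p : ℝ × ℝ => h p.1 p.2) (s, ρ) :=
  hh.smooth.contDiffAt (prod_mem_nhds Filter.univ_mem (Ici_mem_nhds hρ))

theorem hasDerivAt (s : ℝ) {ρ : ℝ} (hρ : ρ₀ < ρ) : HasDerivAt (h s) (dRho ρ₀ h s ρ) ρ := by
  have h1 : DifferentiableAt ℝ (h s) ρ := by
    have := (hh.contDiffAt s hρ).comp ρ (contDiffAt_const.prodMk contDiffAt_id)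
    exact this.differentiableAt (by simp)
  rw [dRho, derivWithin_of_mem_nhds (Ici_mem_nhds hρ)]
  exact h1.hasDerivAt

theorem contDiffAt_dRho (s : ℝ) {ρ : ℝ} (hρ : ρ₀ < ρ) :
    ContDiffAt ℝ ∞ (fun p : ℝ × ℝ => dRho ρ₀ h p.1 p.2) (s, ρ) := by
  have h1 : ContDiffAt ℝ ∞ (fun p : ℝ × ℝ => fderiv ℝ (fun p : ℝ × ℝ => h p.1 p.2) p (0, 1))
      (s, ρ) := ((hh.contDiffAt s hρ).fderiv_right (m := ∞) (by simp)).clm_apply contDiffAt_const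
  refine h1.congr_of_eventuallyEq ?_
  filter_upwards [continuousAt_snd.eventually (lt_mem_nhds hρ)] with p hp
  have h2 := ((hh.contDiffAt p.1 hp).differentiableAt (by simp)).hasFDerivAt.comp_hasDerivAt p.2
    ((hasDerivAt_const p.2 p.1).prodMk (hasDerivAt_id p.2))
  exact (hh.hasDerivAt p.1 hp).unique h2

/-- The chain rule for `∂h/∂ρ` along a curve `(s, r (s))`. -/
theorem hasDerivAt_dRho_comp {r : ℝ → ℝ} {r' s : ℝ} (hr : HasDerivAt r r' s) (hρ : ρ₀ < r s) :
    HasDerivAt (fun σ => dRho ρ₀ h σ (r σ))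
      (deriv (fun σ => dRho ρ₀ h σ (r s)) s + dRho ρ₀ (dRho ρ₀ h) s (r s) * r') s := by
  have hd := ((hh.contDiffAt_dRho s hρ).differentiableAt (by simp)).hasFDerivAt
  set L := fderiv ℝ (fun p : ℝ × ℝ => dRho ρ₀ h p.1 p.2) (s, r s)
  have h1 : HasDerivAt (fun σ => dRho ρ₀ h σ (r σ)) (L (1, r')) s :=
    HasFDerivAt.comp_hasDerivAt (f := fun σ : ℝ => (σ, r σ)) s hd ((hasDerivAt_id s).prodMk hr)
  have h2 : HasDerivAt (fun σ => dRho ρ₀ h σ (r s)) (L (1, 0)) s :=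
    HasFDerivAt.comp_hasDerivAt (f := fun σ : ℝ => (σ, r s)) s hd
      ((hasDerivAt_id s).prodMk (hasDerivAt_const s (r s)))
  have h3 : HasDerivAt (dRho ρ₀ h s) (L (0, 1)) (r s) :=
    HasFDerivAt.comp_hasDerivAt (f := fun ρ : ℝ => (s, ρ)) (r s) hd
      ((hasDerivAt_const (r s) s).prodMk (hasDerivAt_id (r s)))
  have h4 : dRho ρ₀ (dRho ρ₀ h) s (r s) = deriv (dRho ρ₀ h s) (r s) := by
    rw [dRho, derivWithin_of_mem_nhds (Ici_mem_nhds hρ)]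
  rw [h4, h3.deriv, h2.deriv]
  convert h1 using 1
  have : ((1 : ℝ), r') = (1, 0) + r' • ((0, 1) : ℝ × ℝ) := by simp
  rw [this, map_add, map_smul, smul_eq_mul, mul_comm]

end IsAdmissibleProfile

namespace IsRadialAtInfinity

variable {C : Completion lamW b X} {J : EndLoop (2 * n) X} {ρ₀ κ : ℝ}
    {Ham : ℝ → X → ℝ} {h : ℝ → ℝ → ℝ} (D : IsRadialAtInfinity C J ρ₀ κ Ham h)
include D

theorem ham_eq {x : X} (hx : x ∈ C.collar.target) (hr : ρ₀ ≤ C.radius x) (s : ℝ) :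
    Ham s x = h s (C.radius x) := by
  obtain ⟨p, ρ, hρ, rfl⟩ := C.mem_collar_target_iff.1 hx
  rw [C.radius_collar hρ] at hr ⊢
  exact D.radial s p ρ hr

theorem differential_ham {x : X} (hx : x ∈ C.openEnd ρ₀) (s : ℝ)
    (v : TangentSpace (𝓡 (2 * n)) x) :
    differential (Ham s) x v = dRho ρ₀ h s (C.radius x) * differential C.radius x v := by
  have h1 : Ham s =ᶠ[nhds x] h s ∘ C.radius := by
    filter_upwards [(C.isOpen_openEnd ρ₀).mem_nhds hx] with y hy
    exact D.ham_eq hy.1 hy.2.le s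
  have h2 := (D.profile.hasDerivAt s hx.2).hasFDerivAt.hasMFDerivAt
  have h3 := ((C.contMDiffAt_radius hx.1).mdifferentiableAt (by simp)).hasMFDerivAt
  have h4 : mfderiv (𝓡 (2 * n)) 𝓘(ℝ, ℝ) (Ham s) x = _ :=
    h1.mfderiv_eq.trans (HasMFDerivAt.comp x h2 h3).mfderiv
  have h5 := DFunLike.congr_fun h4 v
  refine h5.trans ?_
  change (ContinuousLinearMap.toSpanSingleton ℝ (dRho ρ₀ h s (C.radius x)))
    (differential C.radius x v) = _
  rw [ContinuousLinearMap.toSpanSingleton_apply, smul_eq_mul, mul_comm]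

/-- With `Y` the Liouville field, `λ(X_H) = ω(Y, X_H) = dH(Y)`, and `dρ(Y) = ρ`. -/
theorem lam_hamiltonianField {x : X} (hx : x ∈ C.openEnd ρ₀) (s : ℝ) :
    C.lam x (C.lam.hamiltonianField (Ham s) x) = C.radius x * dRho ρ₀ h s (C.radius x) := by
  rw [← OneForm.d_liouvilleField C.lam_symplectic, C.lam.d_swap]
  have h1 : C.lam.d x (C.lam.hamiltonianField (Ham s) x) (C.lam.liouvilleField x) =
    -differential (Ham s) x (C.lam.liouvilleField x) :=
    OneForm.d_hamiltonianField C.lam_symplectic (Ham s) x _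
  rw [h1, D.differential_ham hx, C.differential_radius_liouvilleField hx.1]
  ring

/-- Since `dH = h' dρ` and `dH(X_H) = 0`, the claim holds where `h' ≠ 0`; where `h' = 0` the field
itself vanishes. -/
theorem differential_radius_hamiltonianField {x : X} (hx : x ∈ C.openEnd ρ₀) (s : ℝ) :
    differential C.radius x (C.lam.hamiltonianField (Ham s) x) = 0 := by
  have h1 : ∀ v, C.lam.d x (C.lam.hamiltonianField (Ham s) x) v =
      -(dRho ρ₀ h s (C.radius x) * differential C.radius x v) := fun v =>
    (OneForm.d_hamiltonianField C.lam_symplectic (Ham s) x v).trans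
      (congrArg Neg.neg (D.differential_ham hx s v))
  rcases eq_or_ne (dRho ρ₀ h s (C.radius x)) 0 with h0 | h0
  · have : C.lam.hamiltonianField (Ham s) x = 0 :=
      C.lam_symplectic x _ fun v => by rw [h1, h0, zero_mul, neg_zero]
    rw [this, map_zero]
  · have h2 := h1 (C.lam.hamiltonianField (Ham s) x)
    rw [OneForm.d_self] at h2
    have h3 := neg_eq_zero.1 h2.symm
    exact (mul_eq_zero.1 h3).resolve_left h0

theorem openEnd_subset_cylEnd : C.openEnd ρ₀ ⊆ C.cylEnd ρ₀ := fun _ hx =>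
  (C.mem_cylEnd_iff D.pos).2 ⟨hx.1, hx.2.le⟩

theorem differential_radius_sq_add_le {x : X} (hx : x ∈ C.openEnd ρ₀) (t : ℝ)
    (v : TangentSpace (𝓡 (2 * n)) x) :
    (differential C.radius x v) ^ 2 + (C.lam x v) ^ 2 ≤
      C.radius x * metricSq C.lam J t x v :=
  add_sq_le_of_contact (F := EuclideanSpace ℝ (Fin (2 * n))) (B := C.lam.d x) (j := J t x)
    (lam := C.lam x) (dρ := differential C.radius x) (Y := C.lam.liouvilleField x)
    (C.lam.d_swap x) (D.compatible.sq t x) (D.compatible.symm t x)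
    (metricSq_nonneg D.compatible t x) (OneForm.d_liouvilleField C.lam_symplectic x)
    (D.contact t x (D.openEnd_subset_cylEnd hx)) (D.pos.trans hx.2)
    (C.differential_radius_liouvilleField hx.1) v

end IsRadialAtInfinity

end Data

/-! ### Solutions: partial derivatives and energy density. -/

section Solutions

variable {m : ℕ} {X : Type*} [TopologicalSpace X] [ChartedSpace (EuclideanSpace ℝ (Fin m)) X]
  [IsManifold (𝓡 m) ∞ X] {lam : OneForm (𝓡 m) (M := X)} {J : EndLoop m X} {Ham : ℝ → X → ℝ}
  {u : ℝ → ℝ → X} {η : ℝ → ℝ}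

/-- The partial derivative `∂ₛu`. -/
def velS (u : ℝ → ℝ → X) (s t : ℝ) : TangentSpace (𝓡 m) (u s t) :=
  velocity (fun σ => u σ t) s

/-- The partial derivative `∂ₜu`. -/
def velT (u : ℝ → ℝ → X) (s t : ℝ) : TangentSpace (𝓡 m) (u s t) :=
  velocity (fun τ => u s τ) t

/-- The energy density `|∂ₛu|²`. -/
def energyDensity (lam : OneForm (𝓡 m) (M := X)) (J : EndLoop m X) (u : ℝ → ℝ → X) (s t : ℝ) : ℝ :=
  metricSq lam J t (u s t) (velS (m := m) u s t)

section Smooth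

variable (hu : ContMDiff 𝓘(ℝ, ℝ × ℝ) (𝓡 m) ∞ (fun p : ℝ × ℝ => u p.1 p.2))
include hu

theorem mdifferentiableAt_fst (s t : ℝ) :
    MDifferentiableAt 𝓘(ℝ, ℝ) (𝓡 m) (fun σ => u σ t) s := by
  have h1 : ContMDiff 𝓘(ℝ, ℝ) 𝓘(ℝ, ℝ × ℝ) ∞ (fun σ : ℝ => (σ, t)) :=
    (contDiff_id.prodMk contDiff_const).contMDiff
  exact (hu.comp h1).mdifferentiableAt (by simp)

theorem mdifferentiableAt_snd (s t : ℝ) :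
    MDifferentiableAt 𝓘(ℝ, ℝ) (𝓡 m) (fun τ => u s τ) t := by
  have h1 : ContMDiff 𝓘(ℝ, ℝ) 𝓘(ℝ, ℝ × ℝ) ∞ (fun τ : ℝ => (s, τ)) :=
    (contDiff_const.prodMk contDiff_id).contMDiff
  exact (hu.comp h1).mdifferentiableAt (by simp)

theorem velS_eq_mfderiv (s t : ℝ) :
    velS (m := m) u s t = mfderiv 𝓘(ℝ, ℝ × ℝ) (𝓡 m) (fun p : ℝ × ℝ => u p.1 p.2) (s, t)
      ((1, 0) : ℝ × ℝ) := by
  have h1 : HasMFDerivAt 𝓘(ℝ, ℝ) 𝓘(ℝ, ℝ × ℝ) (fun σ : ℝ => (σ, t)) s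
      (ContinuousLinearMap.inl ℝ ℝ ℝ) :=
    (hasFDerivAt_prodMk_left s t).hasMFDerivAt
  have h2 := HasMFDerivAt.comp s (hu.mdifferentiableAt (x := (s, t)) (by simp)).hasMFDerivAt h1
  exact DFunLike.congr_fun h2.mfderiv (1 : ℝ)

theorem velT_eq_mfderiv (s t : ℝ) :
    velT (m := m) u s t = mfderiv 𝓘(ℝ, ℝ × ℝ) (𝓡 m) (fun p : ℝ × ℝ => u p.1 p.2) (s, t)
      ((0, 1) : ℝ × ℝ) := by
  have h1 : HasMFDerivAt 𝓘(ℝ, ℝ) 𝓘(ℝ, ℝ × ℝ) (fun τ : ℝ => (s, τ)) t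
      (ContinuousLinearMap.inr ℝ ℝ ℝ) :=
    (hasFDerivAt_prodMk_right s t).hasMFDerivAt
  have h2 := HasMFDerivAt.comp t (hu.mdifferentiableAt (x := (s, t)) (by simp)).hasMFDerivAt h1
  exact DFunLike.congr_fun h2.mfderiv (1 : ℝ)

theorem hasDerivAt_comp_velS {g : X → ℝ} {s t : ℝ}
    (hg : MDifferentiableAt (𝓡 m) 𝓘(ℝ, ℝ) g (u s t)) :
    HasDerivAt (fun σ => g (u σ t)) (differential g (u s t) (velS (m := m) u s t)) s := by
  have h1 := HasMFDerivAt.comp s hg.hasMFDerivAt (mdifferentiableAt_fst hu s t).hasMFDerivAt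
  have h2 : HasFDerivAt (fun σ => g (u σ t)) (((differential g (u s t)).comp
      (mfderiv 𝓘(ℝ, ℝ) (𝓡 m) (fun σ => u σ t) s) : ℝ →L[ℝ] ℝ)) s := h1.hasFDerivAt
  exact h2.hasDerivAt

theorem hasDerivAt_comp_velT {g : X → ℝ} {s t : ℝ}
    (hg : MDifferentiableAt (𝓡 m) 𝓘(ℝ, ℝ) g (u s t)) :
    HasDerivAt (fun τ => g (u s τ)) (differential g (u s t) (velT (m := m) u s t)) t := by
  have h1 := HasMFDerivAt.comp t hg.hasMFDerivAt (mdifferentiableAt_snd hu s t).hasMFDerivAt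
  have h2 : HasFDerivAt (fun τ => g (u s τ)) (((differential g (u s t)).comp
      (mfderiv 𝓘(ℝ, ℝ) (𝓡 m) (fun τ => u s τ) t) : ℝ →L[ℝ] ℝ)) t := h1.hasFDerivAt
  exact h2.hasDerivAt

theorem lam_velS (s t : ℝ) : lam (u s t) (velS (m := m) u s t) =
    lam.pullback (fun p : ℝ × ℝ => u p.1 p.2) (s, t) (1, 0) := by
  rw [velS_eq_mfderiv hu]; rfl

theorem lam_velT (s t : ℝ) : lam (u s t) (velT (m := m) u s t) =
    lam.pullback (fun p : ℝ × ℝ => u p.1 p.2) (s, t) (0, 1) := by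
  rw [velT_eq_mfderiv hu]; rfl

theorem contDiff_pullback (hlam : lam.IsSmooth) :
    ContDiff ℝ ∞ (lam.pullback (fun p : ℝ × ℝ => u p.1 p.2)) :=
  contDiff_iff_contDiffAt.2 fun p => hlam.contDiffAt_pullback (hu p)

theorem d_velS_velT (hlam : lam.IsSmooth) (s t : ℝ) :
    lam.d (u s t) (velS (m := m) u s t) (velT (m := m) u s t) =
      fderiv ℝ (lam.pullback (fun p : ℝ × ℝ => u p.1 p.2)) (s, t) (1, 0) (0, 1)
      - fderiv ℝ (lam.pullback (fun p : ℝ × ℝ => u p.1 p.2)) (s, t) (0, 1) (1, 0) := by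
  rw [hlam.fderiv_pullback (hu (s, t)), velS_eq_mfderiv hu, velT_eq_mfderiv hu]

theorem hasDerivAt_lam_velT (hlam : lam.IsSmooth) (s t : ℝ) :
    HasDerivAt (fun σ => lam (u σ t) (velT (m := m) u σ t))
      (fderiv ℝ (lam.pullback (fun p : ℝ × ℝ => u p.1 p.2)) (s, t) (1, 0) (0, 1)) s := by
  simp only [lam_velT hu]
  have h1 := ((contDiff_pullback hu hlam).differentiable (by simp) (s, t)).hasFDerivAt
  have h2 := HasFDerivAt.comp_hasDerivAt (f := fun σ : ℝ => (σ, t)) s h1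
    ((hasDerivAt_id s).prodMk (hasDerivAt_const s t))
  simpa using h2.clm_apply (hasDerivAt_const s ((0, 1) : ℝ × ℝ))

theorem hasDerivAt_lam_velS (hlam : lam.IsSmooth) (s t : ℝ) :
    HasDerivAt (fun τ => lam (u s τ) (velS (m := m) u s τ))
      (fderiv ℝ (lam.pullback (fun p : ℝ × ℝ => u p.1 p.2)) (s, t) (0, 1) (1, 0)) t := by
  simp only [lam_velS hu]
  have h1 := ((contDiff_pullback hu hlam).differentiable (by simp) (s, t)).hasFDerivAt
  have h2 := HasFDerivAt.comp_hasDerivAt (f := fun τ : ℝ => (s, τ)) t h1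
    ((hasDerivAt_const t s).prodMk (hasDerivAt_id t))
  simpa using h2.clm_apply (hasDerivAt_const t ((1, 0) : ℝ × ℝ))

theorem continuous_lam_velT (hlam : lam.IsSmooth) (s : ℝ) :
    Continuous fun t => lam (u s t) (velT (m := m) u s t) := by
  simp only [lam_velT hu]
  have := (contDiff_pullback hu hlam).continuous
  fun_prop

theorem continuous_differential_velS
    (hH : ContMDiff (𝓘(ℝ, ℝ).prod (𝓡 m)) 𝓘(ℝ, ℝ) ∞ (fun p : ℝ × X => Ham p.1 p.2)) :
    Continuous fun p : ℝ × ℝ => differential (Ham p.1) (u p.1 p.2) (velS (m := m) u p.1 p.2) := by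
  let Ψ : ℝ × ℝ × ℝ → ℝ := fun q => Ham q.1 (u q.2.1 q.2.2)
  have h1 : ContDiff ℝ ∞ Ψ := by
    rw [← contMDiff_iff_contDiff]
    exact hH.comp (ContMDiff.prodMk contDiff_fst.contMDiff (hu.comp contDiff_snd.contMDiff))
  have h2 : ∀ p : ℝ × ℝ, differential (Ham p.1) (u p.1 p.2) (velS (m := m) u p.1 p.2) =
      fderiv ℝ Ψ (p.1, p.1, p.2) (0, 1, 0) := by
    intro p
    have h3 := hasDerivAt_comp_velS hu (mdifferentiableAt_family hH p.1 (u p.1 p.2))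
    have h4 := HasFDerivAt.comp_hasDerivAt (f := fun σ : ℝ => (p.1, σ, p.2)) p.1
      (h1.differentiable (by simp) (p.1, p.1, p.2)).hasFDerivAt
      ((hasDerivAt_const p.1 p.1).prodMk ((hasDerivAt_id p.1).prodMk (hasDerivAt_const p.1 p.2)))
    exact h3.unique h4
  simp only [h2]
  have h5 := h1.continuous_fderiv (by simp)
  fun_prop

end Smooth

namespace IsSolution

variable (sol : IsSolution lam J Ham u η) (hJ : IsCompatibleLoop lam J)
include sol hJ

theorem J_velS (s t : ℝ) : J t (u s t) (velS (m := m) u s t) =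
    velT (m := m) u s t - η s • lam.hamiltonianField (Ham s) (u s t) := by
  have h1 := eq_neg_of_add_eq_zero_left (sol.loop_eq s t)
  have h2 : velS (m := m) u s t = -J t (u s t)
      (velT (m := m) u s t - η s • lam.hamiltonianField (Ham s) (u s t)) :=
    h1
  rw [h2, map_neg, hJ.sq, neg_neg]

theorem velT_eq (s t : ℝ) : velT (m := m) u s t =
    J t (u s t) (velS (m := m) u s t) + η s • lam.hamiltonianField (Ham s) (u s t) := by
  rw [sol.J_velS hJ, sub_add_cancel]

theorem energyDensity_nonneg (s t : ℝ) : 0 ≤ energyDensity lam J u s t :=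
  metricSq_nonneg hJ t _ _

/-- Along a solution the loop component of the gradient is `-∂ₛu`. -/
theorem gradNormSq_eq (s : ℝ) : gradNormSq lam J (Ham s) (u s) (η s) =
    (∫ t in (0 : ℝ)..1, energyDensity lam J u s t) + (∫ t in (0 : ℝ)..1, Ham s (u s t)) ^ 2 := by
  rw [gradNormSq, neg_sq]
  congr 1
  refine intervalIntegral.integral_congr fun t _ => ?_
  have h1 : gradLoop lam J (Ham s) (u s) (η s) t = -velS (m := m) u s t := by
    have h2 := eq_neg_of_add_eq_zero_right (sol.loop_eq s t)
    exact h2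
  simp only [h1, energyDensity, metricSq, map_neg, _root_.neg_apply, neg_neg]

/-- Substituting `J∂ₛu = ∂ₜu - ηX_H` into `ω(J∂ₛu, ∂ₛu)` leaves `-dλ(∂ₛu, ∂ₜu) + η dH(∂ₛu)`. No `J`
remains, which gives both the continuity of the density and the Laplacian of the radius. -/
theorem energyDensity_eq (hlam : lam.IsSmooth) (hsymp : lam.IsSymplectic) (s t : ℝ) :
    energyDensity lam J u s t =
      fderiv ℝ (lam.pullback (fun p : ℝ × ℝ => u p.1 p.2)) (s, t) (0, 1) (1, 0)
      - fderiv ℝ (lam.pullback (fun p : ℝ × ℝ => u p.1 p.2)) (s, t) (1, 0) (0, 1)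
      + η s * differential (Ham s) (u s t) (velS (m := m) u s t) := by
  have h1 : lam.d (u s t) (lam.hamiltonianField (Ham s) (u s t)) (velS (m := m) u s t) =
      -differential (Ham s) (u s t) (velS (m := m) u s t) :=
    OneForm.d_hamiltonianField hsymp (Ham s) (u s t) _
  rw [energyDensity, metricSq, sol.J_velS hJ, map_sub, _root_.sub_apply, map_smul,
    _root_.smul_apply, h1, lam.d_swap, d_velS_velT sol.smooth hlam, smul_eq_mul]
  ring

theorem continuous_multiplier : Continuous η :=
  continuous_iff_continuousAt.2 fun s => (sol.multiplier_eq s).continuousAt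

theorem continuous_energyDensity (hlam : lam.IsSmooth) (hsymp : lam.IsSymplectic)
    (hH : ContMDiff (𝓘(ℝ, ℝ).prod (𝓡 m)) 𝓘(ℝ, ℝ) ∞ (fun p : ℝ × X => Ham p.1 p.2)) :
    Continuous fun p : ℝ × ℝ => energyDensity lam J u p.1 p.2 := by
  simp only [sol.energyDensity_eq hJ hlam hsymp]
  have h1 := (contDiff_pullback sol.smooth hlam).continuous_fderiv (by simp)
  have h2 := sol.continuous_multiplier hJ
  have h3 := continuous_differential_velS sol.smooth hH
  exact ((((h1.clm_apply continuous_const).clm_apply continuous_const).sub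
    ((h1.clm_apply continuous_const).clm_apply continuous_const))).add
    ((h2.comp continuous_fst).mul h3)

theorem continuous_ham
    (hH : ContMDiff (𝓘(ℝ, ℝ).prod (𝓡 m)) 𝓘(ℝ, ℝ) ∞ (fun p : ℝ × X => Ham p.1 p.2)) :
    Continuous fun p : ℝ × ℝ => Ham p.1 (u p.1 p.2) :=
  hH.continuous.comp (continuous_fst.prodMk sol.smooth.continuous)

theorem continuous_gradNormSq (hlam : lam.IsSmooth) (hsymp : lam.IsSymplectic)
    (hH : ContMDiff (𝓘(ℝ, ℝ).prod (𝓡 m)) 𝓘(ℝ, ℝ) ∞ (fun p : ℝ × X => Ham p.1 p.2)) :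
    Continuous fun s => gradNormSq lam J (Ham s) (u s) (η s) := by
  simp only [sol.gradNormSq_eq hJ]
  exact (intervalIntegral.continuous_parametric_intervalIntegral_of_continuous'
    (sol.continuous_energyDensity hJ hlam hsymp hH) 0 1).add
    ((intervalIntegral.continuous_parametric_intervalIntegral_of_continuous'
      (sol.continuous_ham hJ hH) 0 1).pow 2)

end IsSolution

end Solutions

/-! ### The radial coordinate along a solution. -/

section RadialSolutions

variable {n : ℕ} [NeZero (2 * n)]
  {W : Type*} [TopologicalSpace W] [ChartedSpace (EuclideanHalfSpace (2 * n)) W]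
  [IsManifold (𝓡∂ (2 * n)) ∞ W]
  {P : Type*} [TopologicalSpace P] [ChartedSpace (EuclideanSpace ℝ (Fin (2 * n - 1))) P]
  [IsManifold (𝓡 (2 * n - 1)) ∞ P]
  {X : Type*} [TopologicalSpace X] [ChartedSpace (EuclideanSpace ℝ (Fin (2 * n))) X]
  [IsManifold (𝓡 (2 * n)) ∞ X]
  {lamW : OneForm (𝓡∂ (2 * n)) (M := W)} {b : P → W}
  {C : Completion lamW b X} {J : EndLoop (2 * n) X} {ρ₀ κ : ℝ}
  {Ham : ℝ → X → ℝ} {h : ℝ → ℝ → ℝ} {u : ℝ → ℝ → X} {η : ℝ → ℝ}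

namespace IsRadialAtInfinity

variable (D : IsRadialAtInfinity C J ρ₀ κ Ham h) (sol : IsSolution C.lam J Ham u η)
include D sol

/-- Here `∂ₜu = J∂ₛu + ηX_H`, the Hamiltonian field is tangent to the level sets of `ρ`, and `dρ ∘ J
= λ`. -/
theorem differential_radius_velT {s t : ℝ} (hx : u s t ∈ C.openEnd ρ₀) :
    differential C.radius (u s t) (velT (m := 2 * n) u s t) =
      C.lam (u s t) (velS (m := 2 * n) u s t) := by
  rw [sol.velT_eq D.compatible, map_add, map_smul, D.differential_radius_hamiltonianField hx,
    smul_zero, add_zero, D.contact t _ (D.openEnd_subset_cylEnd hx)]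

/-- Contact type and `J² = -1` give `dρ = -λ ∘ J`, which is applied to `∂ₛu`. -/
theorem differential_radius_velS {s t : ℝ} (hx : u s t ∈ C.openEnd ρ₀) :
    differential C.radius (u s t) (velS (m := 2 * n) u s t) =
      -C.lam (u s t) (velT (m := 2 * n) u s t) +
        η s * (C.radius (u s t) * dRho ρ₀ h s (C.radius (u s t))) := by
  have h1 := D.contact t _ (D.openEnd_subset_cylEnd hx) (J t (u s t) (velS (m := 2 * n) u s t))
  rw [D.compatible.sq, map_neg, sol.J_velS D.compatible, map_sub, map_smul,
    D.lam_hamiltonianField hx, smul_eq_mul] at h1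
  linarith

theorem radius_gradient_sq_le {s t : ℝ} (hx : u s t ∈ C.openEnd ρ₀) :
    (differential C.radius (u s t) (velS (m := 2 * n) u s t)) ^ 2 +
      (differential C.radius (u s t) (velT (m := 2 * n) u s t)) ^ 2 ≤
      C.radius (u s t) * energyDensity C.lam J u s t := by
  rw [D.differential_radius_velT sol hx]
  exact D.differential_radius_sq_add_le hx t _

theorem hasDerivAt_radius_fst {s t : ℝ} (hx : u s t ∈ C.openEnd ρ₀) :
    HasDerivAt (fun σ => C.radius (u σ t))
      (differential C.radius (u s t) (velS (m := 2 * n) u s t)) s :=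
  hasDerivAt_comp_velS sol.smooth ((C.contMDiffAt_radius hx.1).mdifferentiableAt (by simp))

theorem hasDerivAt_radius_snd {s t : ℝ} (hx : u s t ∈ C.openEnd ρ₀) :
    HasDerivAt (fun τ => C.radius (u s τ))
      (differential C.radius (u s t) (velT (m := 2 * n) u s t)) t :=
  hasDerivAt_comp_velT sol.smooth ((C.contMDiffAt_radius hx.1).mdifferentiableAt (by simp))

theorem eventually_mem_openEnd {s t : ℝ} (hx : u s t ∈ C.openEnd ρ₀) :
    ∀ᶠ p : ℝ × ℝ in nhds (s, t), u p.1 p.2 ∈ C.openEnd ρ₀ :=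
  sol.smooth.continuous.continuousAt.eventually ((C.isOpen_openEnd ρ₀).mem_nhds hx)

/-- The Laplacian of the radial coordinate along a solution. -/
theorem laplacian_radius {s t : ℝ} (hx : u s t ∈ C.openEnd ρ₀) :
    ∃ fss ftt : ℝ,
      HasDerivAt (fun σ => differential C.radius (u σ t) (velS (m := 2 * n) u σ t)) fss s ∧
      HasDerivAt (fun τ => differential C.radius (u s τ) (velT (m := 2 * n) u s τ)) ftt t ∧
      fss + ftt = energyDensity C.lam J u s t
        + (∫ τ in (0 : ℝ)..1, Ham s (u s τ)) *
          (C.radius (u s t) * dRho ρ₀ h s (C.radius (u s t)))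
        + η s * (C.radius (u s t) * deriv (fun σ => dRho ρ₀ h σ (C.radius (u s t))) s)
        + η s * (C.radius (u s t) * dRho ρ₀ (dRho ρ₀ h) s (C.radius (u s t)) *
          differential C.radius (u s t) (velS (m := 2 * n) u s t)) := by
  have hev := D.eventually_mem_openEnd sol hx
  have hs : ∀ᶠ σ in nhds s, u σ t ∈ C.openEnd ρ₀ :=
    (show ContinuousAt (fun σ : ℝ => (σ, t)) s by fun_prop).eventually hev
  have ht : ∀ᶠ τ in nhds t, u s τ ∈ C.openEnd ρ₀ :=
    (show ContinuousAt (fun τ : ℝ => (s, τ)) t by fun_prop).eventually hev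
  have hf := D.hasDerivAt_radius_fst sol hx
  have h1 := (hasDerivAt_lam_velT sol.smooth C.lam_smooth s t).neg.add
    ((sol.multiplier_eq s).mul (hf.mul (D.profile.hasDerivAt_dRho_comp hf hx.2)))
  have h2 := hasDerivAt_lam_velS sol.smooth C.lam_smooth s t
  refine ⟨_, _, h1.congr_of_eventuallyEq ?_, h2.congr_of_eventuallyEq ?_, ?_⟩
  · filter_upwards [hs] with σ hσ
    exact D.differential_radius_velS sol hσ
  · filter_upwards [ht] with τ hτ
    exact D.differential_radius_velT sol hτ
  -- The difference `∂ₜ(λ(∂ₛu)) - ∂ₛ(λ(∂ₜu))` equals `e - η h' ∂ₛf`, and the last term cancels the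
  -- term `η h' ∂ₛf` in the derivative of `η f h'`.
  · rw [sol.energyDensity_eq D.compatible C.lam_smooth C.lam_symplectic, D.differential_ham hx]
    simp only [Pi.mul_apply]
    ring

end IsRadialAtInfinity

end RadialSolutions

/-! ### One-variable inequalities and the maximum principle. -/

section Analysis

theorem hasDerivAt_max_zero_sq (x : ℝ) :
    HasDerivAt (fun x : ℝ => (max x 0) ^ 2) (2 * max x 0) x := by
  rcases lt_trichotomy x 0 with hx | rfl | hx
  · have h : (fun x : ℝ => (max x 0) ^ 2) =ᶠ[nhds x] fun _ => 0 := by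
      filter_upwards [gt_mem_nhds hx] with y hy
      simp [max_eq_right hy.le]
    rw [max_eq_right hx.le, mul_zero]
    exact (hasDerivAt_const x (0 : ℝ)).congr_of_eventuallyEq h
  · rw [max_self, mul_zero, hasDerivAt_iff_isLittleO_nhds_zero]
    have h1 : (fun h : ℝ => (max (0 + h) 0) ^ 2 - (max 0 0) ^ 2 - h • (0 : ℝ)) =O[nhds 0]
        fun h : ℝ => h ^ 2 := by
      refine Asymptotics.isBigO_of_le _ fun y => ?_
      simp only [zero_add, max_self, smul_zero, sub_zero, Real.norm_eq_abs, abs_pow]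
      rw [zero_pow two_ne_zero, sub_zero, abs_pow]
      refine pow_le_pow_left₀ (abs_nonneg _) ?_ 2
      rcases le_total y 0 with h | h <;> simp [h]
    exact h1.trans_isLittleO (Asymptotics.isLittleO_pow_id one_lt_two)
  · have h : (fun x : ℝ => (max x 0) ^ 2) =ᶠ[nhds x] fun x => x ^ 2 := by
      filter_upwards [lt_mem_nhds hx] with y hy
      simp [max_eq_left hy.le]
    rw [max_eq_left hx.le]
    simpa using (hasDerivAt_pow 2 x).congr_of_eventuallyEq h

theorem contDiff_max_zero_sq : ContDiff ℝ 1 (fun x : ℝ => (max x 0) ^ 2) := by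
  rw [contDiff_one_iff_deriv]
  refine ⟨fun x => (hasDerivAt_max_zero_sq x).differentiableAt, ?_⟩
  have : deriv (fun x : ℝ => (max x 0) ^ 2) = fun x => 2 * max x 0 :=
    funext fun x => (hasDerivAt_max_zero_sq x).deriv
  rw [this]
  fun_prop

theorem abs_sub_le_integral {f f' : ℝ → ℝ} (hf : ∀ x, HasDerivAt f (f' x) x)
    (hf' : Continuous f') {a b x y : ℝ} (hx : x ∈ Icc a b) (hy : y ∈ Icc a b) :
    |f y - f x| ≤ ∫ z in a..b, |f' z| := by
  wlog hxy : x ≤ y generalizing x y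
  · rw [abs_sub_comm]
    exact this hy hx (le_of_not_ge hxy)
  have hi : Continuous fun z => |f' z| := hf'.abs
  rw [← intervalIntegral.integral_eq_sub_of_hasDerivAt (fun z _ => hf z)
    (hf'.intervalIntegrable _ _)]
  refine (intervalIntegral.abs_integral_le_integral_abs hxy).trans ?_
  exact intervalIntegral.integral_mono_interval hx.1 hxy hy.2
    (Filter.Eventually.of_forall fun z => abs_nonneg _) (hi.intervalIntegrable _ _)

theorem exists_le_integral {f : ℝ → ℝ} (hf : Continuous f) :
    ∃ t ∈ Icc (0 : ℝ) 1, f t ≤ ∫ x in (0 : ℝ)..1, f x := by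
  obtain ⟨t, ht, hmin⟩ := isCompact_Icc.exists_isMinOn (nonempty_Icc.2 zero_le_one)
    hf.continuousOn (s := Icc (0 : ℝ) 1)
  refine ⟨t, ht, ?_⟩
  have h1 : ∫ _ in (0 : ℝ)..1, f t ≤ ∫ x in (0 : ℝ)..1, f x :=
    intervalIntegral.integral_mono_on zero_le_one (by simp) (hf.intervalIntegrable _ _)
      fun x hx => hmin hx
  simpa using h1

/-- A linear Gronwall inequality. -/
theorem le_exp_mul_of_deriv_le {y y' e : ℝ → ℝ} (hy : ∀ s, HasDerivAt y (y' s) s)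
    (he : Continuous e) (he0 : ∀ s, 0 ≤ e s) (hle : ∀ s, y' s ≤ (y s + e s) / 2) {a s : ℝ}
    (has : a ≤ s) : y s ≤ Real.exp ((s - a) / 2) * (y a + ∫ x in a..s, e x) := by
  -- The usual integrating factor is applied to `y` only. It is at most `1` for `s ≥ a`, so `F`
  -- still decreases with the unweighted integral of `e`.
  let F : ℝ → ℝ := fun s => Real.exp (-(s - a) / 2) * y s - ∫ x in a..s, e x
  have hF : ∀ s, HasDerivAt F (Real.exp (-(s - a) / 2) * (y' s - y s / 2) - e s) s := by
    intro s
    have h1 : HasDerivAt (fun s => Real.exp (-(s - a) / 2))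
        (Real.exp (-(s - a) / 2) * (-1 / 2)) s :=
      ((((hasDerivAt_id s).sub_const a).neg).div_const 2).exp
    have h2 : HasDerivAt (fun s => ∫ x in a..s, e x) (e s) s :=
      intervalIntegral.integral_hasDerivAt_right (he.intervalIntegrable _ _)
        (he.stronglyMeasurableAtFilter _ _) he.continuousAt
    have h3 : HasDerivAt F _ s := (h1.mul (hy s)).sub h2
    exact h3.congr_deriv (by ring)
  have hanti : AntitoneOn F (Ici a) := by
    refine antitoneOn_of_deriv_nonpos (convex_Ici a)
      (fun x _ => (hF x).continuousAt.continuousWithinAt)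
      (fun x _ => (hF x).differentiableAt.differentiableWithinAt) fun x hx => ?_
    rw [interior_Ici] at hx
    rw [(hF x).deriv]
    have h1 : Real.exp (-(x - a) / 2) ≤ 1 := by
      rw [Real.exp_le_one_iff]
      have : a < x := hx
      linarith
    have h2 : y' x - y x / 2 ≤ e x / 2 := by linarith [hle x]
    have h3 := Real.exp_pos (-(x - a) / 2)
    nlinarith [he0 x]
  have h1 := hanti (mem_Ici.2 le_rfl) (mem_Ici.2 has) has
  simp only [F, sub_self, neg_zero, zero_div, Real.exp_zero, one_mul,
    intervalIntegral.integral_same, sub_zero] at h1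
  have h2 : Real.exp ((s - a) / 2) * Real.exp (-(s - a) / 2) = 1 := by
    rw [← Real.exp_add, ← Real.exp_zero]
    congr 1
    ring
  calc y s = Real.exp ((s - a) / 2) * (Real.exp (-(s - a) / 2) * y s) := by
        rw [← mul_assoc, h2, one_mul]
    _ ≤ _ := by gcongr; linarith

/-- The arithmetic-geometric mean inequality with a free weight. The weight `α` is later `1` in
Gronwall's inequality, `ε` where the energy is at most `ε²`, and `√(1 + G)` in the pointwise bound
for the cutoff. -/
theorem abs_le_of_sq_le_mul {x y e α : ℝ} (hα : 0 < α) (hy : 0 ≤ y) (he : 0 ≤ e)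
    (h : x ^ 2 ≤ y * e) : |x| ≤ (α * y + e / α) / 2 := by
  have h0 : 0 ≤ (α * y + e / α) / 2 := by positivity
  refine abs_le_of_sq_le_sq' ?_ h0 |> abs_le.2
  have h1 : (α * y) * (e / α) = y * e := by field_simp
  nlinarith [sq_nonneg (α * y - e / α)]

/-- The oscillation of a loop is controlled by its mean and its energy. -/
theorem le_integral_of_sq_deriv_le {y y' e : ℝ → ℝ} (hy : ∀ t, HasDerivAt y (y' t) t)
    (hy' : Continuous y') (he : Continuous e) (hy0 : ∀ t, 0 ≤ y t) (he0 : ∀ t, 0 ≤ e t)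
    (h : ∀ t, (y' t) ^ 2 ≤ y t * e t) {α : ℝ} (hα : 0 < α) {t : ℝ} (ht : t ∈ Icc (0 : ℝ) 1) :
    y t ≤ (∫ x in (0 : ℝ)..1, y x) +
      (α * (∫ x in (0 : ℝ)..1, y x) + (∫ x in (0 : ℝ)..1, e x) / α) / 2 := by
  have hyc : Continuous y := continuous_iff_continuousAt.2 fun t => (hy t).continuousAt
  obtain ⟨t₀, ht₀, hle⟩ := exists_le_integral hyc
  have h1 := abs_sub_le_integral hy hy' ht₀ ht
  have h2 : ∫ z in (0 : ℝ)..1, |y' z| ≤ ∫ z in (0 : ℝ)..1, (α * y z + e z / α) / 2 :=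
    intervalIntegral.integral_mono_on zero_le_one (hy'.abs.intervalIntegrable _ _)
      (Continuous.intervalIntegrable (by fun_prop) _ _)
      fun z _ => abs_le_of_sq_le_mul hα (hy0 z) (he0 z) (h z)
  have h3 : ∫ z in (0 : ℝ)..1, (α * y z + e z / α) / 2 =
      (α * (∫ x in (0 : ℝ)..1, y x) + (∫ x in (0 : ℝ)..1, e x) / α) / 2 := by
    rw [intervalIntegral.integral_div, intervalIntegral.integral_add
      (Continuous.intervalIntegrable (by fun_prop) _ _)
      (Continuous.intervalIntegrable (by fun_prop) _ _), intervalIntegral.integral_const_mul,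
      intervalIntegral.integral_div]
  have h4 := le_abs_self (y t - y t₀)
  linarith

/-- The square root of such a `y` has derivative at most `√e / 2`, so small energy keeps a loop with
a zero of `y` close to that zero. -/
theorem sqrt_add_le_of_sq_deriv_le {y y' e : ℝ → ℝ} (hy : ∀ t, HasDerivAt y (y' t) t)
    (hy' : Continuous y') (he : Continuous e) (hy0 : ∀ t, 0 ≤ y t) (he0 : ∀ t, 0 ≤ e t)
    (h : ∀ t, (y' t) ^ 2 ≤ y t * e t) {t₀ t : ℝ} (ht₀ : t₀ ∈ Icc (0 : ℝ) 1) (hz : y t₀ = 0)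
    (ht : t ∈ Icc (0 : ℝ) 1) (hE : ∫ x in (0 : ℝ)..1, e x ≤ 1) : y t ≤ 1 := by
  have hyc : Continuous y := continuous_iff_continuousAt.2 fun t => (hy t).continuousAt
  -- The shift keeps the root differentiable at zeros of `y`. The root equals `1/2` at `t₀` and
  -- varies by at most `(1 + 1)/4`, so it never exceeds `1`.
  have hpos : ∀ t, 0 < y t + 1 / 4 := fun t => by linarith [hy0 t]
  have h1 : ∀ t, HasDerivAt (fun t => Real.sqrt (y t + 1 / 4))
      (y' t / (2 * Real.sqrt (y t + 1 / 4))) t := fun t => ((hy t).add_const _).sqrt (hpos t).ne'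
  have hc : Continuous fun t => y' t / (2 * Real.sqrt (y t + 1 / 4)) :=
    hy'.div (by fun_prop) fun t => by
      have := Real.sqrt_pos.2 (hpos t)
      positivity
  have h2 := abs_sub_le_integral h1 hc ht₀ ht
  have h3 : ∫ z in (0 : ℝ)..1, |y' z / (2 * Real.sqrt (y z + 1 / 4))| ≤
      ∫ z in (0 : ℝ)..1, (1 + e z) / 4 := by
    refine intervalIntegral.integral_mono_on zero_le_one (hc.abs.intervalIntegrable _ _)
      (Continuous.intervalIntegrable (by fun_prop) _ _) fun z _ => ?_
    have hs := Real.sqrt_pos.2 (hpos z)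
    have hss := Real.sq_sqrt (hpos z).le
    rw [abs_div, abs_of_pos (by positivity : 0 < 2 * Real.sqrt (y z + 1 / 4)),
      div_le_iff₀ (by positivity)]
    have h4 : (y' z) ^ 2 ≤ (y z + 1 / 4) * e z := (h z).trans (by nlinarith [he0 z])
    have h5 : 0 ≤ (1 + e z) / 4 * (2 * Real.sqrt (y z + 1 / 4)) := by
      have := he0 z
      positivity
    refine abs_le.2 (abs_le_of_sq_le_sq' ?_ h5)
    have : ((1 + e z) / 4 * (2 * Real.sqrt (y z + 1 / 4))) ^ 2 =
        (1 + e z) ^ 2 / 4 * (y z + 1 / 4) := by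
      rw [mul_pow, mul_pow, hss]; ring
    rw [this]
    nlinarith [sq_nonneg (1 - e z), hpos z]
  have h4 : ∫ z in (0 : ℝ)..1, (1 + e z) / 4 = (1 + ∫ z in (0 : ℝ)..1, e z) / 4 := by
    rw [intervalIntegral.integral_div, intervalIntegral.integral_add (by simp)
      (he.intervalIntegrable _ _)]
    simp
  have h5 : Real.sqrt (y t₀ + 1 / 4) = 1 / 2 := by
    rw [hz, show (0 : ℝ) + 1 / 4 = (1 / 2) ^ 2 by norm_num, Real.sqrt_sq (by norm_num)]
  have h6 := le_abs_self (Real.sqrt (y t + 1 / 4) - Real.sqrt (y t₀ + 1 / 4))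
  have h7 : Real.sqrt (y t + 1 / 4) ≤ 1 := by linarith
  have h8 := (Real.sqrt_le_left zero_le_one).1 h7
  linarith

/-- The second derivative is nonpositive at a local maximum. -/
theorem deriv_of_isLocalMax {f f' : ℝ → ℝ} {f'' x : ℝ}
    (hf : ∀ᶠ y in nhds x, HasDerivAt f (f' y) y) (hf' : HasDerivAt f' f'' x)
    (hmax : IsLocalMax f x) : f' x = 0 ∧ f'' ≤ 0 := by
  have h0 : f' x = 0 := hmax.hasDerivAt_eq_zero hf.self_of_nhds
  refine ⟨h0, not_lt.1 fun hpos => ?_⟩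
  have hd : deriv f =ᶠ[nhds x] f' := hf.mono fun y hy => hy.deriv
  have hdd : deriv (deriv f) x = f'' := hd.deriv_eq.trans hf'.deriv
  -- If `f'' > 0`, the point is also a local minimum. Then `f` is locally constant and `f'' = 0`, a
  -- contradiction.
  have hmin := isLocalMin_of_deriv_deriv_pos (by rwa [hdd])
    (hd.self_of_nhds.trans h0) hf.self_of_nhds.continuousAt
  have hconst : f =ᶠ[nhds x] fun _ => f x := by
    filter_upwards [hmax, hmin] with y h1 h2 using le_antisymm h1 h2
  have h1 : deriv f =ᶠ[nhds x] fun _ => 0 := by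
    have := hconst.deriv
    simpa using this
  have h2 : deriv (deriv f) x = 0 := by
    rw [h1.deriv_eq]; simp
  linarith

/-- Otherwise `G ≥ δ` on a window of length `E/δ + 1`, whose integral would be at least `E + δ`. -/
theorem exists_lt_of_integral_le {G : ℝ → ℝ} (hG : Continuous G) (h0 : ∀ s, 0 ≤ G s)
    (hi : Integrable G) {E δ : ℝ} (hE : ∫ s, G s ≤ E) (hδ : 0 < δ) (s : ℝ) :
    ∃ a ∈ Icc s (s + (E / δ + 1)), G a < δ := by
  by_contra! hcon
  have hE0 : 0 ≤ E := (integral_nonneg h0).trans hE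
  have hL : s ≤ s + (E / δ + 1) := by
    have : 0 ≤ E / δ := by positivity
    linarith
  have h1 : ∫ _ in s..(s + (E / δ + 1)), δ ≤ ∫ x in s..(s + (E / δ + 1)), G x :=
    intervalIntegral.integral_mono_on hL (by simp) (hG.intervalIntegrable _ _) hcon
  have h2 : ∫ x in s..(s + (E / δ + 1)), G x ≤ ∫ x, G x := by
    rw [intervalIntegral.integral_of_le hL]
    exact setIntegral_le_integral hi (Filter.Eventually.of_forall h0)
  rw [intervalIntegral.integral_const, smul_eq_mul] at h1
  have h3 : (s + (E / δ + 1) - s) * δ = E + δ := by field_simp; ring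
  linarith


/-- A maximum principle on the cylinder for the Laplacian with a first order term. -/
theorem le_of_laplacian_ge {Z : ℝ → ℝ → ℝ} (hZ : Continuous fun p : ℝ × ℝ => Z p.1 p.2)
    (hper : ∀ s t, Z s (t + 1) = Z s t) {K : ℝ → ℝ} (hK : Continuous K) (hK1 : ∀ s, 1 ≤ K s)
    {c : ℝ} (hc : 0 ≤ c) {a b m : ℝ} (ha : ∀ t, Z a t ≤ m) (hb : ∀ t, Z b t ≤ m)
    (hlap : ∀ s ∈ Ioo a b, ∀ t, m < Z s t → ∃ zs zt : ℝ → ℝ, ∃ zss ztt : ℝ,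
      (∀ᶠ σ in nhds s, HasDerivAt (fun σ => Z σ t) (zs σ) σ) ∧ HasDerivAt zs zss s ∧
      (∀ᶠ τ in nhds t, HasDerivAt (Z s) (zt τ) τ) ∧ HasDerivAt zt ztt t ∧
      -(c * K s * (1 + |zs s|)) ≤ zss + ztt) {s : ℝ} (hs : s ∈ Icc a b) (t : ℝ) :
    Z s t ≤ m + (b - a) * Real.exp ((c + 1) * ∫ x in a..b, K x) := by
  have hab : a ≤ b := hs.1.trans hs.2
  let Q : ℝ → ℝ := fun σ => ∫ x in a..σ, K x
  have hQ : ∀ σ, HasDerivAt Q (K σ) σ := fun σ =>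
    intervalIntegral.integral_hasDerivAt_right (hK.intervalIntegrable _ _)
      (hK.stronglyMeasurableAtFilter _ _) hK.continuousAt
  have hQm : Monotone Q := by
    refine monotone_of_deriv_nonneg (fun σ => (hQ σ).differentiableAt) fun σ => ?_
    rw [(hQ σ).deriv]
    linarith [hK1 σ]
  have hQa : Q a = 0 := intervalIntegral.integral_same
  set B := Real.exp ((c + 1) * Q b)
  -- This `g` solves `g' = -(c+1) K (g+1)` with `g(b) = 0`, so it is nonnegative on `[a, b]`. Its
  -- primitive `ψ` is the barrier: the factor `c + 1` in place of `c` makes the comparison strict,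
  -- and `g ≤ B` involves only the integral of `K`.
  let g : ℝ → ℝ := fun σ => B * Real.exp (-((c + 1) * Q σ)) - 1
  have hg : ∀ σ, HasDerivAt g (-((c + 1) * K σ) * (g σ + 1)) σ := fun σ => by
    have h1 : HasDerivAt g _ σ :=
      ((((hQ σ).const_mul (c + 1)).neg.exp).const_mul B).sub_const 1
    exact h1.congr_deriv (by simp only [g, Pi.neg_apply]; ring)
  have hgc : Continuous g := continuous_iff_continuousAt.2 fun σ => (hg σ).continuousAt
  let ψ : ℝ → ℝ := fun σ => ∫ x in a..σ, g x
  have hψ : ∀ σ, HasDerivAt ψ (g σ) σ := fun σ =>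
    intervalIntegral.integral_hasDerivAt_right (hgc.intervalIntegrable _ _)
      (hgc.stronglyMeasurableAtFilter _ _) hgc.continuousAt
  have hψc : Continuous ψ := continuous_iff_continuousAt.2 fun σ => (hψ σ).continuousAt
  have hg0 : ∀ σ ≤ b, 0 ≤ g σ := fun σ hσ => by
    have h1 : 1 ≤ B * Real.exp (-((c + 1) * Q σ)) := by
      rw [← Real.exp_add]
      refine Real.one_le_exp ?_
      have := mul_le_mul_of_nonneg_left (hQm hσ) (by linarith : 0 ≤ c + 1)
      linarith
    simp only [g]; linarith
  have hgB : ∀ σ, a ≤ σ → g σ ≤ B := fun σ hσ => by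
    have h1 : Real.exp (-((c + 1) * Q σ)) ≤ 1 := by
      rw [Real.exp_le_one_iff]
      have := mul_nonneg (by linarith : 0 ≤ c + 1) (hQa ▸ hQm hσ : 0 ≤ Q σ)
      linarith
    have h2 : B * Real.exp (-((c + 1) * Q σ)) ≤ B * 1 := by gcongr
    simp only [g]; linarith
  have hψ0 : ∀ σ ∈ Icc a b, 0 ≤ ψ σ := fun σ hσ =>
    intervalIntegral.integral_nonneg hσ.1 fun x hx => hg0 x (hx.2.trans hσ.2)
  have hψB : ∀ σ ∈ Icc a b, ψ σ ≤ (b - a) * B := fun σ hσ => by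
    have h1 : ψ σ ≤ ∫ _ in a..σ, B := intervalIntegral.integral_mono_on hσ.1
      (hgc.intervalIntegrable _ _) (by simp) fun x hx => hgB x hx.1
    rw [intervalIntegral.integral_const, smul_eq_mul] at h1
    have : (σ - a) * B ≤ (b - a) * B := by gcongr; exact hσ.2
    linarith
  obtain ⟨⟨s₁, t₁⟩, ⟨hs₁, -⟩, hmax⟩ := (isCompact_Icc.prod isCompact_Icc).exists_isMaxOn
    (s := Icc a b ×ˢ Icc (0 : ℝ) 1) ⟨(s, 0), hs, by simp⟩
    (f := fun p : ℝ × ℝ => Z p.1 p.2 - ψ p.1) (by fun_prop)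
  -- By periodicity the maximum over one period is a maximum over all `τ`, so `t₁` counts as an
  -- interior point even when it is `0` or `1`.
  have hmax' : ∀ σ ∈ Icc a b, ∀ τ, Z σ τ - ψ σ ≤ Z s₁ t₁ - ψ s₁ := fun σ hσ τ => by
    have hp : Function.Periodic (Z σ) 1 := hper σ
    obtain ⟨τ', hτ', he⟩ := hp.exists_mem_Ico₀ one_pos τ
    rw [he]
    exact hmax (⟨hσ, hτ'.1, hτ'.2.le⟩ : (σ, τ') ∈ Icc a b ×ˢ Icc (0 : ℝ) 1)
  suffices h : Z s₁ t₁ ≤ m + ψ s₁ by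
    have h1 := hmax' s hs t
    have h2 := hψB s hs
    change Z s t ≤ m + (b - a) * B
    linarith
  by_contra! hcon
  have hm : m < Z s₁ t₁ := by linarith [hψ0 s₁ hs₁]
  have hs₁' : s₁ ∈ Ioo a b := by
    refine ⟨hs₁.1.lt_of_ne ?_, hs₁.2.lt_of_ne ?_⟩
    · rintro rfl; linarith [ha t₁]
    · rintro rfl; linarith [hb t₁]
  obtain ⟨zs, zt, zss, ztt, h1, h2, h3, h4, h5⟩ := hlap s₁ hs₁' t₁ hm
  -- At the maximum `∂ₛZ = g ≥ 0`, and the Laplacian of `Z` is at most `g' = -(c+1) K (1+g)`. This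
  -- is strictly below the assumed lower bound `-c K (1+g)`.
  have h6 := deriv_of_isLocalMax (f := fun σ => Z σ t₁ - ψ σ) (f' := fun σ => zs σ - g σ)
    (h1.mono fun σ hσ => hσ.sub (hψ σ)) (h2.sub (hg s₁))
    (Filter.mem_of_superset (Icc_mem_nhds hs₁'.1 hs₁'.2) fun σ hσ => hmax' σ hσ t₁)
  have h7 := deriv_of_isLocalMax h3 h4 (Filter.Eventually.of_forall fun τ => by
    linarith [hmax' s₁ hs₁ τ])
  have h8 : zs s₁ = g s₁ := by linarith [h6.1]
  have h9 := hg0 s₁ hs₁.2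
  rw [h8, abs_of_nonneg h9] at h5
  have h10 := h6.2
  have h11 : 0 < K s₁ * (1 + g s₁) := mul_pos (by linarith [hK1 s₁]) (by linarith)
  nlinarith [h7.2]

end Analysis

/-! ### The cutoff `(√ρ - √r)₊²` and its gradient along solutions. -/

section Cutoff

variable {n : ℕ} [NeZero (2 * n)]
  {W : Type*} [TopologicalSpace W] [ChartedSpace (EuclideanHalfSpace (2 * n)) W]
  [IsManifold (𝓡∂ (2 * n)) ∞ W]
  {P : Type*} [TopologicalSpace P] [ChartedSpace (EuclideanSpace ℝ (Fin (2 * n - 1))) P]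
  [IsManifold (𝓡 (2 * n - 1)) ∞ P]
  {X : Type*} [TopologicalSpace X] [ChartedSpace (EuclideanSpace ℝ (Fin (2 * n))) X]
  [IsManifold (𝓡 (2 * n)) ∞ X]
  {lamW : OneForm (𝓡∂ (2 * n)) (M := W)} {b : P → W}

namespace Completion

variable (C : Completion lamW b X) (r : ℝ)

theorem radius_pos {x : X} (hx : x ∈ C.collar.target) : 0 < C.radius x := by
  have h1 := C.collar.map_target hx
  rw [C.collar_source] at h1
  exact h1.2

/-- The function `(√ρ - √r)²` on the end `∂W × [r, ∞)`, extended by zero. -/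
def cutoff : X → ℝ :=
  (C.cylEnd r).indicator fun x => (max (Real.sqrt (C.radius x) - Real.sqrt r) 0) ^ 2

theorem cutoff_nonneg (x : X) : 0 ≤ C.cutoff r x :=
  indicator_nonneg (fun _ _ => sq_nonneg _) x

variable {r}

theorem cutoff_of_mem_target (hr : 0 < r) {x : X} (hx : x ∈ C.collar.target) :
    C.cutoff r x = (max (Real.sqrt (C.radius x) - Real.sqrt r) 0) ^ 2 := by
  by_cases h : r ≤ C.radius x
  · exact indicator_of_mem ((C.mem_cylEnd_iff hr).2 ⟨hx, h⟩) _
  · rw [cutoff, indicator_of_notMem fun h' => h ((C.mem_cylEnd_iff hr).1 h').2]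
    have := Real.sqrt_le_sqrt (not_le.1 h).le
    rw [max_eq_right (by linarith)]
    norm_num

theorem mem_openEnd_of_cutoff_pos (hr : 0 < r) {x : X} (hx : 0 < C.cutoff r x) :
    x ∈ C.openEnd r := by
  have h1 : x ∈ C.cylEnd r := by
    by_contra h
    exact hx.ne' (indicator_of_notMem h _)
  have h2 := (C.mem_cylEnd_iff hr).1 h1
  refine ⟨h2.1, h2.2.lt_of_ne fun h => ?_⟩
  rw [C.cutoff_of_mem_target hr h2.1, ← h, sub_self, max_self] at hx
  norm_num at hx

theorem radius_le_cutoff (hr : 0 < r) {x : X} (hx : x ∈ C.collar.target) :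
    C.radius x ≤ 2 * C.cutoff r x + 2 * r := by
  have h1 := Real.sq_sqrt (C.radius_pos hx).le
  have h2 := Real.sq_sqrt hr.le
  rw [C.cutoff_of_mem_target hr hx]
  have h3 := le_max_left (Real.sqrt (C.radius x) - Real.sqrt r) 0
  have h4 := le_max_right (Real.sqrt (C.radius x) - Real.sqrt r) 0
  set q := max (Real.sqrt (C.radius x) - Real.sqrt r) 0
  have h5 : Real.sqrt (C.radius x) ≤ q + Real.sqrt r := by linarith
  have h6 : C.radius x ≤ (q + Real.sqrt r) ^ 2 := by
    rw [← h1]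
    exact pow_le_pow_left₀ (Real.sqrt_nonneg _) h5 2
  nlinarith [sq_nonneg (q - Real.sqrt r)]

/-- Inside the collar the positive part is squared, hence `C¹`. At a point outside the collar the
function vanishes nearby because the end is closed. -/
theorem contMDiff_cutoff [T2Space X] (hW : IsLiouvilleDomain lamW) (hb : IsBoundaryInclusion n b)
    (hr : 0 < r) : ContMDiff (𝓡 (2 * n)) 𝓘(ℝ, ℝ) 1 (C.cutoff r) := by
  intro x
  by_cases hx : x ∈ C.collar.target
  · have h1 : C.cutoff r =ᶠ[nhds x]
        (fun y : ℝ => (max (Real.sqrt y - Real.sqrt r) 0) ^ 2) ∘ C.radius := by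
      filter_upwards [C.collar.open_target.mem_nhds hx] with y hy
      exact C.cutoff_of_mem_target hr hy
    refine ContMDiffAt.congr_of_eventuallyEq ?_ h1
    have h2 : ContDiffAt ℝ 1 (fun y : ℝ => (max (Real.sqrt y - Real.sqrt r) 0) ^ 2)
        (C.radius x) :=
      contDiff_max_zero_sq.contDiffAt.comp (C.radius x)
        ((Real.contDiffAt_sqrt (C.radius_pos hx).ne').sub contDiffAt_const)
    exact h2.contMDiffAt.comp x ((C.contMDiffAt_radius hx).of_le (by simp))
  · have h1 : C.cutoff r =ᶠ[nhds x] fun _ => 0 := by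
      filter_upwards [(C.isClosed_cylEnd hW hb hr).isOpen_compl.mem_nhds
        fun h => hx ((C.mem_cylEnd_iff hr).1 h).1] with y hy
      exact indicator_of_notMem hy _
    exact contMDiffAt_const.congr_of_eventuallyEq h1

/-- The sublevel sets of the cutoff are relatively compact. -/
theorem mem_compl_image_collar_of_cutoff_le (hr : 0 < r) {x : X} {c : ℝ}
    (hx : C.cutoff r x ≤ c) : x ∈ (C.collar '' (univ ×ˢ Ioi (2 * c + 2 * r)))ᶜ := by
  have hc : 0 ≤ c := (C.cutoff_nonneg r x).trans hx
  intro h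
  have h0 : Ioi (2 * c + 2 * r) ⊆ Ioi 0 := Ioi_subset_Ioi (by positivity)
  rw [C.mem_image_collar_iff h0] at h
  have := C.radius_le_cutoff hr h.1
  have h2 : 2 * c + 2 * r < C.radius x := h.2
  linarith

end Completion

namespace IsRadialAtInfinity

variable {C : Completion lamW b X} {J : EndLoop (2 * n) X} {ρ₀ κ : ℝ}
  {Ham : ℝ → X → ℝ} {h : ℝ → ℝ → ℝ} {u : ℝ → ℝ → X} {η : ℝ → ℝ} {r : ℝ}

section Gradient

variable (D : IsRadialAtInfinity C J ρ₀ κ Ham h) (sol : IsSolution C.lam J Ham u η)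
include D sol

theorem contDiff_cutoff_comp [T2Space X] (hr : 0 < r) :
    ContDiff ℝ 1 (fun p : ℝ × ℝ => C.cutoff r (u p.1 p.2)) := by
  rw [← contMDiff_iff_contDiff]
  exact (C.contMDiff_cutoff D.domain D.boundary hr).comp (sol.smooth.of_le (by simp))

theorem hasDerivAt_cutoff_fst [T2Space X] (hr : 0 < r) (s t : ℝ) :
    HasDerivAt (fun σ => C.cutoff r (u σ t))
      (fderiv ℝ (fun p : ℝ × ℝ => C.cutoff r (u p.1 p.2)) (s, t) (1, 0)) s :=
  HasFDerivAt.comp_hasDerivAt (f := fun σ : ℝ => (σ, t)) s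
    ((D.contDiff_cutoff_comp sol hr).differentiable (by simp) (s, t)).hasFDerivAt
    ((hasDerivAt_id s).prodMk (hasDerivAt_const s t))

theorem hasDerivAt_cutoff_snd [T2Space X] (hr : 0 < r) (s t : ℝ) :
    HasDerivAt (fun τ => C.cutoff r (u s τ))
      (fderiv ℝ (fun p : ℝ × ℝ => C.cutoff r (u p.1 p.2)) (s, t) (0, 1)) t :=
  HasFDerivAt.comp_hasDerivAt (f := fun τ : ℝ => (s, τ)) t
    ((D.contDiff_cutoff_comp sol hr).differentiable (by simp) (s, t)).hasFDerivAt
    ((hasDerivAt_const t s).prodMk (hasDerivAt_id t))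

/-- Where `q > 0`, `dq = √(q/ρ) dρ`, and `|∇f|² ≤ f e` gives the claim; the square roots in the
definition of `q` absorb the factor `f`. At a zero of `q` the gradient vanishes, since `q ≥ 0` has a
minimum there. -/
theorem cutoff_gradient_sq_le [T2Space X] (hr : ρ₀ < r) (s t : ℝ) :
    (fderiv ℝ (fun p : ℝ × ℝ => C.cutoff r (u p.1 p.2)) (s, t) (1, 0)) ^ 2 ≤
        C.cutoff r (u s t) * energyDensity C.lam J u s t ∧
      (fderiv ℝ (fun p : ℝ × ℝ => C.cutoff r (u p.1 p.2)) (s, t) (0, 1)) ^ 2 ≤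
        C.cutoff r (u s t) * energyDensity C.lam J u s t := by
  have hr0 : 0 < r := D.pos.trans hr
  rcases (C.cutoff_nonneg r (u s t)).eq_or_lt with h0 | h0
  · have hmin : IsLocalMin (fun p : ℝ × ℝ => C.cutoff r (u p.1 p.2)) (s, t) :=
      Filter.Eventually.of_forall fun p => by
        change C.cutoff r (u s t) ≤ _
        rw [← h0]
        exact C.cutoff_nonneg r _
    rw [hmin.fderiv_eq_zero, ← h0]
    simp
  · have hx := C.mem_openEnd_of_cutoff_pos hr0 h0
    have hx0 : u s t ∈ C.openEnd ρ₀ := ⟨hx.1, hr.trans hx.2⟩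
    have hf := C.radius_pos hx.1
    have hgrad := D.radius_gradient_sq_le sol hx0
    have hq := C.cutoff_of_mem_target hr0 hx.1
    have hev : ∀ᶠ p : ℝ × ℝ in nhds (s, t), C.cutoff r (u p.1 p.2) =
        (max (Real.sqrt (C.radius (u p.1 p.2)) - Real.sqrt r) 0) ^ 2 := by
      filter_upwards [D.eventually_mem_openEnd sol hx0] with p hp
      exact C.cutoff_of_mem_target hr0 hp.1
    have hsq : ∀ {c d : ℝ}, c = 2 * max (Real.sqrt (C.radius (u s t)) - Real.sqrt r) 0 *
        (d / (2 * Real.sqrt (C.radius (u s t)))) →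
        d ^ 2 ≤ C.radius (u s t) * energyDensity C.lam J u s t →
        c ^ 2 ≤ C.cutoff r (u s t) * energyDensity C.lam J u s t := by
      intro c d hc hd
      have h1 : c ^ 2 = C.cutoff r (u s t) * (d ^ 2 / C.radius (u s t)) := by
        rw [hc, hq]
        have := Real.sq_sqrt hf.le
        have h2 : Real.sqrt (C.radius (u s t)) ≠ 0 := (Real.sqrt_pos.2 hf).ne'
        field_simp
        rw [this]
        ring
      rw [h1]
      refine mul_le_mul_of_nonneg_left ?_ h0.le
      rw [div_le_iff₀ hf]
      linarith
    constructor
    · refine hsq (d := differential C.radius (u s t) (velS (m := 2 * n) u s t)) ?_ (by nlinarith)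
      have h1 := ((hasDerivAt_max_zero_sq (Real.sqrt (C.radius (u s t)) - Real.sqrt r)).comp s
        (((D.hasDerivAt_radius_fst sol hx0).sqrt hf.ne').sub_const (Real.sqrt r)))
      refine (D.hasDerivAt_cutoff_fst sol hr0 s t).unique (h1.congr_of_eventuallyEq ?_)
      exact (show ContinuousAt (fun σ : ℝ => (σ, t)) s by fun_prop).eventually hev
    · refine hsq (d := differential C.radius (u s t) (velT (m := 2 * n) u s t)) ?_ (by nlinarith)
      have h1 := ((hasDerivAt_max_zero_sq (Real.sqrt (C.radius (u s t)) - Real.sqrt r)).comp t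
        (((D.hasDerivAt_radius_snd sol hx0).sqrt hf.ne').sub_const (Real.sqrt r)))
      refine (D.hasDerivAt_cutoff_snd sol hr0 s t).unique (h1.congr_of_eventuallyEq ?_)
      exact (show ContinuousAt (fun τ : ℝ => (s, τ)) t by fun_prop).eventually hev

end Gradient

end IsRadialAtInfinity

end Cutoff

/-! ### Times of small gradient: confinement of the loop and bound on the multiplier. -/

section Multiplier

variable {n : ℕ} [NeZero (2 * n)]
  {W : Type*} [TopologicalSpace W] [ChartedSpace (EuclideanHalfSpace (2 * n)) W]
  [IsManifold (𝓡∂ (2 * n)) ∞ W]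
  {P : Type*} [TopologicalSpace P] [ChartedSpace (EuclideanSpace ℝ (Fin (2 * n - 1))) P]
  [IsManifold (𝓡 (2 * n - 1)) ∞ P]
  {X : Type*} [TopologicalSpace X] [ChartedSpace (EuclideanSpace ℝ (Fin (2 * n))) X]
  [IsManifold (𝓡 (2 * n)) ∞ X]
  {lamW : OneForm (𝓡∂ (2 * n)) (M := W)} {b : P → W}
  {C : Completion lamW b X} {J : EndLoop (2 * n) X} {ρ₀ κ : ℝ}
  {Ham : ℝ → X → ℝ} {h : ℝ → ℝ → ℝ} {u : ℝ → ℝ → X} {η : ℝ → ℝ}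

namespace IsRadialAtInfinity

section Uniform

variable (D : IsRadialAtInfinity C J ρ₀ κ Ham h)
include D

/-- Reduces uniformity in `s` to the compact parameter interval `[0, 1]`. -/
theorem exists_ham_eq (s : ℝ) : ∃ σ ∈ Icc (0 : ℝ) 1, Ham s = Ham σ := by
  rcases le_total s 0 with h0 | h0
  · exact ⟨0, by simp, D.past s h0⟩
  rcases le_total 1 s with h1 | h1
  · exact ⟨1, by simp, D.future s h1⟩
  · exact ⟨s, ⟨h0, h1⟩, rfl⟩

theorem exists_abs_ham_le {K : Set X} (hK : IsCompact K) :
    ∃ c > 0, ∀ s, ∀ x ∈ K, |Ham s x| ≤ c := by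
  obtain ⟨c, hc⟩ := ((isCompact_Icc (a := (0 : ℝ)) (b := 1)).prod hK).exists_bound_of_continuousOn
    D.smooth.continuous.continuousOn
  refine ⟨max c 1, by positivity, fun s x hx => ?_⟩
  obtain ⟨σ, hσ, he⟩ := D.exists_ham_eq s
  rw [he]
  exact (hc (σ, x) ⟨hσ, hx⟩).trans (le_max_left _ _)

theorem exists_le_ham [T2Space X] : ∃ c > 0, ∀ s x, -c ≤ Ham s x := by
  obtain ⟨c, hc, hle⟩ := D.exists_abs_ham_le
    (C.isCompact_compl_image_collar D.domain D.boundary D.pos)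
  refine ⟨c, hc, fun s x => ?_⟩
  by_cases hx : x ∈ C.collar '' (univ ×ˢ Ioi ρ₀)
  · rw [C.mem_image_collar_iff (Ioi_subset_Ioi D.pos.le)] at hx
    obtain ⟨c₀, hc₀, hinf⟩ := D.profile.inf_pos
    have h1 : ρ₀ ≤ C.radius x := (show ρ₀ < C.radius x from hx.2).le
    rw [D.ham_eq hx.1 h1]
    linarith [hinf s _ h1]
  · exact (abs_le.1 (hle s x hx)).1

/-- Where `λ(X_H) - H ≤ θ/2`, `H` does not vanish. On the compact set of such points over `K`, `|H|`
has a positive minimum, and `δ` is half of it. -/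
theorem exists_le_of_abs_ham_le {K : Set X} (hK : IsCompact K) :
    ∃ θ > 0, ∃ δ > 0, ∀ s, ∀ x ∈ K, |Ham s x| ≤ δ →
      θ ≤ C.lam x (C.lam.hamiltonianField (Ham s) x) - Ham s x := by
  obtain ⟨θ, hθ, hstar⟩ := D.starshaped
  let g : ℝ × X → ℝ := fun p => C.lam p.2 (C.lam.hamiltonianField (Ham p.1) p.2) - Ham p.1 p.2
  have hg : Continuous g :=
    (continuous_apply_hamiltonianField C.lam_smooth C.lam_symplectic D.smooth).sub
      D.smooth.continuous
  let S : Set (ℝ × X) := (Icc (0 : ℝ) 1 ×ˢ K) ∩ {p | g p ≤ θ / 2}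
  have hS : IsCompact S := ((isCompact_Icc).prod hK).inter_right
    (isClosed_le hg continuous_const)
  have key : ∃ δ > 0, ∀ p ∈ S, δ < |Ham p.1 p.2| := by
    rcases S.eq_empty_or_nonempty with he | hne
    · exact ⟨1, one_pos, fun p hp => by simp [he] at hp⟩
    · obtain ⟨p, hp, hmin⟩ := hS.exists_isMinOn hne D.smooth.continuous.abs.continuousOn
      have hpos : 0 < |Ham p.1 p.2| := abs_pos.2 fun h0 => by
        have h1 := hstar p.1 p.2 h0
        have h2 : g p ≤ θ / 2 := hp.2
        have h3 : θ ≤ g p := h1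
        linarith
      exact ⟨|Ham p.1 p.2| / 2, by positivity, fun p' hp' => by
        have h1 : |Ham p.1 p.2| ≤ |Ham p'.1 p'.2| := hmin hp'
        linarith⟩
  obtain ⟨δ, hδ, hlt⟩ := key
  refine ⟨θ / 2, by positivity, δ, hδ, fun s x hx hle => ?_⟩
  obtain ⟨σ, hσ, he⟩ := D.exists_ham_eq s
  rw [he] at hle ⊢
  by_contra hcon
  exact absurd (hlt (σ, x) ⟨⟨hσ, hx⟩, (not_le.1 hcon).le⟩) (not_lt.2 hle)

end Uniform

section Energy

variable (D : IsRadialAtInfinity C J ρ₀ κ Ham h) (sol : IsSolution C.lam J Ham u η)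
include D sol

theorem continuous_energyDensity : Continuous fun p : ℝ × ℝ => energyDensity C.lam J u p.1 p.2 :=
  sol.continuous_energyDensity D.compatible C.lam_smooth C.lam_symplectic D.smooth

theorem continuous_gradNormSq : Continuous fun s => gradNormSq C.lam J (Ham s) (u s) (η s) :=
  sol.continuous_gradNormSq D.compatible C.lam_smooth C.lam_symplectic D.smooth

theorem integral_energyDensity_nonneg (s : ℝ) :
    0 ≤ ∫ t in (0 : ℝ)..1, energyDensity C.lam J u s t :=
  intervalIntegral.integral_nonneg zero_le_one fun t _ => sol.energyDensity_nonneg D.compatible s t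

theorem integral_energyDensity_le (s : ℝ) :
    ∫ t in (0 : ℝ)..1, energyDensity C.lam J u s t ≤ gradNormSq C.lam J (Ham s) (u s) (η s) := by
  rw [sol.gradNormSq_eq D.compatible]
  nlinarith [sq_nonneg (∫ t in (0 : ℝ)..1, Ham s (u s t))]

theorem sq_integral_ham_le (s : ℝ) :
    (∫ t in (0 : ℝ)..1, Ham s (u s t)) ^ 2 ≤ gradNormSq C.lam J (Ham s) (u s) (η s) := by
  rw [sol.gradNormSq_eq D.compatible]
  linarith [D.integral_energyDensity_nonneg sol s]

theorem gradNormSq_nonneg (s : ℝ) : 0 ≤ gradNormSq C.lam J (Ham s) (u s) (η s) :=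
  (sq_nonneg _).trans (D.sq_integral_ham_le sol s)

/-- The term `η dH(X_H)` vanishes, so the derivative is independent of `η`. This matters because `η`
is not yet bounded when the oscillation of `H` is estimated. -/
theorem hasDerivAt_ham_snd (s t : ℝ) : HasDerivAt (fun τ => Ham s (u s τ))
    (differential (Ham s) (u s t) (J t (u s t) (velS (m := 2 * n) u s t))) t := by
  have h1 := hasDerivAt_comp_velT sol.smooth (mdifferentiableAt_family D.smooth s (u s t))
  refine h1.congr_deriv ?_
  have h2 : C.lam.d (u s t) (C.lam.hamiltonianField (Ham s) (u s t))
      (C.lam.hamiltonianField (Ham s) (u s t)) =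
      -differential (Ham s) (u s t) (C.lam.hamiltonianField (Ham s) (u s t)) :=
    OneForm.d_hamiltonianField C.lam_symplectic (Ham s) (u s t) _
  rw [OneForm.d_self] at h2
  rw [sol.velT_eq D.compatible, map_add, map_smul, neg_eq_zero.1 h2.symm, smul_zero, add_zero]

theorem continuous_differential_J_velS (s : ℝ) : Continuous fun t =>
    differential (Ham s) (u s t) (J t (u s t) (velS (m := 2 * n) u s t)) := by
  have h1 : ContDiff ℝ ∞ fun t => Ham s (u s t) := by
    rw [← contMDiff_iff_contDiff]
    exact D.smooth.comp (ContMDiff.prodMk contMDiff_const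
      (sol.smooth.comp (contDiff_const.prodMk contDiff_id).contMDiff))
  have h2 : deriv (fun t => Ham s (u s t)) = fun t =>
      differential (Ham s) (u s t) (J t (u s t) (velS (m := 2 * n) u s t)) :=
    funext fun t => (D.hasDerivAt_ham_snd sol s t).deriv
  rw [← h2]
  exact h1.continuous_deriv (by simp)

theorem lam_J_velS (s t : ℝ) : C.lam (u s t) (J t (u s t) (velS (m := 2 * n) u s t)) =
    C.lam (u s t) (velT (m := 2 * n) u s t) -
      η s * C.lam (u s t) (C.lam.hamiltonianField (Ham s) (u s t)) := by
  rw [sol.J_velS D.compatible, map_sub, map_smul, smul_eq_mul]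

theorem continuous_lam_hamiltonianField (s : ℝ) :
    Continuous fun t => C.lam (u s t) (C.lam.hamiltonianField (Ham s) (u s t)) :=
  (continuous_apply_hamiltonianField C.lam_smooth C.lam_symplectic D.smooth).comp
    (continuous_const.prodMk (sol.smooth.continuous.comp (continuous_const.prodMk continuous_id)))

theorem continuous_ham_snd (s : ℝ) : Continuous fun t => Ham s (u s t) :=
  (sol.continuous_ham D.compatible D.smooth).comp (continuous_const.prodMk continuous_id)

theorem continuous_energyDensity_snd (s : ℝ) : Continuous fun t => energyDensity C.lam J u s t :=
  Continuous.comp (g := fun p : ℝ × ℝ => energyDensity C.lam J u p.1 p.2)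
    (f := fun t : ℝ => (s, t)) (D.continuous_energyDensity sol)
    (continuous_const.prodMk continuous_id)

variable [T2Space X]

theorem continuous_fderiv_cutoff {r : ℝ} (hr : 0 < r) :
    Continuous (fderiv ℝ (fun p : ℝ × ℝ => C.cutoff r (u p.1 p.2))) :=
  (D.contDiff_cutoff_comp sol hr).continuous_fderiv (by simp)

/-- A loop of small energy on which the mean of the Hamiltonian is small stays near the compact
part. -/
theorem cutoff_le_one {r c s : ℝ} (hr : ρ₀ < r) (hc : 0 < c)
    (hinf : ∀ s, ∀ ρ ≥ ρ₀, c ≤ h s ρ) (h1 : gradNormSq C.lam J (Ham s) (u s) (η s) ≤ 1)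
    (h2 : gradNormSq C.lam J (Ham s) (u s) (η s) < c ^ 2) {t : ℝ} (ht : t ∈ Icc (0 : ℝ) 1) :
    C.cutoff r (u s t) ≤ 1 := by
  have hr0 : 0 < r := D.pos.trans hr
  -- Either the cutoff vanishes somewhere and the small energy limits its growth, or the whole loop
  -- lies in the end. In the second case the mean of `H` is at least `c`, contradicting the bound
  -- `c²` on the gradient.
  by_cases hz : ∃ t₀ ∈ Icc (0 : ℝ) 1, C.cutoff r (u s t₀) = 0
  · obtain ⟨t₀, ht₀, hz⟩ := hz
    refine sqrt_add_le_of_sq_deriv_le (D.hasDerivAt_cutoff_snd sol hr0 s) ?_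
      (D.continuous_energyDensity_snd sol s) (fun t => C.cutoff_nonneg r _)
      (fun t => sol.energyDensity_nonneg D.compatible s t)
      (fun t => (D.cutoff_gradient_sq_le sol hr s t).2) ht₀ hz ht
      ((D.integral_energyDensity_le sol s).trans h1)
    have := D.continuous_fderiv_cutoff sol hr0
    fun_prop
  · push Not at hz
    exfalso
    have h3 : ∫ _ in (0 : ℝ)..1, c ≤ ∫ t in (0 : ℝ)..1, Ham s (u s t) := by
      refine intervalIntegral.integral_mono_on zero_le_one (by simp)
        ((D.continuous_ham_snd sol s).intervalIntegrable _ _) fun t ht => ?_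
      have hx := C.mem_openEnd_of_cutoff_pos hr0 ((C.cutoff_nonneg r _).lt_of_ne' (hz t ht))
      have hρ : ρ₀ ≤ C.radius (u s t) := (hr.trans hx.2).le
      rw [D.ham_eq hx.1 hρ]
      exact hinf s _ hρ
    rw [intervalIntegral.integral_const, sub_zero, one_smul] at h3
    have h4 := D.sq_integral_ham_le sol s
    nlinarith

/-- The mean of `H` over the loop is at most `ε` in absolute value, and its oscillation is at most
the integral of `|dH(J∂ₛu)|`, which is of order `ε`. -/
theorem abs_ham_le {K : Set X} {c ε s : ℝ} (hε : 0 < ε)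
    (hK : ∀ t ∈ Icc (0 : ℝ) 1, u s t ∈ K) (hc : 0 < c)
    (hle : ∀ s, ∀ t ∈ Icc (0 : ℝ) 1, ∀ x ∈ K, ∀ v : TangentSpace (𝓡 (2 * n)) x,
      (differential (Ham s) x v) ^ 2 ≤ c * metricSq C.lam J t x v)
    (hG : gradNormSq C.lam J (Ham s) (u s) (η s) ≤ ε ^ 2) {t : ℝ} (ht : t ∈ Icc (0 : ℝ) 1) :
    |Ham s (u s t)| ≤ ε * (1 + (c + 1) / 2) := by
  have hg := D.hasDerivAt_ham_snd sol s
  have hgc := D.continuous_ham_snd sol s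
  have hg' := D.continuous_differential_J_velS sol s
  have he := D.continuous_energyDensity_snd sol s
  set g : ℝ → ℝ := fun t => Ham s (u s t)
  set g' : ℝ → ℝ := fun t =>
    differential (Ham s) (u s t) (J t (u s t) (velS (m := 2 * n) u s t))
  have hosc : ∫ z in (0 : ℝ)..1, |g' z| ≤ ε * ((c + 1) / 2) := by
    have h1 : ∫ z in (0 : ℝ)..1, |g' z| ≤
        ∫ z in (0 : ℝ)..1, (ε * c + energyDensity C.lam J u s z / ε) / 2 := by
      refine intervalIntegral.integral_mono_on zero_le_one (hg'.abs.intervalIntegrable _ _)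
        (Continuous.intervalIntegrable (by fun_prop) _ _) fun z hz => ?_
      refine abs_le_of_sq_le_mul hε hc.le (sol.energyDensity_nonneg D.compatible s z) ?_
      have h2 := hle s z hz _ (hK z hz) (J z (u s z) (velS (m := 2 * n) u s z))
      rwa [metricSq_J D.compatible] at h2
    rw [intervalIntegral.integral_div, intervalIntegral.integral_add (by simp)
      (Continuous.intervalIntegrable (by fun_prop) _ _), intervalIntegral.integral_div,
      intervalIntegral.integral_const, sub_zero, one_smul] at h1
    have h2 : (∫ z in (0 : ℝ)..1, energyDensity C.lam J u s z) / ε ≤ ε := by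
      rw [div_le_iff₀ hε]
      nlinarith [D.integral_energyDensity_le sol s]
    linarith
  have hmean : |∫ z in (0 : ℝ)..1, g z| ≤ ε :=
    abs_le.2 (abs_le_of_sq_le_sq' ((D.sq_integral_ham_le sol s).trans hG) hε.le)
  rw [abs_le] at hmean ⊢
  obtain ⟨t₁, ht₁, h1⟩ := exists_le_integral hgc
  obtain ⟨t₂, ht₂, h2⟩ := exists_le_integral hgc.neg
  have h2' : -g t₂ ≤ -∫ z in (0 : ℝ)..1, g z := by
    rw [← intervalIntegral.integral_neg]; exact h2
  have h3 := abs_le.1 (abs_sub_le_integral hg hg' ht₁ ht)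
  have h4 := abs_le.1 (abs_sub_le_integral hg hg' ht₂ ht)
  change -_ ≤ g t ∧ g t ≤ _
  constructor <;> linarith

/-- Since `∂ₜu = J∂ₛu + ηX_H`, the action is `∫ λ(J∂ₛu) + η ∫ (λ(X_H) - H)`. The first integral is
bounded by the energy, and the factor of `η` is at least `θ`. -/
theorem abs_multiplier_le_of_starshaped {K : Set X} {c θ A s : ℝ} (hθ : 0 < θ)
    (hK : ∀ t ∈ Icc (0 : ℝ) 1, u s t ∈ K) (hc : 0 < c)
    (hle : ∀ t ∈ Icc (0 : ℝ) 1, ∀ x ∈ K, ∀ v : TangentSpace (𝓡 (2 * n)) x,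
      (C.lam x v) ^ 2 ≤ c * metricSq C.lam J t x v)
    (hG : gradNormSq C.lam J (Ham s) (u s) (η s) ≤ 1)
    (hstar : ∀ t ∈ Icc (0 : ℝ) 1,
      θ ≤ C.lam (u s t) (C.lam.hamiltonianField (Ham s) (u s t)) - Ham s (u s t))
    (hA : |action C.lam (Ham s) (u s) (η s)| ≤ A) : |η s| ≤ (A + (c + 1) / 2) / θ := by
  have c1 := D.continuous_lam_hamiltonianField sol s
  have c2 := D.continuous_ham_snd sol s
  have c3 := continuous_lam_velT sol.smooth C.lam_smooth s
  have c4 := D.continuous_energyDensity_snd sol s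
  have c5 : Continuous fun t => C.lam (u s t) (J t (u s t) (velS (m := 2 * n) u s t)) := by
    simp only [D.lam_J_velS sol]
    fun_prop
  have hact : action C.lam (Ham s) (u s) (η s) =
      (∫ t in (0 : ℝ)..1, C.lam (u s t) (J t (u s t) (velS (m := 2 * n) u s t))) +
      η s * ∫ t in (0 : ℝ)..1,
        (C.lam (u s t) (C.lam.hamiltonianField (Ham s) (u s t)) - Ham s (u s t)) := by
    simp only [D.lam_J_velS sol]
    rw [intervalIntegral.integral_sub (c3.intervalIntegrable _ _)
      (Continuous.intervalIntegrable (by fun_prop) _ _),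
      intervalIntegral.integral_sub (c1.intervalIntegrable _ _) (c2.intervalIntegrable _ _),
      intervalIntegral.integral_const_mul, action]
    change (∫ t in (0 : ℝ)..1, C.lam (u s t) (velT (m := 2 * n) u s t)) - _ = _
    ring
  have h1 : |∫ t in (0 : ℝ)..1, C.lam (u s t) (J t (u s t) (velS (m := 2 * n) u s t))| ≤
      (c + 1) / 2 := by
    refine (intervalIntegral.abs_integral_le_integral_abs zero_le_one).trans ?_
    have h2 : ∫ t in (0 : ℝ)..1, |C.lam (u s t) (J t (u s t) (velS (m := 2 * n) u s t))| ≤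
        ∫ t in (0 : ℝ)..1, (c + energyDensity C.lam J u s t) / 2 := by
      refine intervalIntegral.integral_mono_on zero_le_one (c5.abs.intervalIntegrable _ _)
        (Continuous.intervalIntegrable (by fun_prop) _ _) fun z hz => ?_
      have h3 := hle z hz _ (hK z hz) (J z (u s z) (velS (m := 2 * n) u s z))
      rw [metricSq_J D.compatible] at h3
      simpa using abs_le_of_sq_le_mul one_pos hc.le (sol.energyDensity_nonneg D.compatible s z) h3
    rw [intervalIntegral.integral_div, intervalIntegral.integral_add (by simp)
      (c4.intervalIntegrable _ _), intervalIntegral.integral_const, sub_zero, one_smul] at h2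
    linarith [D.integral_energyDensity_le sol s]
  have h2 : θ ≤ ∫ t in (0 : ℝ)..1,
      (C.lam (u s t) (C.lam.hamiltonianField (Ham s) (u s t)) - Ham s (u s t)) := by
    have h3 : ∫ _ in (0 : ℝ)..1, θ ≤ _ := intervalIntegral.integral_mono_on zero_le_one (by simp)
      ((c1.sub c2).intervalIntegrable 0 1) hstar
    rwa [intervalIntegral.integral_const, sub_zero, one_smul] at h3
  rw [le_div_iff₀ hθ]
  set I := ∫ t in (0 : ℝ)..1,
    (C.lam (u s t) (C.lam.hamiltonianField (Ham s) (u s t)) - Ham s (u s t))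
  have h3 : |η s| * I = |η s * I| := by rw [abs_mul, abs_of_pos (hθ.trans_le h2)]
  have h4 : |η s| * θ ≤ |η s| * I := by gcongr
  rw [h3, eq_sub_of_add_eq' hact.symm] at h4
  exact h4.trans ((abs_sub _ _).trans (add_le_add hA h1))

end Energy

end IsRadialAtInfinity

end Multiplier

/-! ### Gronwall's inequality for loop averages. -/

section Gronwall

/-- Gronwall is applied for each fixed `t`, and the result is averaged over `t` with the integrals
exchanged: only the double integral of `e` will be under control, not its integral in `s` at a given
`t`. -/
theorem integral_le_exp_mul_of_sq_deriv_le {y y' e : ℝ → ℝ → ℝ}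
    (hy : ∀ s t, HasDerivAt (fun σ => y σ t) (y' s t) s) (hyc : ∀ s, Continuous (y s))
    (he : Continuous fun p : ℝ × ℝ => e p.1 p.2) (hy0 : ∀ s t, 0 ≤ y s t)
    (he0 : ∀ s t, 0 ≤ e s t) (hle : ∀ s t, (y' s t) ^ 2 ≤ y s t * e s t) {a s : ℝ} (has : a ≤ s)
    (ha : ∀ t, y a t ≤ 1) :
    ∫ t in (0 : ℝ)..1, y s t ≤
      Real.exp ((s - a) / 2) * (1 + ∫ x in a..s, ∫ t in (0 : ℝ)..1, e x t) := by
  have hswap : Continuous fun p : ℝ × ℝ => e p.2 p.1 :=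
    he.comp (continuous_snd.prodMk continuous_fst)
  have hinner : Continuous fun t => ∫ x in a..s, e x t :=
    intervalIntegral.continuous_parametric_intervalIntegral_of_continuous' (μ := volume)
      (f := fun t x => e x t) hswap a s
  have hpt : ∀ t, y s t ≤ Real.exp ((s - a) / 2) * (1 + ∫ x in a..s, e x t) := fun t => by
    have h1 := le_exp_mul_of_deriv_le (fun σ => hy σ t) (e := fun σ => e σ t)
      (he.comp (f := fun σ : ℝ => (σ, t)) (by fun_prop)) (fun σ => he0 σ t) (fun σ => by
        have h2 := abs_le_of_sq_le_mul one_pos (hy0 σ t) (he0 σ t) (hle σ t)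
        rw [one_mul, div_one] at h2
        exact (le_abs_self _).trans h2) has
    exact h1.trans (mul_le_mul_of_nonneg_left (by linarith [ha t]) (Real.exp_pos _).le)
  have h1 := intervalIntegral.integral_mono_on (μ := volume) zero_le_one
    ((hyc s).intervalIntegrable 0 1)
    (Continuous.intervalIntegrable (by fun_prop) _ _) fun t _ => hpt t
  rw [intervalIntegral.integral_const_mul, intervalIntegral.integral_add (by simp)
    (hinner.intervalIntegrable _ _), intervalIntegral.integral_const, sub_zero, one_smul,
    intervalIntegral_intervalIntegral_swap (F := fun t x => e x t)] at h1
  · exact h1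
  · have h2 : IntegrableOn (fun p : ℝ × ℝ => e p.2 p.1) (uIcc 0 1 ×ˢ uIcc a s) volume :=
      hswap.continuousOn.integrableOn_compact (isCompact_uIcc.prod isCompact_uIcc)
    exact h2.mono_set (prod_mono uIoc_subset_uIcc uIoc_subset_uIcc)

end Gronwall

/-! ### Growth of the profile; bounds on the multiplier and on the cutoff at all times. -/

section Bounds

variable {n : ℕ} [NeZero (2 * n)]
  {W : Type*} [TopologicalSpace W] [ChartedSpace (EuclideanHalfSpace (2 * n)) W]
  [IsManifold (𝓡∂ (2 * n)) ∞ W]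
  {P : Type*} [TopologicalSpace P] [ChartedSpace (EuclideanSpace ℝ (Fin (2 * n - 1))) P]
  [IsManifold (𝓡 (2 * n - 1)) ∞ P]
  {X : Type*} [TopologicalSpace X] [T2Space X] [ChartedSpace (EuclideanSpace ℝ (Fin (2 * n))) X]
  [IsManifold (𝓡 (2 * n)) ∞ X]
  {lamW : OneForm (𝓡∂ (2 * n)) (M := W)} {b : P → W}
  {C : Completion lamW b X} {J : EndLoop (2 * n) X} {ρ₀ κ : ℝ}
  {Ham : ℝ → X → ℝ} {h : ℝ → ℝ → ℝ}

namespace IsAdmissibleProfile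

/-- The condition on `∂h/∂ρ` says that `√(h+1)` has derivative at most `√κ / 2`, so `h` grows at
most quadratically. -/
theorem add_one_le (hh : IsAdmissibleProfile ρ₀ κ h) (hκ : 0 < κ) (h0 : 0 < ρ₀) (s : ℝ) {ρ : ℝ}
    (hρ : ρ₀ ≤ ρ) : h s ρ + 1 ≤ 2 * (h s ρ₀ + 1) + 2 * κ * ρ ^ 2 := by
  obtain ⟨c, hc, hinf⟩ := hh.inf_pos
  have hpos : ∀ x ∈ Ici ρ₀, 0 < h s x + 1 := fun x hx => by linarith [hinf s x hx]
  have hd : ∀ x ∈ Ioi ρ₀, HasDerivAt (fun x => Real.sqrt (h s x + 1) - Real.sqrt κ * x)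
      (dRho ρ₀ h s x / (2 * Real.sqrt (h s x + 1)) - Real.sqrt κ) x := fun x (hx : ρ₀ < x) =>
    ((((hh.hasDerivAt s hx).add_const 1).sqrt (hpos x hx.le).ne').sub
      ((hasDerivAt_id x).const_mul (Real.sqrt κ))).congr_deriv (by rw [mul_one])
  have hcont : ContinuousOn (h s) (Ici ρ₀) :=
    hh.smooth.continuousOn.comp (f := fun x : ℝ => (s, x)) (by fun_prop)
      fun x hx => ⟨mem_univ _, hx⟩
  have hanti : AntitoneOn (fun x => Real.sqrt (h s x + 1) - Real.sqrt κ * x) (Ici ρ₀) := by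
    refine antitoneOn_of_deriv_nonpos (convex_Ici ρ₀) (by fun_prop) (fun x hx => ?_)
      fun x hx => ?_
    · rw [interior_Ici] at hx
      exact (hd x hx).differentiableAt.differentiableWithinAt
    · rw [interior_Ici] at hx
      have hx' : x ∈ Ici ρ₀ := (show ρ₀ < x from hx).le
      rw [(hd x hx).deriv, sub_nonpos]
      have hs := Real.sqrt_pos.2 (hpos x hx')
      rw [div_le_iff₀ (by positivity)]
      have h1 := hh.dRho_le s x hx'
      rw [sq_abs] at h1
      have h2 : dRho ρ₀ h s x ≤ Real.sqrt κ * Real.sqrt (h s x + 1) := by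
        rw [← Real.sqrt_mul hκ.le]
        exact Real.le_sqrt_of_sq_le h1
      nlinarith [Real.sqrt_nonneg κ]
  have h1 := hanti (mem_Ici.2 le_rfl) hρ hρ
  simp only at h1
  have h2 := Real.sq_sqrt (hpos ρ hρ).le
  have h3 := Real.sq_sqrt (hpos ρ₀ (mem_Ici.2 le_rfl)).le
  have h4 := Real.sq_sqrt hκ.le
  have h5 : Real.sqrt (h s ρ + 1) ≤ Real.sqrt (h s ρ₀ + 1) + Real.sqrt κ * ρ := by
    nlinarith [Real.sqrt_nonneg κ]
  have h6 := pow_le_pow_left₀ (Real.sqrt_nonneg _) h5 2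
  nlinarith [sq_nonneg (Real.sqrt (h s ρ₀ + 1) - Real.sqrt κ * ρ)]

end IsAdmissibleProfile

namespace IsRadialAtInfinity

variable (D : IsRadialAtInfinity C J ρ₀ κ Ham h)
include D

/-- The value `h s ρ₀` is bounded uniformly in `s`, being that of the Hamiltonian on the compact
slice `ρ = ρ₀`. The quadratic growth of the profile gives the rest. -/
theorem exists_ham_add_one_le : ∃ c > 0, ∀ s, ∀ x ∈ C.openEnd ρ₀,
    Ham s x + 1 ≤ c * (1 + (C.radius x) ^ 2) := by
  obtain ⟨c, hc, hle⟩ := D.exists_abs_ham_le (C.isCompact_image_collar D.domain D.boundary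
    (S := {ρ₀}) (by simpa using D.pos) isCompact_singleton)
  refine ⟨2 * (c + 1) + 2 * κ, by have := D.kappa_pos; positivity, fun s x hx => ?_⟩
  obtain ⟨p, ρ, hρ, rfl⟩ := C.mem_collar_target_iff.1 hx.1
  have h1 : ρ₀ ≤ C.radius (C.collar (p, ρ)) := (show ρ₀ < _ from hx.2).le
  have h2 := (abs_le.1 (hle s (C.collar (p, ρ₀)) ⟨(p, ρ₀), by simp, rfl⟩)).2
  rw [D.radial s p ρ₀ le_rfl] at h2
  rw [D.ham_eq hx.1 h1]
  have h3 := D.profile.add_one_le D.kappa_pos D.pos s h1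
  have h4 := D.kappa_pos
  nlinarith [sq_nonneg (C.radius (C.collar (p, ρ)))]

/-- At times of small gradient the multiplier is bounded and the loop stays near the compact
part. -/
theorem exists_bound_of_gradNormSq_lt (A : ℝ) : ∃ δ > 0, ∃ M : ℝ,
    ∀ (u : ℝ → ℝ → X) (η : ℝ → ℝ), IsSolution C.lam J Ham u η → ∀ s,
      |action C.lam (Ham s) (u s) (η s)| ≤ A → gradNormSq C.lam J (Ham s) (u s) (η s) < δ →
      |η s| ≤ M ∧ ∀ t, C.cutoff (ρ₀ + 1) (u s t) ≤ 1 := by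
  have hr : ρ₀ < ρ₀ + 1 := lt_add_one _
  have hr0 : 0 < ρ₀ + 1 := D.pos.trans hr
  -- A loop on which the cutoff at `r = ρ₀ + 1` is at most `1` lies in this set.
  set K : Set X := (C.collar '' (univ ×ˢ Ioi (2 * 1 + 2 * (ρ₀ + 1))))ᶜ with hK
  have hKc : IsCompact K := C.isCompact_compl_image_collar D.domain D.boundary (by positivity)
  obtain ⟨c₀, hc₀, hinf⟩ := D.profile.inf_pos
  obtain ⟨c, hc, hle⟩ := exists_sq_le_metricSq C.lam_smooth D.compatible D.smooth hKc
  obtain ⟨θ, hθ, δ, hδ, hstar⟩ := D.exists_le_of_abs_ham_le hKc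
  -- The bounds `1` and `c₀` confine the loop to `K`. The last bound makes `|H| ≤ δ` along it, as
  -- required for the lower bound on `λ(X_H) - H`.
  set ε := min (min 1 c₀) (δ / (1 + (c + 1) / 2))
  have hε : 0 < ε := by positivity
  have hε1 : ε ≤ 1 := (min_le_left _ _).trans (min_le_left _ _)
  have hε2 : ε ≤ c₀ := (min_le_left _ _).trans (min_le_right _ _)
  have hε3 : ε * (1 + (c + 1) / 2) ≤ δ := by
    rw [← le_div_iff₀ (by positivity)]
    exact min_le_right _ _
  refine ⟨ε ^ 2, by positivity, (A + (c + 1) / 2) / θ, fun u η sol s hA hG => ?_⟩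
  have hG1 : gradNormSq C.lam J (Ham s) (u s) (η s) ≤ 1 :=
    hG.le.trans (pow_le_one₀ hε.le hε1)
  have hq : ∀ t ∈ Icc (0 : ℝ) 1, C.cutoff (ρ₀ + 1) (u s t) ≤ 1 := fun t ht =>
    D.cutoff_le_one sol hr hc₀ hinf hG1 (hG.trans_le (pow_le_pow_left₀ hε.le hε2 2)) ht
  have huK : ∀ t ∈ Icc (0 : ℝ) 1, u s t ∈ K := fun t ht =>
    C.mem_compl_image_collar_of_cutoff_le hr0 (hq t ht)
  constructor
  · refine D.abs_multiplier_le_of_starshaped sol hθ huK hc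
      (fun t ht x hx v => (hle 0 (by simp) t ht x hx v).2) hG1 (fun t ht => ?_) hA
    refine hstar s _ (huK t ht) (le_trans ?_ hε3)
    refine D.abs_ham_le sol hε huK hc (fun s t ht x hx v => ?_) hG.le ht
    obtain ⟨σ, hσ, he⟩ := D.exists_ham_eq s
    rw [he]
    exact (hle σ hσ t ht x hx v).1
  · intro t
    have hp : Function.Periodic (u s) 1 := sol.periodic s
    obtain ⟨t', ht', he⟩ := hp.exists_mem_Ico₀ one_pos t
    rw [he]
    exact hq t' ⟨ht'.1, ht'.2.le⟩

variable {u : ℝ → ℝ → X} {η : ℝ → ℝ} (sol : IsSolution C.lam J Ham u η) {E : ℝ}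
  (hi : Integrable (fun s => gradNormSq C.lam J (Ham s) (u s) (η s)))
  (hE : ∫ s, gradNormSq C.lam J (Ham s) (u s) (η s) ≤ E)
include sol hi hE

theorem intervalIntegral_gradNormSq_le {a b : ℝ} (hab : a ≤ b) :
    ∫ s in a..b, gradNormSq C.lam J (Ham s) (u s) (η s) ≤ E := by
  rw [intervalIntegral.integral_of_le hab]
  exact (setIntegral_le_integral hi
    (Filter.Eventually.of_forall fun s => D.gradNormSq_nonneg sol s)).trans hE

/-- The derivative of `η` is the mean of `H`, bounded in absolute value by `(1 + G)/2`, whose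
integral over the window is at most `(L + E)/2`. -/
theorem abs_multiplier_le {M L : ℝ} {s a : ℝ} (ha : a ∈ Icc s (s + L)) (hM : |η a| ≤ M) :
    |η s| ≤ M + (L + E) / 2 := by
  have hL : s ≤ s + L := ha.1.trans ha.2
  have hGc := D.continuous_gradNormSq sol
  have hc : Continuous fun s => ∫ t in (0 : ℝ)..1, Ham s (u s t) :=
    intervalIntegral.continuous_parametric_intervalIntegral_of_continuous'
      (sol.continuous_ham D.compatible D.smooth) 0 1
  have h1 := abs_sub_le_integral sol.multiplier_eq hc ha (left_mem_Icc.2 hL)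
  have h2 : ∫ z in s..(s + L), |∫ t in (0 : ℝ)..1, Ham z (u z t)| ≤
      ∫ z in s..(s + L), (1 + gradNormSq C.lam J (Ham z) (u z) (η z)) / 2 := by
    refine intervalIntegral.integral_mono_on hL (hc.abs.intervalIntegrable _ _)
      (Continuous.intervalIntegrable (by fun_prop) _ _) fun z _ => ?_
    have h3 := D.sq_integral_ham_le sol z
    have h4 := sq_abs (∫ t in (0 : ℝ)..1, Ham z (u z t))
    nlinarith [sq_nonneg (|∫ t in (0 : ℝ)..1, Ham z (u z t)| - 1)]
  rw [intervalIntegral.integral_div, intervalIntegral.integral_add (by simp)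
    (hGc.intervalIntegrable _ _), intervalIntegral.integral_const, smul_eq_mul] at h2
  have h3 := D.intervalIntegral_gradNormSq_le sol hi hE hL
  have h4 := abs_sub_abs_le_abs_sub (η s) (η a)
  linarith

theorem integral_cutoff_le {r : ℝ} (hr : ρ₀ < r) {a b s : ℝ} (hs : s ∈ Icc a b)
    (ha : ∀ t, C.cutoff r (u a t) ≤ 1) :
    ∫ t in (0 : ℝ)..1, C.cutoff r (u s t) ≤ Real.exp ((b - a) / 2) * (1 + E) := by
  have hr0 : 0 < r := D.pos.trans hr
  have he := D.continuous_energyDensity sol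
  have hE0 : 0 ≤ E := (integral_nonneg fun s => D.gradNormSq_nonneg sol s).trans hE
  have h1 := integral_le_exp_mul_of_sq_deriv_le
    (fun s t => D.hasDerivAt_cutoff_fst sol hr0 s t)
    (fun s => continuous_iff_continuousAt.2 fun t =>
      (D.hasDerivAt_cutoff_snd sol hr0 s t).continuousAt) he
    (fun s t => C.cutoff_nonneg r (u s t)) (sol.energyDensity_nonneg D.compatible)
    (fun s t => (D.cutoff_gradient_sq_le sol hr s t).1) hs.1 ha
  have h2 : ∫ x in a..s, ∫ t in (0 : ℝ)..1, energyDensity C.lam J u x t ≤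
      ∫ x in a..s, gradNormSq C.lam J (Ham x) (u x) (η x) :=
    intervalIntegral.integral_mono_on hs.1
      ((intervalIntegral.continuous_parametric_intervalIntegral_of_continuous' he 0 1
        ).intervalIntegrable _ _)
      ((D.continuous_gradNormSq sol).intervalIntegrable _ _)
      fun x _ => D.integral_energyDensity_le sol x
  have h3 := D.intervalIntegral_gradNormSq_le sol hi hE hs.1
  refine h1.trans (mul_le_mul (Real.exp_le_exp.2 (by linarith [hs.2])) (by linarith) ?_
    (Real.exp_pos _).le)
  have h4 : 0 ≤ ∫ x in a..s, ∫ t in (0 : ℝ)..1, energyDensity C.lam J u x t :=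
    intervalIntegral.integral_nonneg hs.1 fun x _ => D.integral_energyDensity_nonneg sol x
  linarith

/-- The mean of `q` is bounded by the Gronwall estimate, and its oscillation in `t` by that mean and
the energy at time `s`. The result is not uniform in `s`, but its right side has bounded integral
over bounded intervals. -/
theorem cutoff_sq_le {r : ℝ} (hr : ρ₀ < r) {a b s : ℝ} (hs : s ∈ Icc a b)
    (ha : ∀ t, C.cutoff r (u a t) ≤ 1) (t : ℝ) :
    (C.cutoff r (u s t)) ^ 2 ≤ (3 / 2 * (Real.exp ((b - a) / 2) * (1 + E) + 1)) ^ 2 *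
      (1 + gradNormSq C.lam J (Ham s) (u s) (η s)) := by
  have hr0 : 0 < r := D.pos.trans hr
  have hp : Function.Periodic (u s) 1 := sol.periodic s
  obtain ⟨t', ht', he⟩ := hp.exists_mem_Ico₀ one_pos t
  rw [he]
  have hφ := D.integral_cutoff_le sol hi hE hr hs ha
  have hG0 := D.gradNormSq_nonneg sol s
  have hG := D.integral_energyDensity_le sol s
  have hφ0 : 0 ≤ ∫ t in (0 : ℝ)..1, C.cutoff r (u s t) :=
    intervalIntegral.integral_nonneg zero_le_one fun t _ => C.cutoff_nonneg r _
  set G := gradNormSq C.lam J (Ham s) (u s) (η s)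
  -- With this weight the energy term is at most `α` as well, and `α ≥ 1` absorbs the mean. Thus `q`
  -- is at most a constant times `√(1 + G)`.
  set α := Real.sqrt (1 + G) with hα
  have hα2 : α ^ 2 = 1 + G := Real.sq_sqrt (by linarith)
  have hα1 : 1 ≤ α := Real.one_le_sqrt.2 (by linarith)
  have hc : Continuous fun τ =>
      fderiv ℝ (fun p : ℝ × ℝ => C.cutoff r (u p.1 p.2)) (s, τ) (0, 1) := by
    have := D.continuous_fderiv_cutoff sol hr0
    fun_prop
  have h1 := le_integral_of_sq_deriv_le (D.hasDerivAt_cutoff_snd sol hr0 s) hc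
    (D.continuous_energyDensity_snd sol s) (fun t => C.cutoff_nonneg r _)
    (fun t => sol.energyDensity_nonneg D.compatible s t)
    (fun t => (D.cutoff_gradient_sq_le sol hr s t).2) (zero_lt_one.trans_le hα1)
    (⟨ht'.1, ht'.2.le⟩ : t' ∈ Icc (0 : ℝ) 1)
  have h2 : (∫ t in (0 : ℝ)..1, energyDensity C.lam J u s t) / α ≤ α := by
    rw [div_le_iff₀ (by linarith)]
    nlinarith
  set φ := ∫ t in (0 : ℝ)..1, C.cutoff r (u s t)
  set Φ := Real.exp ((b - a) / 2) * (1 + E)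
  rw [← hα2, ← mul_pow]
  refine pow_le_pow_left₀ (C.cutoff_nonneg r _) (h1.trans ?_) 2
  have h3 : φ * α ≤ Φ * α := by gcongr
  nlinarith

end IsRadialAtInfinity

end Bounds

/-! ### The differential inequality for `log ρ` and the compactness theorem. -/

section Confinement

theorem le_half_add_sq (x : ℝ) : x ≤ ((1 + x) / 2) ^ 2 := by
  nlinarith [sq_nonneg (1 - x)]

theorem one_add_sq_le {q r f Φ G : ℝ} (hf : 0 ≤ f) (hle : f ≤ 2 * q + 2 * r)
    (hG : 0 ≤ G) (hqG : q ^ 2 ≤ Φ * (1 + G)) :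
    1 + f ^ 2 ≤ (1 + 8 * r ^ 2 + 8 * Φ) * (1 + G) := by
  have h1 := pow_le_pow_left₀ hf hle 2
  nlinarith [sq_nonneg (q - r), mul_nonneg (sq_nonneg r) hG]

variable {n : ℕ} [NeZero (2 * n)]
  {W : Type*} [TopologicalSpace W] [ChartedSpace (EuclideanHalfSpace (2 * n)) W]
  [IsManifold (𝓡∂ (2 * n)) ∞ W]
  {P : Type*} [TopologicalSpace P] [ChartedSpace (EuclideanSpace ℝ (Fin (2 * n - 1))) P]
  [IsManifold (𝓡 (2 * n - 1)) ∞ P]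
  {X : Type*} [TopologicalSpace X] [T2Space X] [ChartedSpace (EuclideanSpace ℝ (Fin (2 * n))) X]
  [IsManifold (𝓡 (2 * n)) ∞ X]
  {lamW : OneForm (𝓡∂ (2 * n)) (M := W)} {b : P → W}
  {C : Completion lamW b X} {J : EndLoop (2 * n) X} {ρ₀ κ : ℝ}
  {Ham : ℝ → X → ℝ} {h : ℝ → ℝ → ℝ}

/-- The right side makes sense everywhere and equals `log r` where the cutoff vanishes, so it
extends `log ρ` continuously to the whole cylinder. -/
theorem Completion.log_radius_of_mem_openEnd (C : Completion lamW b X) {r : ℝ} (hr : 0 < r) {x : X}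
    (hx : x ∈ C.openEnd r) :
    Real.log (C.radius x) = 2 * Real.log (Real.sqrt (C.cutoff r x) + Real.sqrt r) := by
  have h1 : Real.sqrt r ≤ Real.sqrt (C.radius x) :=
    Real.sqrt_le_sqrt (show r < C.radius x from hx.2).le
  rw [C.cutoff_of_mem_target hr hx.1, max_eq_left (by linarith), Real.sqrt_sq (by linarith),
    sub_add_cancel, Real.log_sqrt (C.radius_pos hx.1).le]
  ring

namespace IsRadialAtInfinity

variable (D : IsRadialAtInfinity C J ρ₀ κ Ham h)
  {u : ℝ → ℝ → X} {η : ℝ → ℝ} (sol : IsSolution C.lam J Ham u η)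
include D sol

/-- The Laplacian of `log ρ` along a solution, up to a first order term, is bounded below. -/
theorem laplacian_log_radius_ge {s t : ℝ} (hx : u s t ∈ C.openEnd ρ₀) {N c T : ℝ}
    (hN : |η s| ≤ N) (hc : -c ≤ ∫ τ in (0 : ℝ)..1, Ham s (u s τ)) (hc0 : 0 ≤ c) (hT : 0 ≤ T)
    (hκ : κ * (Ham s (u s t) + 1) ≤ T ^ 2) :
    ∃ zs zt : ℝ → ℝ, ∃ zss ztt : ℝ,
      (∀ᶠ σ in nhds s, HasDerivAt (fun σ => Real.log (C.radius (u σ t))) (zs σ) σ) ∧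
      HasDerivAt zs zss s ∧
      (∀ᶠ τ in nhds t, HasDerivAt (fun τ => Real.log (C.radius (u s τ))) (zt τ) τ) ∧
      HasDerivAt zt ztt t ∧ -((c + N) * T * (1 + |zs s|)) ≤ zss + ztt := by
  obtain ⟨fss, ftt, hfss, hftt, hlap⟩ := D.laplacian_radius sol hx
  have hf := C.radius_pos hx.1
  have hev := D.eventually_mem_openEnd sol hx
  have hρ : C.radius (u s t) ≥ ρ₀ := (show ρ₀ < C.radius (u s t) from hx.2).le
  have hgrad := D.radius_gradient_sq_le sol hx
  have hs := D.hasDerivAt_radius_fst sol hx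
  have ht := D.hasDerivAt_radius_snd sol hx
  have h1 := D.profile.monotone s _ hρ
  have h2 := D.profile.dRho_le s _ hρ
  have h3 := D.profile.dRhoRho_le s _ hρ
  have h4 := D.profile.dSRho_le s _ hρ
  rw [← D.ham_eq hx.1 hρ s] at h2 h3 h4
  rw [← mul_pow] at h3
  have hN0 : 0 ≤ N := (abs_nonneg _).trans hN
  refine ⟨fun σ => differential C.radius (u σ t) (velS (m := 2 * n) u σ t) / C.radius (u σ t),
    fun τ => differential C.radius (u s τ) (velT (m := 2 * n) u s τ) / C.radius (u s τ), _, _,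
    ?_, hfss.div hs hf.ne', ?_, hftt.div ht hf.ne', ?_⟩
  · filter_upwards [(show ContinuousAt (fun σ : ℝ => (σ, t)) s by fun_prop).eventually hev]
      with σ hσ
    exact (D.hasDerivAt_radius_fst sol hσ).log (C.radius_pos hσ.1).ne'
  · filter_upwards [(show ContinuousAt (fun τ : ℝ => (s, τ)) t by fun_prop).eventually hev]
      with τ hτ
    exact (D.hasDerivAt_radius_snd sol hτ).log (C.radius_pos hτ.1).ne'
  · set f := C.radius (u s t)
    set fs := differential C.radius (u s t) (velS (m := 2 * n) u s t)
    set ft := differential C.radius (u s t) (velT (m := 2 * n) u s t)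
    set I := ∫ τ in (0 : ℝ)..1, Ham s (u s τ)
    set h' := dRho ρ₀ h s f
    set h'' := dRho ρ₀ (dRho ρ₀ h) s f
    set hs' := deriv (fun σ => dRho ρ₀ h σ f) s
    set e := energyDensity C.lam J u s t
    -- The first quotient on the right is nonnegative by the gradient bound and is dropped below.
    have e1 : (fss * f - fs * fs) / f ^ 2 + (ftt * f - ft * ft) / f ^ 2 =
        (f * e - (fs ^ 2 + ft ^ 2)) / f ^ 2 +
          (I * h' + η s * hs' + η s * (f * h'') * (fs / f)) := by
      have : fss = e + I * (f * h') + η s * (f * hs') + η s * (f * h'' * fs) - ftt := by linarith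
      rw [this]
      field_simp
      ring
    rw [e1]
    have e2 : 0 ≤ (f * e - (fs ^ 2 + ft ^ 2)) / f ^ 2 := div_nonneg (by linarith) (by positivity)
    have b1 : |h'| ≤ T := abs_le_of_sq_le_sq (by rw [← sq_abs]; linarith) hT
    have b2 : |hs'| ≤ T := abs_le_of_sq_le_sq (by rw [← sq_abs]; linarith) hT
    have b3 : |f * h''| ≤ T := by
      rw [abs_mul, abs_of_pos hf]
      exact (abs_le_of_sq_le_sq' (by linarith) hT).2
    -- Because `h' ≥ 0`, only a lower bound for the mean of the Hamiltonian is needed.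
    have c1 : -(c * T) ≤ I * h' := by
      have := (abs_le.1 b1).2
      nlinarith
    have c2 : -(N * T) ≤ η s * hs' := by
      have : |η s * hs'| ≤ N * T := by rw [abs_mul]; gcongr
      exact (abs_le.1 this).1
    have c3 : -(N * T * |fs / f|) ≤ η s * (f * h'') * (fs / f) := by
      have : |η s * (f * h'') * (fs / f)| ≤ N * T * |fs / f| := by
        rw [abs_mul, abs_mul]; gcongr
      exact (abs_le.1 this).1
    have c4 : 0 ≤ c * T * |fs / f| := by positivity
    linarith

/-- A bound on the radial coordinate over a strip whose ends lie near the compact part. -/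
theorem cutoff_le_exp {r a d N c c₂ : ℝ} (hr : ρ₀ < r) (hqa : ∀ t, C.cutoff r (u a t) ≤ 1)
    (hqd : ∀ t, C.cutoff r (u d t) ≤ 1) (hη : ∀ s, |η s| ≤ N) (hc : 0 ≤ c)
    (hH : ∀ s x, -c ≤ Ham s x) (hc₂ : 0 ≤ c₂)
    (hgrow : ∀ s ∈ Ioo a d, ∀ t, u s t ∈ C.openEnd r →
      Ham s (u s t) + 1 ≤ c₂ * (1 + gradNormSq C.lam J (Ham s) (u s) (η s)))
    {s : ℝ} (hs : s ∈ Icc a d) (t : ℝ) :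
    C.cutoff r (u s t) ≤ Real.exp (2 * Real.log (1 + Real.sqrt r) +
      (d - a) * Real.exp (((c + N) * ((1 + κ * c₂) / 2) + 1) *
        ∫ x in a..d, (1 + gradNormSq C.lam J (Ham x) (u x) (η x)))) := by
  have hr0 : 0 < r := D.pos.trans hr
  have hN : 0 ≤ N := (abs_nonneg _).trans (hη 0)
  have hκ := D.kappa_pos
  have hG0 := fun s => D.gradNormSq_nonneg sol s
  have hGc := D.continuous_gradNormSq sol
  set G : ℝ → ℝ := fun s => gradNormSq C.lam J (Ham s) (u s) (η s) with hG
  set m := 2 * Real.log (1 + Real.sqrt r)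
  -- `Z` is `log ρ` on the end and `log r` off it; `m` is its value where the cutoff equals `1`.
  -- Thus `Z > m` occurs only inside the end, where the differential inequality holds.
  let Z : ℝ → ℝ → ℝ := fun s t =>
    2 * Real.log (Real.sqrt (C.cutoff r (u s t)) + Real.sqrt r)
  have hsr := Real.sqrt_pos.2 hr0
  have hZpos : ∀ s t, 0 < Real.sqrt (C.cutoff r (u s t)) + Real.sqrt r := fun s t =>
    add_pos_of_nonneg_of_pos (Real.sqrt_nonneg _) hsr
  have hZm : ∀ {s t}, C.cutoff r (u s t) ≤ 1 → Z s t ≤ m := fun {s t} hq => by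
    have h1 : Real.sqrt (C.cutoff r (u s t)) ≤ 1 := Real.sqrt_le_one.2 hq
    exact mul_le_mul_of_nonneg_left (Real.log_le_log (hZpos s t) (by linarith)) (by norm_num)
  have hlog : ∀ {s t}, u s t ∈ C.openEnd r → ∀ᶠ p : ℝ × ℝ in nhds (s, t),
      Z p.1 p.2 = Real.log (C.radius (u p.1 p.2)) := fun {s t} hx => by
    filter_upwards [sol.smooth.continuous.continuousAt.eventually
      ((C.isOpen_openEnd r).mem_nhds hx)] with p hp
    exact (C.log_radius_of_mem_openEnd hr0 hp).symm
  have hmain : Z s t ≤ m + (d - a) * Real.exp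
      (((c + N) * ((1 + κ * c₂) / 2) + 1) * ∫ x in a..d, (1 + G x)) := by
    refine le_of_laplacian_ge (Z := Z) (K := fun s => 1 + G s) ?_ (fun s t => ?_) (by fun_prop)
      (fun s => by linarith [hG0 s]) (by positivity) (fun t => hZm (hqa t)) (fun t => hZm (hqd t))
      ?_ hs t
    · have h1 : Continuous fun p : ℝ × ℝ => C.cutoff r (u p.1 p.2) :=
        (D.contDiff_cutoff_comp sol hr0).continuous
      exact continuous_const.mul (Continuous.log (by fun_prop) fun p => (hZpos p.1 p.2).ne')
    · simp only [Z, sol.periodic]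
    · intro s hs t hlt
      have hx : u s t ∈ C.openEnd r := by
        refine C.mem_openEnd_of_cutoff_pos hr0 ?_
        by_contra hcon
        exact absurd (hZm (by linarith)) (not_le.2 hlt)
      have hx0 : u s t ∈ C.openEnd ρ₀ := ⟨hx.1, hr.trans hx.2⟩
      -- The chosen `T` bounds the square root and is affine in `1 + G s`, hence at most `(1 + κ
      -- c₂)/2` times `1 + G s`.
      have hT : κ * (Ham s (u s t) + 1) ≤ ((1 + κ * (c₂ * (1 + G s))) / 2) ^ 2 :=
        (mul_le_mul_of_nonneg_left (hgrow s hs t hx) hκ.le).trans (le_half_add_sq _)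
      have hI : -c ≤ ∫ τ in (0 : ℝ)..1, Ham s (u s τ) := by
        have h2 : ∫ _ in (0 : ℝ)..1, -c ≤ _ := intervalIntegral.integral_mono_on zero_le_one
          (by simp) ((D.continuous_ham_snd sol s).intervalIntegrable 0 1) fun τ _ => hH s (u s τ)
        rwa [intervalIntegral.integral_const, sub_zero, one_smul] at h2
      have hGs : 0 ≤ G s := hG0 s
      have hT0 : 0 ≤ (1 + κ * (c₂ * (1 + G s))) / 2 := by positivity
      obtain ⟨zs, zt, zss, ztt, h1, h2, h3, h4, h5⟩ :=
        D.laplacian_log_radius_ge sol hx0 (hη s) hI hc hT0 hT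
      refine ⟨zs, zt, zss, ztt, ?_, h2, ?_, h4, le_trans (neg_le_neg ?_) h5⟩
      · have h6 := (show ContinuousAt (fun σ : ℝ => (σ, t)) s by fun_prop).eventually (hlog hx)
        filter_upwards [h1, h6.eventually_nhds] with σ hσ hσ'
        exact hσ.congr_of_eventuallyEq hσ'
      · have h6 := (show ContinuousAt (fun τ : ℝ => (s, τ)) t by fun_prop).eventually (hlog hx)
        filter_upwards [h3, h6.eventually_nhds] with τ hτ hτ'
        exact hτ.congr_of_eventuallyEq hτ'
      · refine mul_le_mul_of_nonneg_right ?_ (by positivity)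
        rw [mul_assoc]
        refine mul_le_mul_of_nonneg_left ?_ (by positivity)
        linarith
  have h1 : (Real.sqrt (C.cutoff r (u s t)) + Real.sqrt r) ^ 2 ≤ Real.exp (m + (d - a) * Real.exp
      (((c + N) * ((1 + κ * c₂) / 2) + 1) * ∫ x in a..d, (1 + G x))) := by
    rw [← Real.log_le_iff_le_exp (pow_pos (hZpos s t) 2), Real.log_pow]
    exact_mod_cast hmain
  have h2 := Real.sq_sqrt (C.cutoff_nonneg r (u s t))
  refine le_trans ?_ h1
  nlinarith only [h2, hsr, Real.sqrt_nonneg (C.cutoff r (u s t))]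

end IsRadialAtInfinity

/-- Solutions of bounded action and energy stay in a compact set. -/
theorem IsRadialAtInfinity.exists_isCompact (D : IsRadialAtInfinity C J ρ₀ κ Ham h) (A E : ℝ) :
    ∃ K : Set X, IsCompact K ∧
      ∀ (u : ℝ → ℝ → X) (η : ℝ → ℝ), IsSolution C.lam J Ham u η →
        (∀ s, |action C.lam (Ham s) (u s) (η s)| ≤ A) →
        Integrable (fun s => gradNormSq C.lam J (Ham s) (u s) (η s)) →
        ∫ s, gradNormSq C.lam J (Ham s) (u s) (η s) ≤ E → ∀ s t, u s t ∈ K := by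
  obtain ⟨δ, hδ, M, hgood⟩ := D.exists_bound_of_gradNormSq_lt A
  obtain ⟨c, hc, hH⟩ := D.exists_le_ham
  obtain ⟨c₁, hc₁, hgrow⟩ := D.exists_ham_add_one_le
  have hκ := D.kappa_pos
  set r := ρ₀ + 1
  have hr : ρ₀ < r := lt_add_one _
  have hr0 : 0 < r := D.pos.trans hr
  set L := E / δ + 1
  -- The constants are fixed before any solution is given, so `E` may still be negative; the
  -- absolute value ensures `N ≥ 0` regardless.
  set N := |M + (L + E) / 2|
  set Φ := (3 / 2 * (Real.exp ((2 * L) / 2) * (1 + E) + 1)) ^ 2 with hΦ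
  set c₂ := c₁ * (1 + 8 * r ^ 2 + 8 * Φ)
  have hc₂ : 0 ≤ c₂ := by positivity
  set m := 2 * Real.log (1 + Real.sqrt r) + 2 * L * Real.exp
    (((c + N) * ((1 + κ * c₂) / 2) + 1) * (2 * L + E))
  refine ⟨(C.collar '' (univ ×ˢ Ioi (2 * Real.exp m + 2 * r)))ᶜ,
    C.isCompact_compl_image_collar D.domain D.boundary (by positivity),
    fun u η sol hA hi hE s t => C.mem_compl_image_collar_of_cutoff_le hr0 ?_⟩
  have hG0 := fun s => D.gradNormSq_nonneg sol s
  have hGc := D.continuous_gradNormSq sol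
  have hE0 : 0 ≤ E := (integral_nonneg hG0).trans hE
  have hgoodtime := fun s => exists_lt_of_integral_le hGc hG0 hi hE hδ s
  have hη : ∀ s, |η s| ≤ N := fun s => by
    obtain ⟨a, ha, hlt⟩ := hgoodtime s
    exact (D.abs_multiplier_le sol hi hE ha (hgood u η sol a (hA a) hlt).1).trans (le_abs_self _)
  -- Good times on either side of `s`, at most `2 * L` apart.
  obtain ⟨a, ha, hGa⟩ := hgoodtime (s - L)
  obtain ⟨d, hd, hGd⟩ := hgoodtime s
  have hqa := (hgood u η sol a (hA a) hGa).2
  have hqd := (hgood u η sol d (hA d) hGd).2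
  have hL : 0 < L := by positivity
  have has : a ≤ s := by linarith [ha.2]
  have had : d - a ≤ 2 * L := by linarith [ha.1, hd.2]
  refine (D.cutoff_le_exp sol hr hqa hqd hη hc.le hH hc₂ (fun s hs t hx => ?_)
    ⟨has, hd.1⟩ t).trans (Real.exp_le_exp.2 (add_le_add le_rfl (mul_le_mul had
      (Real.exp_le_exp.2 (mul_le_mul_of_nonneg_left ?_ (by positivity))) (Real.exp_pos _).le
      (by positivity))))
  · refine (hgrow s _ ⟨hx.1, hr.trans hx.2⟩).trans ?_
    rw [mul_assoc]
    refine mul_le_mul_of_nonneg_left (one_add_sq_le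
      (C.radius_pos hx.1).le (C.radius_le_cutoff hr0 hx.1) (hG0 s) ?_) hc₁.le
    refine (D.cutoff_sq_le sol hi hE hr (Ioo_subset_Icc_self hs) hqa t).trans
      (mul_le_mul_of_nonneg_right ?_ (by linarith [hG0 s]))
    rw [hΦ]
    gcongr
  · rw [intervalIntegral.integral_add (by simp) (hGc.intervalIntegrable _ _),
      intervalIntegral.integral_const, smul_eq_mul, mul_one]
    linarith [D.intervalIntegral_gradNormSq_le sol hi hE (has.trans hd.1)]

end Confinement

/-! ### Polynomial profiles of degree at most two. -/

section Quadratic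

theorem dRho_of_hasDerivAt {ρ₀ : ℝ} {h : ℝ → ℝ → ℝ} {s ρ d : ℝ} (hd : HasDerivAt (h s) d ρ)
    (hρ : ρ₀ ≤ ρ) : dRho ρ₀ h s ρ = d :=
  hd.hasDerivWithinAt.derivWithin (uniqueDiffOn_Ici ρ₀ ρ hρ)

theorem isAdmissibleProfile_quadratic {a b c ε ρ₀ : ℝ} (ha : 0 ≤ a) (hε : 0 < ε)
    (hmono : ∀ ρ ≥ ρ₀, 0 ≤ 2 * a * ρ + b) (hpos : ∀ ρ ≥ ρ₀, ε ≤ a * ρ ^ 2 + b * ρ + c) :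
    ∃ κ > 0, IsAdmissibleProfile ρ₀ κ (fun _ ρ => a * ρ ^ 2 + b * ρ + c) := by
  have h1 : ∀ s, ∀ ρ ≥ ρ₀, dRho ρ₀ (fun _ ρ => a * ρ ^ 2 + b * ρ + c) s ρ = 2 * a * ρ + b :=
    fun s ρ hρ => dRho_of_hasDerivAt (((((hasDerivAt_pow 2 ρ).const_mul a).add
      ((hasDerivAt_id ρ).const_mul b)).add_const c).congr_deriv (by norm_num; ring)) hρ
  have h2 : ∀ s, ∀ ρ ≥ ρ₀,
      dRho ρ₀ (dRho ρ₀ (fun _ ρ => a * ρ ^ 2 + b * ρ + c)) s ρ = 2 * a := fun s ρ hρ => by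
    rw [dRho, derivWithin_congr (s := Ici ρ₀) (h1 s) (h1 s ρ hρ)]
    have h3 : HasDerivAt (fun ρ => 2 * a * ρ + b) (2 * a) ρ := by
      simpa using ((hasDerivAt_id ρ).const_mul (2 * a)).add_const b
    exact h3.hasDerivWithinAt.derivWithin (uniqueDiffOn_Ici ρ₀ ρ hρ)
  set κ := 4 * a + b ^ 2 + 4 * a * |c| with hκ
  have hκ0 : 0 ≤ κ := by positivity
  have h4 : ∀ ρ ≥ ρ₀, (2 * a * ρ + b) ^ 2 ≤ κ * (a * ρ ^ 2 + b * ρ + c + 1) := fun ρ hρ => by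
    have h5 := hpos ρ hρ
    set q := a * ρ ^ 2 + b * ρ + c with hq
    have h6 : (2 * a * ρ + b) ^ 2 = 4 * a * q + b ^ 2 - 4 * a * c := by rw [hq]; ring
    have h7 : 0 ≤ (b ^ 2 + 4 * a * |c|) * q := by
      have : 0 ≤ q := hε.le.trans h5
      positivity
    have h8 : a * -c ≤ a * |c| := mul_le_mul_of_nonneg_left (neg_le_abs c) ha
    rw [h6, hκ]
    nlinarith only [h7, h8, ha]
  refine ⟨2 * κ + 2 * b ^ 2 + 1, by positivity, ?_, ?_,
    ⟨ε, hε, fun s ρ hρ => hpos ρ hρ⟩, ?_, ?_, ?_⟩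
  · exact ContDiff.contDiffOn (by fun_prop)
  · intro s ρ hρ
    rw [h1 s ρ hρ]
    exact hmono ρ hρ
  · intro s ρ hρ
    rw [h1 s ρ hρ, sq_abs]
    have h5 : 0 ≤ a * ρ ^ 2 + b * ρ + c + 1 := by linarith [hpos ρ hρ]
    refine (h4 ρ hρ).trans (mul_le_mul_of_nonneg_right ?_ h5)
    nlinarith only [hκ0, sq_nonneg b]
  · intro s ρ hρ
    rw [h2 s ρ hρ, sq_abs]
    have h5 : 0 ≤ a * ρ ^ 2 + b * ρ + c := by linarith [hpos ρ hρ]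
    have h6 := h4 ρ hρ
    have h7 : 0 ≤ b ^ 2 * (a * ρ ^ 2 + b * ρ + c) := by positivity
    have h8 : ρ ^ 2 * (2 * a) ^ 2 ≤ 2 * (2 * a * ρ + b) ^ 2 + 2 * b ^ 2 := by
      nlinarith only [sq_nonneg (2 * a * ρ + 2 * b)]
    nlinarith only [h5, h6, h7, h8]
  · intro s ρ hρ
    have h3 : (fun σ => dRho ρ₀ (fun _ ρ => a * ρ ^ 2 + b * ρ + c) σ ρ) =
        fun _ => 2 * a * ρ + b := funext fun σ => h1 σ ρ hρ
    rw [h3, deriv_const, abs_zero, zero_pow two_ne_zero]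
    have h5 : 0 ≤ a * ρ ^ 2 + b * ρ + c + 1 := by linarith [hpos ρ hρ]
    exact mul_nonneg (by positivity) h5

/-- Beyond the chosen threshold the leading term dominates the absolute values of the lower
coefficients, leaving the leading coefficient as a lower bound. -/
theorem exists_quadratic_pos {a b c : ℝ} (h : 0 < a ∨ a = 0 ∧ (0 < b ∨ b = 0 ∧ 0 < c)) :
    ∃ ρ₁ > 0, ∃ ε > 0, ∀ ρ ≥ ρ₁, 0 ≤ 2 * a * ρ + b ∧ ε ≤ a * ρ ^ 2 + b * ρ + c := by
  have hb := neg_le_abs b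
  have hc := neg_le_abs c
  have hb0 := abs_nonneg b
  have hc0 := abs_nonneg c
  rcases h with ha | ⟨rfl, hb' | ⟨rfl, hc'⟩⟩
  · refine ⟨1 + (|b| + |c|) / a, by positivity, a, ha, fun ρ hρ => ?_⟩
    have h1 : a * (1 + (|b| + |c|) / a) ≤ a * ρ := mul_le_mul_of_nonneg_left hρ ha.le
    rw [mul_add, mul_one, mul_div_cancel₀ _ ha.ne'] at h1
    have h2 : 1 ≤ ρ := le_trans (le_add_of_nonneg_right (by positivity)) hρ
    constructor
    · nlinarith
    · have h3 : a + |c| ≤ a * ρ + b := by linarith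
      nlinarith
  · refine ⟨1 + |c| / b, by positivity, b, hb', fun ρ hρ => ?_⟩
    have h1 : b * (1 + |c| / b) ≤ b * ρ := mul_le_mul_of_nonneg_left hρ hb'.le
    rw [mul_add, mul_one, mul_div_cancel₀ _ hb'.ne'] at h1
    constructor <;> linarith
  · exact ⟨1, one_pos, c, hc', fun ρ _ => by constructor <;> linarith⟩

theorem exists_isAdmissibleProfile_eval (p : Polynomial ℝ) (hp : p.natDegree ≤ 2)
    (hlead : 0 < p.leadingCoeff) :
    ∃ ρ₁ > 0, ∀ ρ₀ ≥ ρ₁, ∃ κ > 0, IsAdmissibleProfile ρ₀ κ (fun _ ρ => p.eval ρ) := by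
  have hcases : 0 < p.coeff 2 ∨
      p.coeff 2 = 0 ∧ (0 < p.coeff 1 ∨ p.coeff 1 = 0 ∧ 0 < p.coeff 0) := by
    rw [Polynomial.leadingCoeff] at hlead
    have h0 : ∀ k, p.natDegree < k → p.coeff k = 0 := fun k hk =>
      Polynomial.coeff_eq_zero_of_natDegree_lt hk
    generalize p.natDegree = d at *
    interval_cases d
    · exact Or.inr ⟨h0 2 (by norm_num), Or.inr ⟨h0 1 (by norm_num), hlead⟩⟩
    · exact Or.inr ⟨h0 2 (by norm_num), Or.inl hlead⟩
    · exact Or.inl hlead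
  have heval : (fun (_ ρ : ℝ) => p.eval ρ) =
      fun _ ρ => p.coeff 2 * ρ ^ 2 + p.coeff 1 * ρ + p.coeff 0 := by
    funext _ ρ
    rw [Polynomial.eval_eq_sum_range' (Nat.lt_succ_of_le hp)]
    simp [Finset.sum_range_succ]
    ring
  obtain ⟨ρ₁, h1, ε, hε, hle⟩ := exists_quadratic_pos hcases
  refine ⟨ρ₁, h1, fun ρ₀ h0 => ?_⟩
  rw [heval]
  exact isAdmissibleProfile_quadratic (hcases.elim le_of_lt fun h => h.1.ge) hε
    (fun ρ hρ => (hle ρ (h0.le.trans hρ)).1) (fun ρ hρ => (hle ρ (h0.le.trans hρ)).2)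

end Quadratic

end RabinowitzFloer

end

theorem mainTheorem6 {n : ℕ} [NeZero (2 * n)]
    {W : Type*} [TopologicalSpace W] [ChartedSpace (EuclideanHalfSpace (2 * n)) W]
    [IsManifold (𝓡∂ (2 * n)) ∞ W]
    {P : Type*} [TopologicalSpace P] [ChartedSpace (EuclideanSpace ℝ (Fin (2 * n - 1))) P]
    [IsManifold (𝓡 (2 * n - 1)) ∞ P]
    {X : Type*} [TopologicalSpace X] [T2Space X]
    [ChartedSpace (EuclideanSpace ℝ (Fin (2 * n))) X] [IsManifold (𝓡 (2 * n)) ∞ X]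
    -- a Liouville domain, its boundary, and its completion
    (lamW : OneForm (𝓡∂ (2 * n)) (M := W)) (hW : IsLiouvilleDomain lamW)
    (b : P → W) (hb : IsBoundaryInclusion n b) (C : Completion lamW b X) :
    -- the compactness statement
    (∀ (J : EndLoop (2 * n) X), IsCompatibleLoop C.lam J →
      ∀ (ρ₀ : ℝ), 0 < ρ₀ →
      -- contact type: `dρ ∘ J_t = lam` on the end
      (∀ t, ∀ w ∈ C.cylEnd ρ₀, ∀ v : TangentSpace (𝓡 (2 * n)) w,
        mfderiv (𝓡 (2 * n)) 𝓘(ℝ, ℝ) C.radius w (J t w v) = C.lam w v) →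
      ∀ (Ham : ℝ → X → ℝ),
      ContMDiff (𝓘(ℝ, ℝ).prod (𝓡 (2 * n))) 𝓘(ℝ, ℝ) ∞ (fun p : ℝ × X => Ham p.1 p.2) →
      (∀ s ≤ 0, Ham s = Ham 0) → (∀ s ≥ 1, Ham s = Ham 1) →
      (∃ θ > 0, ∀ s w, Ham s w = 0 →
        C.lam w (C.lam.hamiltonianField (Ham s) w) - Ham s w ≥ θ) →
      ∀ (h : ℝ → ℝ → ℝ) (κ : ℝ), 0 < κ → IsAdmissibleProfile ρ₀ κ h →
      (∀ s (x : P), ∀ ρ ≥ ρ₀, Ham s (C.collar (x, ρ)) = h s ρ) →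
      ∀ A E : ℝ, ∃ K : Set X, IsCompact K ∧
        ∀ (u : ℝ → ℝ → X) (η : ℝ → ℝ), IsSolution C.lam J Ham u η →
          (∀ s, |action C.lam (Ham s) (u s) (η s)| ≤ A) →
          Integrable (fun s => gradNormSq C.lam J (Ham s) (u s) (η s)) →
          ∫ s, gradNormSq C.lam J (Ham s) (u s) (η s) ≤ E →
          ∀ s t, u s t ∈ K)
    -- polynomials of degree at most two with positive leading coefficient are admissible
    ∧ (∀ p : Polynomial ℝ, p.natDegree ≤ 2 → 0 < p.leadingCoeff →
        ∃ ρ₁ > 0, ∀ ρ₀ ≥ ρ₁, ∃ κ > 0, IsAdmissibleProfile ρ₀ κ (fun _ ρ => p.eval ρ)) := by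
  refine ⟨fun J hJ ρ₀ hρ₀ hcontact Ham hsmooth hpast hfuture hstar h κ hκ hprofile hradial A E =>
      ?_,
    exists_isAdmissibleProfile_eval⟩
  have D : IsRadialAtInfinity C J ρ₀ κ Ham h :=
    ⟨hW, hb, hJ, hρ₀, hcontact, hsmooth, hpast, hfuture, hstar, hκ, hprofile, hradial⟩
  exact D.exists_isCompact A E
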